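/- **Setting.** Let $K$ be a local field of characteristic $t>0$, with ring of integers $\mathfrak D$, prime element $\mathfrak p$ and residue field of $q=t^c$ elements, and let $dx$ be the Haar measure of $K^+$ with $|\mathfrak D|=1$. Let $1=\zeta_0,\zeta_1,\dots,\zeta_{c-1}\in K$ be such that their $GF(t)$-span is a subfield of $K$ with $q$ elements. For $0\le b<q$, $b=a_0+a_1t+\dots+a_{c-1}t^{c-1}$ with $0\le a_i<t$, put $u(b)=(a_0+a_1\zeta_1+\dots+a_{c-1}\zeta_{c-1})\mathfrak p^{-1}$, and for $n=b_0+b_1q+\dots+b_sq^s$ with $0\le b_k<q$ put $u(n)=u(b_0)+u(b_1)\mathfrak p^{-1}+\dots+u(b_s)\mathfrak p^{-s}$. Let $\chi$ be the continuous unitary character of $K^+$ with $\chi(\zeta_0\mathfrak p^{-1})=e^{2\pi i/t}$ and $\chi(\zeta_i\mathfrak p^{-j})=1$ for all other pairs $(i,j)$, $0\le i<c$, $j\in\mathbb Z$. Put $\chi_n(\xi)=\chi(u(n)\xi)$, and let $\hat f(\xi)=\int_K f(x)\overline{\chi(\xi x)}\,dx$ denote the Fourier transform, extended to $L^2(K)$.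 **Theorem 3.1.** Let $\varphi,\psi_1,\dots,\psi_L\in L^2(K)$ and let $(h^\ell_k)_{k\ge0}$, $0\le\ell\le L$, be complex sequences such that, with convergence in $L^2(K)$, $$\varphi(x)=\sqrt q\sum_{k\ge0}h^0_k\,\varphi(\mathfrak p^{-1}x-u(k)),\qquad \psi_\ell(x)=\sqrt q\sum_{k\ge0}h^\ell_k\,\varphi(\mathfrak p^{-1}x-u(k))\quad(1\le\ell\le L).$$ The masks are the functions $m_\ell=q^{-1/2}\sum_{k\ge0}h^\ell_k\overline{\chi_k}$, so that $\hat\varphi(\xi)=m_0(\mathfrak p\xi)\hat\varphi(\mathfrak p\xi)$ and $\hat\psi_\ell(\xi)=m_\ell(\mathfrak p\xi)\hat\varphi(\mathfrak p\xi)$; their series converge in $L^2(\mathfrak D)$ under the following assumption. Suppose that $\varphi$ generates an MRA, in the sense that $$\sum_{k\ge0}|\hat\varphi(\xi-u(k))|^2=1\ \text{ for a.e. }\xi\in\mathfrak D,\qquad \lim_{j\to\infty}|\hat\varphi(\mathfrak p^j\xi)|=1\ \text{ for a.e. }\xi\in K.$$ Let $$f^\ell_r(\xi)=\sum_{k\ge0}h^\ell_{r+qk}\,\overline{\chi_{qk}(\xi)}\qquad(0\le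 r\le q-1,\ 0\le\ell\le L)$$ be the polyphase components of the masks (the series converging in $L^2(\mathfrak D)$), so that $m_\ell=q^{-1/2}\sum_{r=0}^{q-1}\overline{\chi_r}\,f^\ell_r$, and let $\Gamma(\xi)=\big(f^\ell_r(\xi)\big)_{0\le r\le q-1,\;0\le\ell\le L}$ be the $q\times(L+1)$ polyphase matrix. If $$\Gamma(\xi)\,\Gamma(\xi)^*=I_q\quad\text{for a.e. }\xi\in\mathfrak D,$$ then the wavelet system $$\psi_{\ell,j,k}(x)=q^{j/2}\,\psi_\ell(\mathfrak p^{-j}x-u(k)),\qquad 1\le\ell\le L,\ j\in\mathbb Z,\ k\ge0,$$ is a tight frame for $L^2(K)$, and in fact a Parseval frame: $\sum_{\ell=1}^L\sum_{j\in\mathbb Z}\sum_{k\ge0}|\langle f,\psi_{\ell,j,k}\rangle|^2=\|f\|_2^2$ for every $f\in L^2(K)$. -/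

import Mathlib

open MeasureTheory Filter Topology
open scoped ValuativeRel ComplexConjugate Matrix

/-- A prime element of a local field: an element of maximal absolute value in the prime ideal
`{x : |x| < 1}`. -/
def IsPrimeElement {K : Type*} [Field K] [ValuativeRel K] (ϖ : K) : Prop :=
  ValuativeRel.valuation K ϖ < 1 ∧
    ∀ x : K, ValuativeRel.valuation K x < 1 →
      ValuativeRel.valuation K x ≤ ValuativeRel.valuation K ϖ

/-- `1 = ζ₀, ζ₁, …, ζ_{c-1}` is a basis, over the prime field `GF(t)`, of a copy of `GF(q)`
inside `K`, where `q = t ^ c`: the `GF(t)`-span of the `ζ i` is a subfield of `K` with `q = t ^ c`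
elements.  (Linear independence follows by counting.) -/
def IsResidueBasis {K : Type*} [Field K] (t q : ℕ) {c : ℕ} [NeZero c] (ζ : Fin c → K) : Prop :=
  q = t ^ c ∧ ζ 0 = 1 ∧
    ∃ F : Subfield K, Nat.card F = q ∧
      ∀ x : K, x ∈ F ↔ ∃ a : Fin c → ℕ, x = ∑ i, (a i : K) * ζ i

/-- The elements `u(b)`, `0 ≤ b < q`: if `b = a₀ + a₁ t + ⋯ + a_{c-1} t ^ (c-1)` with
`0 ≤ a_i < t`, then `u(b) = (a₀ ζ₀ + a₁ ζ₁ + ⋯ + a_{c-1} ζ_{c-1}) ϖ⁻¹`. -/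
def translationDigit {K : Type*} [Field K] (t : ℕ) {c : ℕ} (ζ : Fin c → K) (ϖ : K) (b : ℕ) : K :=
  (∑ i : Fin c, ((b / t ^ (i : ℕ) % t : ℕ) : K) * ζ i) * ϖ⁻¹

/-- The translations `u(n)`, `n ≥ 0`: if `n = b₀ + b₁ q + ⋯ + b_s q ^ s` with `0 ≤ b_k < q`, then
`u(n) = u(b₀) + u(b₁) ϖ⁻¹ + ⋯ + u(b_s) ϖ⁻ˢ`.  (The digits `b_k` with `k > n` vanish, and
`u(0) = 0`.) -/
def translation {K : Type*} [Field K] (t q : ℕ) {c : ℕ} (ζ : Fin c → K) (ϖ : K) (n : ℕ) : K :=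
  ∑ k ∈ Finset.range (n + 1), translationDigit t ζ ϖ (n / q ^ k % q) * (ϖ ^ k)⁻¹

/-- `χ` is the continuous unitary character of `K⁺` with `χ(ζ_i ϖ ^ (-j)) = exp (2πi / t)` if
`i = 0` and `j = 1`, and `χ(ζ_i ϖ ^ (-j)) = 1` for all other `i` and `j : ℤ`. -/
def IsBasicCharacter {K : Type*} [Field K] [TopologicalSpace K] (t : ℕ) {c : ℕ} [NeZero c]
    (ζ : Fin c → K) (ϖ : K) (χ : AddChar K Circle) : Prop :=
  Continuous χ ∧
    ∀ (i : Fin c) (j : ℤ),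
      χ (ζ i * ϖ ^ (-j)) = if i = 0 ∧ j = 1 then Circle.exp (2 * Real.pi / t) else 1

/-- `g ∈ L²(ν)` is the sum of the series `∑ k, e k` in `L²(ν)`. -/
def HasL2Sum {K : Type*} [MeasurableSpace K] (ν : Measure K) (e : ℕ → K → ℂ) (g : K → ℂ) : Prop :=
  MemLp g 2 ν ∧
    Tendsto (fun N : ℕ => eLpNorm (fun x => g x - ∑ k ∈ Finset.range N, e k x) 2 ν) atTop (𝓝 0)

/-- (A representative of) the sum of a series that converges in `L²(ν)`; it is unique up to
`ν`-null sets. -/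
noncomputable def l2Sum {K : Type*} [MeasurableSpace K] (ν : Measure K) (e : ℕ → K → ℂ) : K → ℂ :=
  Classical.epsilon (HasL2Sum ν e)

/-- The Fourier transform `ξ ↦ ∫ f(x) conj (χ(ξ x)) dx` of `f · 1_{ϖ⁻ⁿ𝔇}`, the restriction of `f`
to the compact subgroup `ϖ⁻ⁿ𝔇 = {x : ϖⁿ x ∈ 𝔇}`.  For `f ∈ L²(K)` the integrand is integrable. -/
noncomputable def truncatedFourier {K : Type*} [Field K] [ValuativeRel K] [MeasurableSpace K]
    (μ : Measure K) (ϖ : K) (χ : AddChar K Circle) (f : K → ℂ) (n : ℕ) (ξ : K) : ℂ :=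
  ∫ x in {x : K | ϖ ^ n * x ∈ 𝒪[K]}, f x * conj (χ (ξ * x) : ℂ) ∂μ

/-- (A representative of) the Fourier transform on `L²(K)`: the limit in `L²(K)` of the Fourier
transforms of the restrictions of `f` to `ϖ⁻ⁿ𝔇`, as `n → ∞`. By Plancherel's theorem the limit
exists for every `f ∈ L²(K)`; it is unique up to null sets. -/
noncomputable def fourierL2 {K : Type*} [Field K] [ValuativeRel K] [MeasurableSpace K]
    (μ : Measure K) (ϖ : K) (χ : AddChar K Circle) (f : K → ℂ) : K → ℂ :=
  Classical.epsilon fun g : K → ℂ =>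
    MemLp g 2 μ ∧
      Tendsto (fun n : ℕ => eLpNorm (fun ξ => g ξ - truncatedFourier μ ϖ χ f n ξ) 2 μ) atTop (𝓝 0)

/-- `g(x) = √q ∑_{k ≥ 0} a_k φ(ϖ⁻¹ x - u(k))`, with convergence in `L²(K)`. For `g = φ` this is the
refinement equation with coefficients `a`. Taking Fourier transforms, `ĝ(ξ) = m(ϖ ξ) φ̂(ϖ ξ)` with
the mask `m = q ^ (-1/2) ∑ k, a_k conj χ_{u(k)}`. -/
def SatisfiesTwoScale {K : Type*} [Field K] [MeasurableSpace K] (μ : Measure K) (q : ℕ) (ϖ : K)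
    (u : ℕ → K) (φ : K → ℂ) (a : ℕ → ℂ) (g : K → ℂ) : Prop :=
  HasL2Sum μ (fun k x => (Real.sqrt q : ℂ) * (a k * φ (ϖ⁻¹ * x - u k))) g

/-- The conditions that characterize the generators of an MRA among the refinable functions:
`∑ k, |φ̂(ξ - u(k))|² = 1` for a.e. `ξ ∈ 𝔇`, and `|φ̂(ϖ ^ j ξ)| → 1` as `j → ∞` for a.e. `ξ ∈ K`. -/
def GeneratesMRA {K : Type*} [Field K] [ValuativeRel K] [MeasurableSpace K] (μ : Measure K)
    (ϖ : K) (χ : AddChar K Circle) (u : ℕ → K) (φ : K → ℂ) : Prop :=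
  (∀ᵐ ξ ∂(μ.restrict (𝒪[K] : Set K)),
      HasSum (fun k : ℕ => ‖fourierL2 μ ϖ χ φ (ξ - u k)‖ ^ 2) 1) ∧
    ∀ᵐ ξ ∂μ, Tendsto (fun j : ℕ => ‖fourierL2 μ ϖ χ φ (ϖ ^ j * ξ)‖) atTop (𝓝 1)

/-- The `r`-th polyphase component `ξ ↦ ∑_{k ≥ 0} a_{r + q k} conj (χ_{u(q k)}(ξ))` of the mask
`m = q ^ (-1/2) ∑_{k ≥ 0} a_k conj χ_{u(k)}`; the series converges in `L²(𝔇)` for `a ∈ ℓ²`.  As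
`u(r + q k) = u(r) + u(q k)`, one has
`m(ξ) = q ^ (-1/2) ∑_{r < q} conj (χ_{u(r)}(ξ)) * polyphaseComponent r ξ`. -/
noncomputable def polyphaseComponent {K : Type*} [Field K] [ValuativeRel K] [MeasurableSpace K]
    (μ : Measure K) (q : ℕ) (χ : AddChar K Circle) (u : ℕ → K) (a : ℕ → ℂ) (r : ℕ) : K → ℂ :=
  l2Sum (μ.restrict (𝒪[K] : Set K))
    (fun k ξ => a (r + q * k) * conj (χ (u (q * k) * ξ) : ℂ))

/-- The `q × (L + 1)` polyphase matrix `Γ(ξ)` of the masks with coefficients `h 0, …, h L`. -/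
noncomputable def polyphaseMatrix {K : Type*} [Field K] [ValuativeRel K] [MeasurableSpace K]
    (μ : Measure K) (q : ℕ) (χ : AddChar K Circle) (u : ℕ → K) {L : ℕ}
    (h : Fin (L + 1) → ℕ → ℂ) (ξ : K) : Matrix (Fin q) (Fin (L + 1)) ℂ :=
  Matrix.of fun r ℓ => polyphaseComponent μ q χ u (h ℓ) (r : ℕ) ξ

/-- The wavelet system `ψ_{ℓ,j,k}(x) = q ^ (j/2) ψ_ℓ(ϖ ^ (-j) x - u(k))`, `j ∈ ℤ`, `k ≥ 0`. -/
noncomputable def waveletSystem {K : Type*} [Field K] (q : ℕ) (ϖ : K) (u : ℕ → K) {L : ℕ}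
    (ψ : Fin L → K → ℂ) : Fin L × ℤ × ℕ → K → ℂ :=
  fun i x => (((q : ℝ) ^ ((i.2.1 : ℝ) / 2) : ℝ) : ℂ) * ψ i.1 (ϖ ^ (-i.2.1) * x - u i.2.2)

/-- `F` is a frame for `L²(μ)` with frame bounds `A` and `B`. -/
def IsFrameWithBounds {K ι : Type*} [MeasurableSpace K] (μ : Measure K) (F : ι → K → ℂ)
    (A B : ℝ) : Prop :=
  0 < A ∧ 0 < B ∧ (∀ i, MemLp (F i) 2 μ) ∧
    ∀ f : K → ℂ, MemLp f 2 μ →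
      Summable (fun i => ‖∫ x, f x * conj (F i x) ∂μ‖ ^ 2) ∧
      A * ∫ x, ‖f x‖ ^ 2 ∂μ ≤ ∑' i, ‖∫ x, f x * conj (F i x) ∂μ‖ ^ 2 ∧
      ∑' i, ‖∫ x, f x * conj (F i x) ∂μ‖ ^ 2 ≤ B * ∫ x, ‖f x‖ ^ 2 ∂μ

/-- A tight frame: both frame bounds agree. -/
def IsTightFrame {K ι : Type*} [MeasurableSpace K] (μ : Measure K) (F : ι → K → ℂ) : Prop :=
  ∃ A : ℝ, IsFrameWithBounds μ F A A

/-- A Parseval frame: both frame bounds are `1`. -/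
def IsParsevalFrame {K ι : Type*} [MeasurableSpace K] (μ : Measure K) (F : ι → K → ℂ) : Prop :=
  IsFrameWithBounds μ F 1 1

/-!
The theorem is the unitary extension principle for the local field `K`. Write `φ_{j,k}` and
`ψ_{ℓ,j,k}` for the dilates and translates of `φ` and `ψ_ℓ` on the scale `j`, and let `S_j(f)` and
`W_j(f)` be the sums of `|⟨f, φ_{j,k}⟩|²` over `k` and of `|⟨f, ψ_{ℓ,j,k}⟩|²` over `ℓ` and `k`.

* The first condition on `φ` says that the periodization of `|φ̂|²` is `1`. By Plancherel's theorem
  the functions `φ_{j,k}`, `k ≥ 0`, are orthonormal for each `j`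
  (`IsWaveletLattice.orthonormal_dilate`). Therefore the coefficients of the two-scale equations are
  square-summable, and `⟨f, ψ_{ℓ,j,m}⟩` is a series in the coefficients `⟨f, φ_{j+1,k}⟩`
  (`IsWaveletLattice.twoScale_dilate`).
* In terms of Fourier series on `𝒪[K]`, the passage from the coefficients on the scale `j + 1` to
  those on the scale `j` is multiplication by the adjoint of the polyphase matrix. As `Γ Γᴴ = 1`,
  this is an isometry (`IsWaveletLattice.sum_tsum_enorm_sq_polyphase`), which means that
  `S_j(f) + W_j(f) = S_{j+1}(f)` (`IsWaveletLattice.tsum_inner_dilate_add`).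
* The sum of all `W_j(f)` telescopes. It remains to show that `S_j(f)` tends to `0` as `j → -∞` and
  to `‖f‖²` as `j → ∞`. The `S_j` are the squared norms of orthogonal projections, so it is enough
  to take for `f` the indicator function of a ball. For `j → -∞`, the Cauchy–Schwarz inequality
  bounds `S_j(f)` by the integral of the periodization of `|φ|²` over a ball that shrinks to a point
  (`IsWaveletLattice.tendsto_tsum_dilate_zero`). For `j → ∞`, Plancherel's theorem and Parseval's
  identity on `𝒪[K]` turn `S_j(f)` into `‖f‖²` times the integral of `|φ̂(ϖ ^ m ξ)|²` over `𝒪[K]`,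
  where `m → ∞` with `j`, and the second condition on `φ` applies
  (`IsWaveletLattice.tendsto_tsum_dilate_norm`).

All that is used about `K`, the translations `u` and the character `χ` is collected in the structure
`IsWaveletLattice`. Fourier analysis on `K` is developed from it: the lattice characters are an
orthonormal basis of `L²(𝒪[K])` (`IsWaveletLattice.charBasis`), and Plancherel's theorem on `K`
follows by periodization and rescaling (`IsFourierL2.eLpNorm_eq`).
-/

/-! ### Digits and translations -/

theorem AddChar.map_finset_sum_eq_prod {A M ι : Type*} [AddCommMonoid A] [CommMonoid M]
    (χ : AddChar A M) (s : Finset ι) (f : ι → A) : χ (∑ i ∈ s, f i) = ∏ i ∈ s, χ (f i) :=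
  map_prod χ.toMonoidHom (fun i => Multiplicative.ofAdd (f i)) s

section Algebra

variable {K : Type*} [Field K] [ValuativeRel K]

theorem mem_integer_iff_val {x : K} : x ∈ 𝒪[K] ↔ ValuativeRel.valuation K x ≤ 1 :=
  Valuation.mem_integer_iff _ _

theorem IsPrimeElement.ne_zero [ValuativeRel.IsNontrivial K] {ϖ : K} (hϖ : IsPrimeElement ϖ) :
    ϖ ≠ 0 := by
  rintro rfl
  obtain ⟨r', hr', hr⟩ := Valuation.IsNontrivial.exists_lt_one (v := ValuativeRel.valuation K)
  have := hϖ.2 r' hr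
  simp only [map_zero, le_zero_iff] at this
  exact hr' (by simpa using this)

theorem IsPrimeElement.exists_eq_mul [ValuativeRel.IsNontrivial K] {ϖ : K}
    (hϖ : IsPrimeElement ϖ) {x : K} (hx : ValuativeRel.valuation K x < 1) :
    ∃ y ∈ 𝒪[K], x = ϖ * y := by
  have h0 := hϖ.ne_zero
  refine ⟨ϖ⁻¹ * x, ?_, by field_simp⟩
  have h1 : 0 < ValuativeRel.valuation K ϖ := by simpa [zero_lt_iff] using h0
  rw [mem_integer_iff_val, map_mul, map_inv₀, inv_mul_le_iff₀ h1, mul_one]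
  exact hϖ.2 x hx

/-- A nonzero element of a finite subfield is a root of unity, hence a unit of `𝒪[K]`. -/
theorem Subfield.val_eq_one (F : Subfield K) [Finite F] {x : K} (hx : x ∈ F) (h0 : x ≠ 0) :
    ValuativeRel.valuation K x = 1 := by
  have h1 : (⟨x, hx⟩ : F) ≠ 0 := by simpa [Subtype.ext_iff] using h0
  have : IsOfFinOrder (Units.mk0 (⟨x, hx⟩ : F) h1) := isOfFinOrder_of_finite _
  obtain ⟨n, hn, h⟩ := this.exists_pow_eq_one
  have h' : x ^ n = 1 := by
    have := congrArg (fun y : Fˣ => ((y : F) : K)) h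
    simpa using this
  have h2 : ValuativeRel.valuation K x ^ n = 1 := by rw [← map_pow, h', map_one]
  exact (pow_eq_one_iff_left hn.ne').1 h2

theorem Subfield.mem_integer (F : Subfield K) [Finite F] {x : K} (hx : x ∈ F) : x ∈ 𝒪[K] := by
  by_cases h0 : x = 0
  · subst h0; exact zero_mem _
  · exact mem_integer_iff_val.2 (F.val_eq_one hx h0).le

/-- A subfield with as many elements as the residue field represents all residue classes. -/
theorem Subfield.exists_sub_val_lt_one (F : Subfield K) [Finite F] [Finite 𝓀[K]]
    (hF : Nat.card F = Nat.card 𝓀[K]) {y : K} (hy : y ∈ 𝒪[K]) :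
    ∃ x ∈ F, ValuativeRel.valuation K (y - x) < 1 := by
  let g : F →+* 𝓀[K] := (IsLocalRing.residue 𝒪[K]).comp
    { toFun := fun x => ⟨x, F.mem_integer x.2⟩
      map_one' := rfl
      map_mul' := fun _ _ => rfl
      map_zero' := rfl
      map_add' := fun _ _ => rfl }
  have hg : Function.Bijective g := (Nat.bijective_iff_injective_and_card g).2 ⟨g.injective, hF⟩
  obtain ⟨x, hx⟩ := hg.2 (IsLocalRing.residue 𝒪[K] ⟨y, hy⟩)
  refine ⟨x, x.2, ?_⟩
  have h1 : IsLocalRing.residue 𝒪[K] (⟨y, hy⟩ - ⟨x, F.mem_integer x.2⟩) = 0 := by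
    rw [map_sub, sub_eq_zero]; exact hx.symm
  rw [IsLocalRing.residue_eq_zero_iff] at h1
  refine lt_of_le_of_ne (mem_integer_iff_val.1 (sub_mem hy (F.mem_integer x.2))) fun h2 => ?_
  exact h1 ((Valuation.integer.integers (ValuativeRel.valuation K)).isUnit_of_one' h2)

end Algebra

section Digits

variable {K : Type*} [Field K] {t q c : ℕ} {ζ : Fin c → K} {ϖ : K}

/-- The digit `∑ i, a_i ζ_i` attached to `b = ∑ i, a_i t ^ i`. -/
def finiteFieldDigit {K : Type*} [Field K] (t : ℕ) {c : ℕ} (ζ : Fin c → K) (b : ℕ) : K :=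
  ∑ i : Fin c, ((b / t ^ (i : ℕ) % t : ℕ) : K) * ζ i

@[simp] theorem finiteFieldDigit_zero : finiteFieldDigit t ζ 0 = 0 := by simp [finiteFieldDigit]

/-- The digits of the numbers `b < q` enumerate the finite field spanned by the `ζ i` without
repetition, since their number agrees with its cardinality. -/
theorem IsResidueBasis.exists_subfield [NeZero c] [Fact t.Prime] [CharP K t]
    (hζ : IsResidueBasis t q ζ) :
    ∃ F : Subfield K, Finite F ∧ Nat.card F = q ∧ (∀ b, finiteFieldDigit t ζ b ∈ F) ∧
      (∀ x ∈ F, ∃ b < q, finiteFieldDigit t ζ b = x) ∧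
      (∀ a < q, ∀ b < q, finiteFieldDigit t ζ a = finiteFieldDigit t ζ b → a = b) ∧
      ∀ x ∈ F, ∃ a : Fin c → ℕ, x = ∑ i, (a i : K) * ζ i := by
  obtain ⟨rfl, -, F, hF, hmem⟩ := hζ
  have ht : 0 < t := (Fact.out : t.Prime).pos
  have hpos : 0 < t ^ c := pow_pos ht c
  have hfin : Finite F := Nat.finite_of_card_ne_zero (by omega)
  have hd : ∀ b, finiteFieldDigit t ζ b ∈ F := fun b => (hmem _).2 ⟨_, rfl⟩
  have hs : ∀ x ∈ F, ∃ b < t ^ c, finiteFieldDigit t ζ b = x := by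
    intro x hx
    obtain ⟨a, rfl⟩ := (hmem x).1 hx
    let a' : Fin c → Fin t := fun i => ⟨a i % t, Nat.mod_lt _ ht⟩
    refine ⟨finFunctionFinEquiv a', (finFunctionFinEquiv a').2, ?_⟩
    refine Finset.sum_congr rfl fun i _ => ?_
    congr 1
    have := finFunctionFinEquiv_symm_apply_val (finFunctionFinEquiv a') i
    rw [Equiv.symm_apply_apply] at this
    rw [← this]
    change ((a i % t : ℕ) : K) = _
    exact (CharP.cast_eq_mod K t (a i)).symm
  refine ⟨F, hfin, hF, hd, hs, ?_, fun x hx => (hmem x).1 hx⟩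
  let g : Fin (t ^ c) → F := fun b => ⟨finiteFieldDigit t ζ b, hd b⟩
  have hg : Function.Bijective g := by
    refine (Nat.bijective_iff_surjective_and_card g).2 ⟨?_, by simp [hF]⟩
    rintro ⟨x, hx⟩
    obtain ⟨b, hb, h⟩ := hs x hx
    exact ⟨⟨b, hb⟩, Subtype.ext h⟩
  intro a ha b hb h
  have := @hg.1 ⟨a, ha⟩ ⟨b, hb⟩ (Subtype.ext h)
  simpa using this

theorem translation_zero : translation t q ζ ϖ 0 = 0 := by
  simp [translation, translationDigit]

/-- The sum defining `u(n)` may be extended by vanishing digits. -/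
theorem translation_eq_sum (hq : 2 ≤ q) {n N : ℕ} (h : n < N) :
    translation t q ζ ϖ n =
      ∑ k ∈ Finset.range N, finiteFieldDigit t ζ (n / q ^ k % q) * (ϖ ^ (k + 1))⁻¹ := by
  have h1 : translation t q ζ ϖ n =
      ∑ k ∈ Finset.range (n + 1), finiteFieldDigit t ζ (n / q ^ k % q) * (ϖ ^ (k + 1))⁻¹ := by
    refine Finset.sum_congr rfl fun k _ => ?_
    rw [pow_succ', mul_inv, ← mul_assoc]; rfl
  rw [h1]
  refine Finset.sum_subset (Finset.range_mono h) fun k _ hk => ?_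
  simp only [Finset.mem_range, not_lt] at hk
  have h2 : n < q ^ k := lt_of_lt_of_le (by omega) (Nat.lt_pow_self hq).le
  rw [Nat.div_eq_of_lt h2]
  simp

theorem translation_succ_digit (hq : 2 ≤ q) {r : ℕ} (hr : r < q) (s : ℕ) :
    translation t q ζ ϖ (r + q * s) =
      ϖ⁻¹ * (finiteFieldDigit t ζ r + translation t q ζ ϖ s) := by
  have hs : s ≤ r + q * s := by nlinarith
  rw [translation_eq_sum hq (Nat.lt_succ_self (r + q * s) |>.trans (Nat.lt_succ_self _)),
    Finset.sum_range_succ', translation_eq_sum hq (Nat.lt_succ_of_le hs), mul_add, Finset.mul_sum,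
    add_comm]
  congr 1
  · rw [pow_zero, Nat.div_one, Nat.add_mul_mod_self_left, Nat.mod_eq_of_lt hr]
    ring
  · refine Finset.sum_congr rfl fun k _ => ?_
    rw [pow_succ' q k, ← Nat.div_div_eq_div_mul, Nat.add_mul_div_left _ _ (by omega),
      Nat.div_eq_of_lt hr, zero_add]
    simp only [pow_succ, mul_inv]; ring

end Digits

/-- The properties of the prime element `ϖ`, the character `χ` and the translations `u` on which
the wavelet theory rests: `{u k}` is a discrete subgroup of `K⁺` that represents `K / 𝒪[K]`, it is
compatible with expansions in base `q`, and `χ` is trivial on its products, just as `χ` is trivial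
on `𝒪[K]`; as `χ` is nontrivial on `ϖ⁻¹ 𝒪[K]`, the ring `𝒪[K]` is its own annihilator. -/
structure IsWaveletLattice {K : Type*} [Field K] [ValuativeRel K] [TopologicalSpace K] (ϖ : K)
    (χ : AddChar K Circle) (q : ℕ) (u : ℕ → K) : Prop where
  two_le : 2 ≤ q
  prime : IsPrimeElement ϖ
  ne_zero : ϖ ≠ 0
  map_zero : u 0 = 0
  exists_sub : ∀ m n, ∃ k, u k = u m - u n
  map_digit : ∀ r < q, ∀ s, u (r + q * s) = u r + ϖ⁻¹ * u s
  small : ∀ r < q, ϖ * u r ∈ 𝒪[K]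
  cover : ∀ x, ∃ k, x - u k ∈ 𝒪[K]
  separated : ∀ k l, u k - u l ∈ 𝒪[K] → k = l
  continuous : Continuous χ
  map_integer : ∀ x ∈ 𝒪[K], χ x = 1
  map_inv_prime : χ ϖ⁻¹ ≠ 1
  map_mul : ∀ k l, χ (u k * u l) = 1

section Lattice

variable {K : Type*} [Field K] [ValuativeRel K] [TopologicalSpace K]
  [IsNonarchimedeanLocalField K] {t q c : ℕ} [NeZero c] {ζ : Fin c → K} {ϖ : K}
  {χ : AddChar K Circle}

theorem IsPrimeElement.tendsto_pow_mul (hϖ : IsPrimeElement ϖ) {y : ℕ → K}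
    (hy : ∀ n, y n ∈ 𝒪[K]) : Tendsto (fun n => ϖ ^ n * y n) atTop (𝓝 0) := by
  rw [(IsValuativeTopology.hasBasis_nhds_zero' K).tendsto_right_iff]
  intro γ hγ
  obtain ⟨N, hN⟩ := exists_pow_lt₀ hϖ.1 (Units.mk0 γ hγ)
  filter_upwards [eventually_ge_atTop N] with n hn
  simp only [Units.val_mk0] at hN
  refine lt_of_le_of_lt ?_ hN
  rw [map_mul, map_pow]
  calc _ ≤ ValuativeRel.valuation K ϖ ^ n * 1 := by
        gcongr; exact mem_integer_iff_val.1 (hy n)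
    _ ≤ _ := by rw [mul_one]; exact pow_le_pow_right_of_le_one' hϖ.1.le hn

theorem IsPrimeElement.exists_pow_mul_mem (hϖ : IsPrimeElement ϖ) (x : K) :
    ∃ n : ℕ, ϖ ^ n * x ∈ 𝒪[K] := by
  by_cases hx : x = 0
  · exact ⟨0, by simp [hx]⟩
  have hv : ValuativeRel.valuation K x ≠ 0 := by simpa using hx
  obtain ⟨N, hN⟩ := exists_pow_lt₀ hϖ.1 (Units.mk0 _ hv)⁻¹
  refine ⟨N, mem_integer_iff_val.2 ?_⟩
  rw [map_mul, map_pow]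
  simp only [Units.val_inv_eq_inv_val, Units.val_mk0] at hN
  calc _ ≤ (ValuativeRel.valuation K x)⁻¹ * ValuativeRel.valuation K x := by gcongr
    _ = 1 := inv_mul_cancel₀ hv

/-- Successive residues: every integer is `x₀ + x₁ ϖ + ⋯ + x_{n-1} ϖ ^ (n-1) + ϖ ^ n y`. -/
theorem IsPrimeElement.exists_expansion (hϖ : IsPrimeElement ϖ) (F : Subfield K)
    (hF : ∀ y ∈ 𝒪[K], ∃ x ∈ F, ValuativeRel.valuation K (y - x) < 1) {x : K} (hx : x ∈ 𝒪[K])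
    (n : ℕ) : ∃ a : ℕ → K, (∀ i, a i ∈ F) ∧ ∃ y ∈ 𝒪[K],
      x = ∑ i ∈ Finset.range n, a i * ϖ ^ i + ϖ ^ n * y := by
  induction n with
  | zero => exact ⟨fun _ => 0, fun _ => zero_mem _, x, hx, by simp⟩
  | succ n ih =>
    obtain ⟨a, ha, y, hy, rfl⟩ := ih
    obtain ⟨b, hb, hlt⟩ := hF y hy
    obtain ⟨z, hz, hyz⟩ := hϖ.exists_eq_mul hlt
    refine ⟨fun i => if i = n then b else a i, fun i => ?_, z, hz, ?_⟩
    · dsimp only; split_ifs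
      exacts [hb, ha i]
    · have e : ∑ i ∈ Finset.range n, (if i = n then b else a i) * ϖ ^ i =
          ∑ i ∈ Finset.range n, a i * ϖ ^ i :=
        Finset.sum_congr rfl fun i hi => by rw [if_neg (Finset.mem_range.1 hi).ne]
      simp only [Finset.sum_range_succ, e, if_true]
      rw [pow_succ]; linear_combination ϖ ^ n * hyz

omit [ValuativeRel K] [IsNonarchimedeanLocalField K] in
theorem IsBasicCharacter.map_digit (hχ : IsBasicCharacter t ζ ϖ χ) {x : K}
    (hx : ∃ a : Fin c → ℕ, x = ∑ i, (a i : K) * ζ i) {j : ℤ} (hj : j ≠ 1) :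
    χ (x * ϖ ^ (-j)) = 1 := by
  obtain ⟨a, rfl⟩ := hx
  rw [Finset.sum_mul, AddChar.map_finset_sum_eq_prod]
  refine Finset.prod_eq_one fun i _ => ?_
  rw [mul_assoc, ← nsmul_eq_mul, AddChar.map_nsmul_eq_pow, hχ.2, if_neg (fun h => hj h.2), one_pow]

theorem IsResidueBasis.isWaveletLattice [Fact t.Prime] [CharP K t]
    (hζ : IsResidueBasis t q ζ) (hq : Nat.card 𝓀[K] = q) (hϖ : IsPrimeElement ϖ)
    (hχ : IsBasicCharacter t ζ ϖ χ) :
    IsWaveletLattice ϖ χ q (translation t q ζ ϖ) := by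
  have ht : t.Prime := Fact.out
  have h0 := hϖ.ne_zero
  have hq2 : 2 ≤ q := by
    rw [hζ.1]; exact ht.two_le.trans (Nat.le_self_pow (NeZero.ne c) t)
  obtain ⟨F, hFfin, hFcard, hd, hsurj, hinj, hspan⟩ := hζ.exists_subfield
  have hres : ∀ y ∈ 𝒪[K], ∃ x ∈ F, ValuativeRel.valuation K (y - x) < 1 := fun y hy =>
    F.exists_sub_val_lt_one (hFcard.trans hq.symm) hy
  set u := translation t q ζ ϖ with hu
  have hu0 : u 0 = 0 := translation_zero
  have hrec : ∀ r < q, ∀ s, u (r + q * s) = ϖ⁻¹ * (finiteFieldDigit t ζ r + u s) :=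
    fun r hr s => translation_succ_digit hq2 hr s
  have hur : ∀ r < q, u r = ϖ⁻¹ * finiteFieldDigit t ζ r := fun r hr => by
    have := hrec r hr 0
    simpa [hu0] using this
  have hmod : ∀ n, n % q + q * (n / q) = n := fun n => Nat.mod_add_div n q
  have hlt : ∀ n, n % q < q := fun n => Nat.mod_lt _ (by omega)
  -- the range of `u` consists of the sums `∑ x_j ϖ ^ (-j)`, `j ≥ 1`, with coefficients in `F`
  have hform : ∀ n, ∃ N, ∃ a : ℕ → K, (∀ i, a i ∈ F) ∧
      u n = ∑ k ∈ Finset.range N, a k * ϖ ^ (-((k : ℤ) + 1)) := fun n =>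
    ⟨n + 1, fun k => finiteFieldDigit t ζ (n / q ^ k % q), fun k => hd _, by
      rw [hu, translation_eq_sum hq2 (Nat.lt_succ_self n)]
      refine Finset.sum_congr rfl fun k _ => ?_
      rw [zpow_neg]; norm_cast⟩
  refine ⟨hq2, hϖ, h0, hu0, ?_, ?_, ?_, ?_, ?_, hχ.1, ?_, ?_, ?_⟩
  · intro m
    induction m using Nat.strong_induction_on with
    | _ m ih =>
      intro n
      -- for `m = 0` the recursion runs on `n` instead
      induction n using Nat.strong_induction_on with
      | _ n ihn =>
      by_cases hmn : m = 0 ∧ n = 0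
      · exact ⟨0, by rw [hmn.1, hmn.2, hu0, sub_zero]⟩
      have hrest : ∃ k, u k = u (m / q) - u (n / q) := by
        by_cases hm : m = 0
        · have hn : n / q < n := Nat.div_lt_self (by omega) hq2
          obtain ⟨k, hk⟩ := ihn _ hn
          exact ⟨k, by rw [hk, hm, Nat.zero_div]⟩
        · exact ih _ (Nat.div_lt_self (by omega) hq2) _
      obtain ⟨k, hk⟩ := hrest
      obtain ⟨b, hb, hbeq⟩ := hsurj _ (sub_mem (hd (m % q)) (hd (n % q)))
      refine ⟨b + q * k, ?_⟩
      rw [hrec b hb, hbeq, hk]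
      conv_rhs => rw [← hmod m, ← hmod n, hrec _ (hlt m), hrec _ (hlt n)]
      ring
  · intro r hr s
    rw [hrec r hr, hur r hr]; ring
  · intro r hr
    rw [hur r hr, mul_inv_cancel_left₀ h0]
    exact F.mem_integer (hd r)
  · intro x
    obtain ⟨n, hn⟩ := hϖ.exists_pow_mul_mem x
    induction n generalizing x with
    | zero => exact ⟨0, by simpa [hu0] using hn⟩
    | succ n ih =>
      obtain ⟨k, hk⟩ := ih (ϖ * x) (by rwa [← mul_assoc, ← pow_succ])
      obtain ⟨y, hy, hlt⟩ := hres _ hk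
      obtain ⟨b, hb, rfl⟩ := hsurj y hy
      obtain ⟨z, hz, hyz⟩ := hϖ.exists_eq_mul hlt
      refine ⟨b + q * k, ?_⟩
      have : x - u (b + q * k) = z := by
        rw [hrec b hb]
        field_simp
        linear_combination hyz
      rwa [this]
  · intro k
    induction k using Nat.strong_induction_on with
    | _ k ih =>
      intro l
      induction l using Nat.strong_induction_on with
      | _ l ihl =>
      intro hkl
      by_cases h00 : k = 0 ∧ l = 0
      · rw [h00.1, h00.2]
      have hϖint : ϖ ∈ 𝒪[K] := mem_integer_iff_val.2 hϖ.1.le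
      have e : ϖ * (u k - u l) = (finiteFieldDigit t ζ (k % q) - finiteFieldDigit t ζ (l % q)) +
          (u (k / q) - u (l / q)) := by
        conv_lhs => rw [← hmod k, ← hmod l, hrec _ (hlt k), hrec _ (hlt l)]
        field_simp
        ring
      have hdiff := sub_mem (hd (k % q)) (hd (l % q))
      have h1 : u (k / q) - u (l / q) ∈ 𝒪[K] := by
        rw [← sub_eq_iff_eq_add'.2 e]
        exact sub_mem (mul_mem hϖint hkl) (F.mem_integer hdiff)
      have h2 : k / q = l / q := by
        by_cases hk : k = 0
        · subst hk
          rw [Nat.zero_div] at h1 ⊢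
          exact ihl _ (Nat.div_lt_self (by omega) hq2) h1
        · exact ih _ (Nat.div_lt_self (by omega) hq2) _ h1
      rw [h2, sub_self, add_zero] at e
      have h3 : finiteFieldDigit t ζ (k % q) - finiteFieldDigit t ζ (l % q) = 0 := by
        by_contra h
        have := F.val_eq_one hdiff h
        rw [← e, map_mul] at this
        have h4 : ValuativeRel.valuation K ϖ * ValuativeRel.valuation K (u k - u l) < 1 :=
          mul_lt_one_of_lt_of_le hϖ.1 (mem_integer_iff_val.1 hkl)
        exact h4.ne this
      rw [← hmod k, ← hmod l, h2, hinj _ (hlt k) _ (hlt l) (sub_eq_zero.1 h3)]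
  · intro x hx
    choose a ha y hy hxy using fun n => hϖ.exists_expansion F hres hx n
    have h1 : ∀ n, χ x = χ (ϖ ^ n * y n) := by
      intro n
      conv_lhs => rw [hxy n, AddChar.map_add_eq_mul, AddChar.map_finset_sum_eq_prod]
      rw [Finset.prod_eq_one, one_mul]
      intro i _
      have := hχ.map_digit (hspan _ (ha n i)) (j := -(i : ℤ)) (by omega)
      simpa using this
    have h2 : Tendsto (fun n => χ (ϖ ^ n * y n)) atTop (𝓝 (χ 0)) :=
      (hχ.1.tendsto 0).comp (hϖ.tendsto_pow_mul hy)
    simp_rw [← h1, AddChar.map_zero_eq_one] at h2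
    exact tendsto_nhds_unique tendsto_const_nhds h2
  · have := hχ.2 0 1
    rw [hζ.2.1, one_mul, zpow_neg, zpow_one, if_pos ⟨rfl, rfl⟩] at this
    rw [this, Ne, Circle.exp_eq_one]
    rintro ⟨n, hn⟩
    have ht0 : (t : ℝ) ≠ 0 := by exact_mod_cast ht.ne_zero
    have hpi := Real.pi_ne_zero
    field_simp at hn
    have h2 : (1 : ℤ) = t * n := by exact_mod_cast hn
    have h3 : (t : ℤ) ∣ 1 := ⟨n, h2⟩
    have := Int.le_of_dvd one_pos h3
    have := ht.two_le
    omega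
  · intro k l
    obtain ⟨N, a, ha, hk⟩ := hform k
    obtain ⟨M, b, hb, hl⟩ := hform l
    rw [hk, hl, Finset.sum_mul_sum, AddChar.map_finset_sum_eq_prod]
    refine Finset.prod_eq_one fun i _ => ?_
    rw [AddChar.map_finset_sum_eq_prod]
    refine Finset.prod_eq_one fun j _ => ?_
    have e : a i * ϖ ^ (-((i : ℤ) + 1)) * (b j * ϖ ^ (-((j : ℤ) + 1))) =
        (a i * b j) * ϖ ^ (-((i : ℤ) + j + 2)) := by
      rw [show -((i : ℤ) + j + 2) = -((i : ℤ) + 1) + -((j : ℤ) + 1) by ring, zpow_add₀ h0]; ring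
    rw [e]
    exact hχ.map_digit (hspan _ (mul_mem (ha i) (hb j))) (by omega)

end Lattice

/-! ### Balls, Haar measure and periodization -/

section Balls

set_option linter.unusedSectionVars false

open scoped ENNReal

variable {K : Type*} [Field K] [ValuativeRel K] [TopologicalSpace K]

/-- The ball `a + ϖ ^ n 𝒪[K]`. -/
def integerBall (ϖ a : K) (n : ℤ) : Set K := {x | ϖ ^ (-n) * (x - a) ∈ 𝒪[K]}

theorem integerBall_zero_zero (ϖ : K) : integerBall ϖ 0 0 = (𝒪[K] : Set K) := by
  ext x; simp [integerBall]

theorem mem_integerBall {ϖ a x : K} {n : ℤ} :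
    x ∈ integerBall ϖ a n ↔ ϖ ^ (-n) * (x - a) ∈ 𝒪[K] := Iff.rfl

theorem isOpen_integer [IsNonarchimedeanLocalField K] : IsOpen (𝒪[K] : Set K) := by
  refine AddSubgroup.isOpen_of_mem_nhds (ValuativeRel.valuation K).integer.toAddSubgroup
    (g := 0) ?_
  refine (IsValuativeTopology.hasBasis_nhds_zero' K).mem_iff.2 ⟨1, one_ne_zero, fun x hx => ?_⟩
  exact mem_integer_iff_val.2 (le_of_lt hx)

theorem isCompact_integer [IsNonarchimedeanLocalField K] : IsCompact (𝒪[K] : Set K) :=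
  isCompact_iff_compactSpace.2 (inferInstanceAs (CompactSpace 𝒪[K]))

variable [IsNonarchimedeanLocalField K] [MeasurableSpace K] [BorelSpace K]

theorem measurableSet_integer : MeasurableSet (𝒪[K] : Set K) := isOpen_integer.measurableSet

variable {ϖ : K} {χ : AddChar K Circle} {q : ℕ} {u : ℕ → K}

theorem isOpen_integerBall (ϖ a : K) (n : ℤ) : IsOpen (integerBall ϖ a n) :=
  isOpen_integer.preimage (f := fun x => ϖ ^ (-n) * (x - a)) (by fun_prop)

theorem measurableSet_integerBall (ϖ a : K) (n : ℤ) : MeasurableSet (integerBall ϖ a n) :=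
  (isOpen_integerBall ϖ a n).measurableSet

namespace IsWaveletLattice

variable (H : IsWaveletLattice ϖ χ q u)
include H

theorem q_ne_zero : (q : ℝ≥0∞) ≠ 0 := by
  have := H.two_le
  exact_mod_cast (show q ≠ 0 by omega)

theorem q_pos : 0 < q := by
  have := H.two_le
  omega

theorem prime_mem : ϖ ∈ 𝒪[K] := mem_integer_iff_val.2 H.prime.1.le

theorem zpow_mul_mem {x : K} (hx : x ∈ 𝒪[K]) {n : ℤ} (hn : 0 ≤ n) : ϖ ^ n * x ∈ 𝒪[K] := by
  lift n to ℕ using hn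
  rw [zpow_natCast]
  exact mul_mem (pow_mem H.prime_mem n) hx

theorem integerBall_eq_of_mem {a b : K} {n : ℤ} (h : b ∈ integerBall ϖ a n) :
    integerBall ϖ a n = integerBall ϖ b n := by
  ext x
  simp only [mem_integerBall] at h ⊢
  have e : ϖ ^ (-n) * (x - a) = ϖ ^ (-n) * (x - b) + ϖ ^ (-n) * (b - a) := by ring
  rw [e]
  exact ⟨fun h' => by simpa using sub_mem h' h, fun h' => add_mem h' h⟩

theorem integerBall_mono (a : K) {m n : ℤ} (h : m ≤ n) :
    integerBall ϖ a n ⊆ integerBall ϖ a m := by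
  intro x hx
  rw [mem_integerBall] at hx ⊢
  have := H.zpow_mul_mem hx (n := n - m) (by omega)
  rwa [← mul_assoc, ← zpow_add₀ H.ne_zero, show n - m + -n = -m by ring] at this

theorem mem_integerBall_self (a : K) (n : ℤ) : a ∈ integerBall ϖ a n := by
  simp [mem_integerBall]

/-- Two balls are disjoint or nested. -/
theorem integerBall_inter {a b : K} {m n : ℤ} (h : m ≤ n) :
    integerBall ϖ a m ∩ integerBall ϖ b n = ∅ ∨
      integerBall ϖ a m ∩ integerBall ϖ b n = integerBall ϖ b n := by
  rcases Set.eq_empty_or_nonempty (integerBall ϖ a m ∩ integerBall ϖ b n) with h0 | ⟨x, hxa, hxb⟩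
  · exact Or.inl h0
  · right
    rw [H.integerBall_eq_of_mem hxa, H.integerBall_eq_of_mem hxb]
    exact Set.inter_eq_right.2 (H.integerBall_mono x h)

theorem isTopologicalBasis : TopologicalSpace.IsTopologicalBasis
    (Set.range fun p : ℕ × ℕ => integerBall ϖ (ϖ ^ p.1 * u p.2) (p.1 : ℤ)) := by
  refine TopologicalSpace.isTopologicalBasis_of_isOpen_of_nhds ?_ ?_
  · rintro _ ⟨p, rfl⟩
    exact isOpen_integerBall _ _ _
  · intro x U hx hU
    have h1 : U ∈ 𝓝 x := hU.mem_nhds hx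
    rw [← map_add_left_nhds_zero, Filter.mem_map] at h1
    obtain ⟨γ, hγ, hsub⟩ := (IsValuativeTopology.hasBasis_nhds_zero' K).mem_iff.1 h1
    obtain ⟨N, hN⟩ := exists_pow_lt₀ H.prime.1 (Units.mk0 γ hγ)
    obtain ⟨k, hk⟩ := H.cover (ϖ ^ (-(N : ℤ)) * x)
    have hϖN : ϖ ^ N ≠ 0 := pow_ne_zero _ H.ne_zero
    have hxmem : x ∈ integerBall ϖ (ϖ ^ N * u k) (N : ℤ) := by
      rw [mem_integerBall]
      convert! hk using 1
      rw [zpow_neg, zpow_natCast]; field_simp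
    refine ⟨_, ⟨(N, k), rfl⟩, hxmem, ?_⟩
    simp only
    rw [H.integerBall_eq_of_mem hxmem]
    intro y hy
    have : y - x ∈ (fun y => x + y) ⁻¹' U := by
      apply hsub
      rw [mem_integerBall, zpow_neg, zpow_natCast] at hy
      have h2 := mem_integer_iff_val.1 hy
      have h3 : y - x = ϖ ^ N * ((ϖ ^ N)⁻¹ * (y - x)) := by field_simp
      refine lt_of_le_of_lt ?_ hN
      rw [h3, (ValuativeRel.valuation K).map_mul, map_pow]
      exact mul_le_of_le_one_right' h2
    simpa using this

theorem secondCountableTopology : SecondCountableTopology K :=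
  H.isTopologicalBasis.secondCountableTopology (Set.countable_range _)

theorem exists_neg (k : ℕ) : ∃ l, u l = -u k := by
  obtain ⟨l, hl⟩ := H.exists_sub 0 k
  exact ⟨l, by rw [hl, H.map_zero, zero_sub]⟩

theorem injective : Function.Injective u := fun k l h =>
  H.separated k l (by rw [h, sub_self]; exact zero_mem _)

theorem eq_zero_of_mem {k : ℕ} (hk : u k ∈ 𝒪[K]) : k = 0 :=
  H.separated k 0 (by rwa [H.map_zero, sub_zero])

/-- The translates of `𝒪[K]` by the lattice tile `K`. -/
theorem iUnion_preimage_add : ⋃ k, (fun x => x + u k) ⁻¹' (𝒪[K] : Set K) = Set.univ := by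
  refine Set.eq_univ_of_forall fun x => ?_
  obtain ⟨k, hk⟩ := H.cover x
  obtain ⟨l, hl⟩ := H.exists_neg k
  exact Set.mem_iUnion.2 ⟨l, by
    change x + u l ∈ 𝒪[K]
    rwa [hl, ← sub_eq_add_neg]⟩

theorem pairwise_disjoint_preimage_add :
    Pairwise (Function.onFun Disjoint fun k => (fun x => x + u k) ⁻¹' (𝒪[K] : Set K)) := by
  intro k l hkl
  refine Set.disjoint_left.2 fun x hx hx' => hkl (H.separated k l ?_)
  have := sub_mem (show x + u k ∈ 𝒪[K] from hx) (show x + u l ∈ 𝒪[K] from hx')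
  rwa [add_sub_add_left_eq_sub] at this

theorem measurableEmbedding_affine (j : ℤ) (b : K) :
    MeasurableEmbedding (fun x => ϖ ^ j * x - b) :=
  ((Homeomorph.mulLeft₀ (ϖ ^ j) (zpow_ne_zero _ H.ne_zero)).trans
    (Homeomorph.subRight b)).measurableEmbedding

variable (μ : Measure K) [μ.IsAddHaarMeasure]

/-- Periodization: an integral over `K` is an integral over `𝒪[K]` of a sum over the lattice. -/
theorem lintegral_eq_tsum (F : K → ℝ≥0∞) :
    ∫⁻ x, F x ∂μ = ∑' k, ∫⁻ x in (𝒪[K] : Set K), F (x - u k) ∂μ := by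
  conv_lhs => rw [← Measure.restrict_univ (μ := μ), ← H.iUnion_preimage_add]
  rw [lintegral_iUnion (fun k => measurableSet_integer.preimage (measurable_add_const _))
    H.pairwise_disjoint_preimage_add]
  refine tsum_congr fun k => ?_
  have h1 := (measurePreserving_add_right μ (u k)).setLIntegral_comp_preimage_emb
    (MeasurableEquiv.addRight (u k)).measurableEmbedding (fun x => F (x - u k)) (𝒪[K] : Set K)
  simpa using h1

variable (hμ : μ (𝒪[K] : Set K) = 1)
include hμ

/-- Multiplication by `ϖ` maps Haar measure to a Haar measure, and `𝒪[K]` is the union of `q`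
translates of `ϖ 𝒪[K]`. -/
theorem map_prime_mul : μ.map (fun x => ϖ * x) = (q : ℝ≥0∞) • μ := by
  have := H.secondCountableTopology
  have h0 := H.ne_zero
  let e : K ≃+ K := DistribMulAction.toAddEquiv₀ K ϖ h0
  have hm : Measurable (fun x : K => ϖ * x) := (continuous_const_mul ϖ).measurable
  have : (μ.map (fun x => ϖ * x)).IsAddHaarMeasure := by
    refine e.isAddHaarMeasure_map μ (continuous_const_mul ϖ) ?_
    change Continuous fun x : K => ((Units.mk0 ϖ h0)⁻¹ : Kˣ) • x
    simp only [Units.smul_def, smul_eq_mul]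
    exact continuous_const_mul _
  have h1 := Measure.isAddLeftInvariant_eq_smul (μ.map (fun x => ϖ * x)) μ
  set c := Measure.addHaarScalarFactor (μ.map (fun x => ϖ * x)) μ with hc
  have hball : ∀ a, μ (integerBall ϖ a 1) = μ (integerBall ϖ 0 1) := by
    intro a
    have := measure_preimage_add_right μ (-a) (integerBall ϖ 0 1)
    rw [← this]
    congr 1
    ext x
    simp [integerBall, sub_eq_add_neg]
  have hdec : (𝒪[K] : Set K) = ⋃ r ∈ Finset.range q, integerBall ϖ (ϖ * u r) 1 := by
    ext x
    simp only [Set.mem_iUnion, Finset.mem_range, exists_prop, mem_integerBall]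
    constructor
    · intro hx
      obtain ⟨k, hk⟩ := H.cover (ϖ⁻¹ * x)
      have hkq : k < q := by
        have h1 : ϖ * u k ∈ 𝒪[K] := by
          have := sub_mem hx (mul_mem H.prime_mem hk)
          rwa [mul_sub, mul_inv_cancel_left₀ h0, sub_sub_cancel] at this
        have h2 := H.map_digit (k % q) (Nat.mod_lt _ H.q_pos) (k / q)
        rw [Nat.mod_add_div] at h2
        rw [h2, mul_add, mul_inv_cancel_left₀ h0] at h1
        have h3 := sub_mem h1 (H.small (k % q) (Nat.mod_lt _ H.q_pos))
        rw [add_sub_cancel_left] at h3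
        exact Nat.lt_of_div_eq_zero H.q_pos (H.eq_zero_of_mem h3)
      refine ⟨k, hkq, ?_⟩
      convert! hk using 1
      rw [zpow_neg, zpow_one]; field_simp
    · rintro ⟨r, hr, hx⟩
      have := add_mem (mul_mem H.prime_mem hx) (H.small r hr)
      rw [zpow_neg, zpow_one, mul_inv_cancel_left₀ h0, sub_add_cancel] at this
      exact this
  have h2 : (q : ℝ≥0∞) * μ (integerBall ϖ 0 1) = 1 := by
    rw [← hμ, hdec, measure_biUnion_finset]
    · simp [hball]
    · intro r _ s _ hrs
      refine Set.disjoint_left.2 fun x hx hx' => hrs (H.separated r s ?_)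
      rw [mem_integerBall, zpow_neg, zpow_one] at hx hx'
      convert! sub_mem hx' hx using 1
      field_simp
      ring_nf
    · exact fun r _ => measurableSet_integerBall _ _ _
  have h3 : (c : ℝ≥0∞) * μ (integerBall ϖ 0 1) = 1 := by
    have h4 : μ.map (fun x => ϖ * x) (integerBall ϖ 0 1) = (c • μ) (integerBall ϖ 0 1) :=
      congrArg (fun m : Measure K => m (integerBall ϖ 0 1)) h1
    rw [Measure.map_apply hm (measurableSet_integerBall _ _ _)] at h4
    have h5 : (fun x => ϖ * x) ⁻¹' integerBall ϖ 0 1 = (𝒪[K] : Set K) := by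
      ext x
      simp [integerBall, h0]
    rw [h5, hμ] at h4
    exact h4.symm
  have h4 : (c : ℝ≥0∞) = q := by
    rw [ENNReal.eq_inv_of_mul_eq_one_left h2, ENNReal.eq_inv_of_mul_eq_one_left h3]
  rw [h1, ← h4]
  rfl

theorem map_zpow_mul (j : ℤ) : μ.map (fun x => ϖ ^ j * x) = (q : ℝ≥0∞) ^ j • μ := by
  have h0 := H.ne_zero
  have hq0 := H.q_ne_zero
  have hqt : (q : ℝ≥0∞) ≠ ∞ := ENNReal.natCast_ne_top q
  have hm : ∀ a : K, Measurable (fun x : K => a * x) := fun a => (continuous_const_mul a).measurable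
  have hinv : μ.map (fun x => ϖ⁻¹ * x) = (q : ℝ≥0∞)⁻¹ • μ := by
    have h1 := congrArg (Measure.map (fun x => ϖ⁻¹ * x)) (H.map_prime_mul μ hμ)
    rw [Measure.map_map (hm _) (hm _), Measure.map_smul] at h1
    have h2 : (fun x => ϖ⁻¹ * x) ∘ (fun x => ϖ * x) = id := by
      ext x; simp [h0]
    rw [h2, Measure.map_id] at h1
    conv_rhs => rw [h1]
    rw [smul_smul, ENNReal.inv_mul_cancel hq0 hqt, one_smul]
  induction j using Int.induction_on with
  | zero => simp
  | succ n ih =>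
    have h2 : (fun x => ϖ ^ ((n : ℤ) + 1) * x) = (fun x => ϖ * x) ∘ fun x => ϖ ^ (n : ℤ) * x := by
      ext x
      simp only [Function.comp]
      rw [zpow_add_one₀ h0]; ring
    rw [h2, ← Measure.map_map (hm _) (hm _), ih, Measure.map_smul, H.map_prime_mul μ hμ, smul_smul,
      ENNReal.zpow_add hq0 hqt, zpow_one]
  | pred n ih =>
    have h2 : (fun x => ϖ ^ (-(n : ℤ) - 1) * x) =
        (fun x => ϖ⁻¹ * x) ∘ fun x => ϖ ^ (-(n : ℤ)) * x := by
      ext x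
      simp only [Function.comp]
      rw [zpow_sub_one₀ h0]; ring
    rw [h2, ← Measure.map_map (hm _) (hm _), ih, Measure.map_smul, hinv, smul_smul, sub_eq_add_neg,
      ENNReal.zpow_add hq0 hqt, zpow_neg_one]

/-- The dilation `x ↦ ϖ ^ j x`, followed by a translation, multiplies the measure by `q ^ j`. -/
theorem map_affine (j : ℤ) (b : K) :
    μ.map (fun x => ϖ ^ j * x - b) = (q : ℝ≥0∞) ^ j • μ := by
  have h2 : (fun x => ϖ ^ j * x - b) = (fun x => x + -b) ∘ fun x => ϖ ^ j * x := by
    ext x; simp [sub_eq_add_neg]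
  rw [h2, ← Measure.map_map (measurable_add_const _) (continuous_const_mul _).measurable,
    H.map_zpow_mul μ hμ, Measure.map_smul, map_add_right_eq_self]

theorem lintegral_comp_affine (j : ℤ) (b : K) (F : K → ℝ≥0∞) :
    ∫⁻ x, F (ϖ ^ j * x - b) ∂μ = (q : ℝ≥0∞) ^ j * ∫⁻ x, F x ∂μ := by
  rw [← (H.measurableEmbedding_affine j b).lintegral_map, H.map_affine μ hμ, lintegral_smul_measure,
    smul_eq_mul]

theorem integral_comp_affine (j : ℤ) (b : K) (F : K → ℂ) :
    ∫ x, F (ϖ ^ j * x - b) ∂μ = (q : ℂ) ^ j * ∫ x, F x ∂μ := by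
  rw [← (H.measurableEmbedding_affine j b).integral_map, H.map_affine μ hμ, integral_smul_measure,
    Complex.real_smul]
  congr 1
  cases j <;> simp

theorem measure_integerBall (a : K) (n : ℤ) : μ (integerBall ϖ a n) = (q : ℝ≥0∞) ^ (-n) := by
  have h := H.lintegral_comp_affine μ hμ (-n) (ϖ ^ (-n) * a) ((𝒪[K] : Set K).indicator 1)
  rw [lintegral_indicator_one measurableSet_integer, hμ, mul_one] at h
  rw [← h, ← lintegral_indicator_one (measurableSet_integerBall _ _ _)]
  congr 1
  ext x
  rw [← mul_sub]
  rfl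

theorem measure_integerBall_lt_top (a : K) (n : ℤ) : μ (integerBall ϖ a n) < ∞ := by
  rw [H.measure_integerBall μ hμ]
  exact ENNReal.zpow_lt_top H.q_ne_zero (ENNReal.natCast_ne_top q) _

omit hμ in
/-- A locally integrable function whose integrals over all small balls vanish is zero: the balls
form a π-system that generates the Borel sets. -/
theorem ae_eq_zero_of_setIntegral_integerBall {f : K → ℂ}
    (hf : ∀ a, IntegrableOn f (integerBall ϖ a 0) μ)
    (h0 : ∀ a (n : ℕ), ∫ x in integerBall ϖ a n, f x ∂μ = 0) : f =ᵐ[μ] 0 := by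
  have hcover : ⋃ k, integerBall ϖ (u k) 0 = Set.univ := by
    refine Set.eq_univ_of_forall fun x => ?_
    obtain ⟨k, hk⟩ := H.cover x
    exact Set.mem_iUnion.2 ⟨k, by simpa [mem_integerBall] using hk⟩
  have : ∀ᵐ x ∂μ.restrict (⋃ k, integerBall ϖ (u k) 0), f x = 0 := by
    rw [ae_restrict_iUnion_iff]
    intro k
    refine (hf (u k)).ae_eq_zero_of_forall_setIntegral_eq_zero fun s hs hfin => ?_
    clear hfin
    have := H.secondCountableTopology
    induction s, hs using MeasurableSpace.induction_on_inter
      (BorelSpace.measurable_eq.trans H.isTopologicalBasis.borel_eq_generateFrom) with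
    | h_inter =>
      rintro _ ⟨⟨m, k⟩, rfl⟩ _ ⟨⟨n, l⟩, rfl⟩ hne
      simp only at hne ⊢
      rcases le_total m n with hmn | hmn
      · rcases H.integerBall_inter (a := ϖ ^ m * u k) (b := ϖ ^ n * u l) (Int.ofNat_le.2 hmn) with
          h | h
        · exact absurd h hne.ne_empty
        · exact ⟨(n, l), h.symm⟩
      · rcases H.integerBall_inter (a := ϖ ^ n * u l) (b := ϖ ^ m * u k) (Int.ofNat_le.2 hmn) with
          h | h
        · rw [Set.inter_comm] at h
          exact absurd h hne.ne_empty
        · rw [Set.inter_comm] at h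
          exact ⟨(m, k), h.symm⟩
    | empty => simp
    | basic t ht =>
      obtain ⟨⟨n, l⟩, rfl⟩ := ht
      simp only
      rw [Measure.restrict_restrict (measurableSet_integerBall _ _ _), Set.inter_comm]
      rcases H.integerBall_inter (a := u k) (b := ϖ ^ n * u l) (Int.natCast_nonneg n) with h | h
      · simp [h]
      · rw [h]; exact h0 _ _
    | compl t ht ih =>
      have h1 := integral_add_compl ht (hf (u k))
      have h2 := h0 (u k) 0
      rw [Nat.cast_zero] at h2
      rwa [ih, zero_add, h2] at h1
    | iUnion g hd hm ih =>
      rw [integral_iUnion hm hd (Integrable.integrableOn (hf (u k)))]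
      simp [ih]
  rwa [hcover, Measure.restrict_univ] at this

end IsWaveletLattice

end Balls

/-! ### Square-integrable functions -/

section L2

open scoped ENNReal InnerProductSpace

variable {X : Type*} [MeasurableSpace X] {μ : Measure X} {f g : X → ℂ}

theorem eLpNorm_two_sq (f : X → ℂ) (μ : Measure X) :
    eLpNorm f 2 μ ^ 2 = ∫⁻ x, ‖f x‖ₑ ^ 2 ∂μ := by
  have := eLpNorm_nnreal_pow_eq_lintegral (f := f) (μ := μ) (p := 2) two_ne_zero
  simpa using this

theorem inner_toLp_toLp (hf : MemLp f 2 μ) (hg : MemLp g 2 μ) :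
    ⟪hf.toLp f, hg.toLp g⟫_ℂ = ∫ x, g x * conj (f x) ∂μ := by
  rw [L2.inner_def]
  refine integral_congr_ae ?_
  filter_upwards [hf.coeFn_toLp, hg.coeFn_toLp] with x hx hx'
  rw [hx, hx', RCLike.inner_apply]

theorem enorm_toLp_sq (hf : MemLp f 2 μ) : ‖hf.toLp f‖ₑ ^ 2 = ∫⁻ x, ‖f x‖ₑ ^ 2 ∂μ := by
  rw [Lp.enorm_toLp, eLpNorm_two_sq]

theorem norm_toLp_sq (hf : MemLp f 2 μ) : ‖hf.toLp f‖ ^ 2 = ∫ x, ‖f x‖ ^ 2 ∂μ := by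
  have h1 := inner_toLp_toLp hf hf
  rw [inner_self_eq_norm_sq_to_K] at h1
  have h2 : ∫ x, f x * conj (f x) ∂μ = ((∫ x, ‖f x‖ ^ 2 ∂μ : ℝ) : ℂ) := by
    rw [← integral_complex_ofReal]
    refine integral_congr_ae (ae_of_all _ fun x => ?_)
    simp only
    rw [Complex.mul_conj, Complex.normSq_eq_norm_sq]
  rw [h2] at h1
  exact Complex.ofReal_injective (by rw [Complex.ofReal_pow]; exact h1)

theorem enorm_sq_eq_ofReal {E : Type*} [SeminormedAddGroup E] (z : E) :
    ‖z‖ₑ ^ 2 = ENNReal.ofReal (‖z‖ ^ 2) := by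
  rw [ENNReal.ofReal_pow (norm_nonneg _), ofReal_norm]

/-- Bessel's and Parseval's sums with values in `ℝ≥0∞`. -/
theorem HasSum.tsum_enorm_sq_eq {ι E G : Type*} [SeminormedAddGroup E] [SeminormedAddGroup G]
    {F : ι → E} {y : G} (h : HasSum (fun i => ‖F i‖ ^ 2) (‖y‖ ^ 2)) :
    ∑' i, ‖F i‖ₑ ^ 2 = ‖y‖ₑ ^ 2 := by
  rw [enorm_sq_eq_ofReal y, ← h.tsum_eq,
    ENNReal.ofReal_tsum_of_nonneg (fun i => by positivity) h.summable]
  exact tsum_congr fun i => enorm_sq_eq_ofReal _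

theorem HilbertBasis.hasSum_norm_sq {ι E : Type*} [NormedAddCommGroup E] [InnerProductSpace ℂ E]
    (b : HilbertBasis ι ℂ E) (x : E) : HasSum (fun i => ‖⟪b i, x⟫_ℂ‖ ^ 2) (‖x‖ ^ 2) := by
  have h := b.hasSum_inner_mul_inner x x
  have h1 : ∀ i, ⟪x, b i⟫_ℂ * ⟪b i, x⟫_ℂ = ((‖⟪b i, x⟫_ℂ‖ ^ 2 : ℝ) : ℂ) := by
    intro i
    rw [← inner_conj_symm x (b i), mul_comm, Complex.mul_conj, Complex.normSq_eq_norm_sq]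
  simp_rw [h1] at h
  rw [inner_self_eq_norm_sq_to_K] at h
  exact Complex.hasSum_ofReal.1 (by rw [Complex.ofReal_pow]; exact h)

end L2

/-! ### Characters of the ring of integers -/

section Characters

open scoped ENNReal InnerProductSpace

set_option linter.unusedSectionVars false

variable {K : Type*} [Field K] [ValuativeRel K] [TopologicalSpace K]
  [IsNonarchimedeanLocalField K] [MeasurableSpace K] [BorelSpace K]
  {ϖ : K} {χ : AddChar K Circle} {q : ℕ} {u : ℕ → K}

/-- The conjugate lattice character `ξ ↦ conj (χ (u k ξ))`. -/
noncomputable def latticeChar {K : Type*} [Field K] (χ : AddChar K Circle) (u : ℕ → K) (k : ℕ) :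
    K → ℂ := fun ξ => conj (χ (u k * ξ) : ℂ)

theorem norm_latticeChar (k : ℕ) (x : K) : ‖latticeChar χ u k x‖ = 1 := by
  rw [latticeChar, RCLike.norm_conj]
  exact Circle.norm_coe _

namespace IsWaveletLattice

variable (H : IsWaveletLattice ϖ χ q u)
include H

theorem continuous_char (a : K) : Continuous fun x => (χ (a * x) : ℂ) := by
  have := H.continuous
  fun_prop

variable (μ : Measure K) [μ.IsAddHaarMeasure] (hμ : μ (𝒪[K] : Set K) = 1)
include hμ

theorem isProbabilityMeasure : IsProbabilityMeasure (μ.restrict (𝒪[K] : Set K)) :=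
  ⟨by rw [Measure.restrict_apply_univ, hμ]⟩

/-- The ring of integers is its own annihilator with respect to `χ`. -/
theorem setIntegral_char (ξ : K) :
    ∫ x in (𝒪[K] : Set K), (χ (ξ * x) : ℂ) ∂μ = (𝒪[K] : Set K).indicator 1 ξ := by
  have := H.isProbabilityMeasure μ hμ
  by_cases hξ : ξ ∈ 𝒪[K]
  · rw [Set.indicator_of_mem (by exact hξ), Pi.one_apply]
    rw [setIntegral_congr_fun (g := fun _ => (1 : ℂ)) measurableSet_integer]
    · simp
    · intro x hx
      simp [H.map_integer _ (mul_mem hξ hx)]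
  · rw [Set.indicator_of_notMem (by exact hξ)]
    have hξ0 : ξ ≠ 0 := by rintro rfl; exact hξ (zero_mem _)
    obtain ⟨z, hz, hξz⟩ : ∃ z ∈ 𝒪[K], ξ⁻¹ = ϖ * z := by
      refine H.prime.exists_eq_mul ?_
      rw [mem_integer_iff_val, not_le] at hξ
      rw [map_inv₀]
      exact inv_lt_one_of_one_lt₀ hξ
    have hz' : ξ * z = ϖ⁻¹ := by
      have h0 := H.ne_zero
      field_simp
      rw [mul_assoc, mul_comm z, ← hξz, mul_inv_cancel₀ hξ0]
    have h1 := (measurePreserving_add_right μ z).setIntegral_preimage_emb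
      (MeasurableEquiv.addRight z).measurableEmbedding (fun x => (χ (ξ * x) : ℂ)) (𝒪[K] : Set K)
    have h2 : (fun x => x + z) ⁻¹' (𝒪[K] : Set K) = (𝒪[K] : Set K) := by
      ext x
      exact ⟨fun h => by simpa using sub_mem (show x + z ∈ 𝒪[K] from h) hz, fun h => add_mem h hz⟩
    rw [h2] at h1
    simp_rw [mul_add, AddChar.map_add_eq_mul, Circle.coe_mul, hz'] at h1
    rw [integral_mul_const] at h1
    by_contra h
    have h3 : (χ ϖ⁻¹ : ℂ) = 1 := by
      have := h1.trans (mul_one _).symm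
      exact mul_left_cancel₀ h this
    exact H.map_inv_prime (Circle.ext h3)

theorem setIntegral_integerBall_char (x : K) (n : ℤ) :
    ∫ ξ in integerBall ϖ 0 (-n), (χ (ξ * x) : ℂ) ∂μ =
      (q : ℂ) ^ n * (integerBall ϖ 0 n).indicator 1 x := by
  have h := H.integral_comp_affine μ hμ n 0
    ((𝒪[K] : Set K).indicator fun η => (χ (ϖ ^ (-n) * x * η) : ℂ))
  rw [integral_indicator measurableSet_integer, H.setIntegral_char μ hμ] at h
  have h1 : (𝒪[K] : Set K).indicator (1 : K → ℂ) (ϖ ^ (-n) * x) =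
      (integerBall ϖ 0 n).indicator 1 x := by
    have h2 : ϖ ^ (-n) * x ∈ (𝒪[K] : Set K) ↔ x ∈ integerBall ϖ 0 n := by simp [mem_integerBall]
    by_cases hx : x ∈ integerBall ϖ 0 n
    · rw [Set.indicator_of_mem hx, Set.indicator_of_mem (h2.2 hx)]; rfl
    · rw [Set.indicator_of_notMem hx, Set.indicator_of_notMem (fun h => hx (h2.1 h))]
  rw [h1] at h
  rw [← h, ← integral_indicator (measurableSet_integerBall _ _ _)]
  congr 1
  ext ξ
  have h0 := H.ne_zero
  have h2 : ξ ∈ integerBall ϖ 0 (-n) ↔ ϖ ^ n * ξ - 0 ∈ (𝒪[K] : Set K) := by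
    simp [mem_integerBall]
  by_cases hξ : ξ ∈ integerBall ϖ 0 (-n)
  · rw [Set.indicator_of_mem hξ, Set.indicator_of_mem (h2.1 hξ)]
    congr 2
    have h3 : ϖ ^ (-n) * ϖ ^ n = 1 := by rw [← zpow_add₀ h0]; simp
    linear_combination (-(ξ * x)) * h3
  · rw [Set.indicator_of_notMem hξ, Set.indicator_of_notMem (fun h => hξ (h2.2 h))]

/-- Completeness of the characters `χ (u k · )` in `L²(𝒪[K])`: the vanishing of the coefficients
means that the Fourier transform of `f` vanishes, and the integral of `f` over a ball is a mean
value of the Fourier transform. -/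
theorem ae_eq_zero_of_coeff_eq_zero {f : K → ℂ} (hf : IntegrableOn f (𝒪[K] : Set K) μ)
    (h : ∀ k, ∫ x in (𝒪[K] : Set K), f x * (χ (u k * x) : ℂ) ∂μ = 0) :
    f =ᵐ[μ.restrict (𝒪[K] : Set K)] 0 := by
  have := H.isProbabilityMeasure μ hμ
  have := H.secondCountableTopology
  have hF : ∀ ξ, ∫ x in (𝒪[K] : Set K), f x * (χ (ξ * x) : ℂ) ∂μ = 0 := by
    intro ξ
    obtain ⟨k, hk⟩ := H.cover ξ
    rw [← h k]
    refine setIntegral_congr_fun measurableSet_integer fun x hx => ?_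
    congr 2
    have : χ ((ξ - u k) * x) = 1 := H.map_integer _ (mul_mem hk hx)
    rw [show ξ * x = (ξ - u k) * x + u k * x by ring, AddChar.map_add_eq_mul, this, one_mul]
  have hg : (𝒪[K] : Set K).indicator f =ᵐ[μ] 0 := by
    have hint : Integrable ((𝒪[K] : Set K).indicator f) μ :=
      (integrable_indicator_iff measurableSet_integer).2 hf
    refine H.ae_eq_zero_of_setIntegral_integerBall μ (fun a => hint.integrableOn) fun a n => ?_
    rw [setIntegral_indicator measurableSet_integer, Set.inter_comm, ← setIntegral_indicator
      (measurableSet_integerBall _ _ _)]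
    have h1 : ∀ x, (integerBall ϖ a n).indicator f x = ((q : ℂ) ^ (n : ℤ))⁻¹ *
        ∫ ξ in integerBall ϖ 0 (-n), f x * (χ (ξ * (x - a)) : ℂ) ∂μ := by
      intro x
      have hq : ((q : ℂ) ^ (n : ℤ)) ≠ 0 := zpow_ne_zero _ (by exact_mod_cast H.q_pos.ne')
      rw [integral_const_mul, H.setIntegral_integerBall_char μ hμ]
      have h2 : x - a ∈ integerBall ϖ 0 n ↔ x ∈ integerBall ϖ a n := by simp [mem_integerBall]
      by_cases hx : x ∈ integerBall ϖ a n
      · rw [Set.indicator_of_mem hx, Set.indicator_of_mem (h2.2 hx), Pi.one_apply]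
        field_simp
      · rw [Set.indicator_of_notMem hx, Set.indicator_of_notMem (fun h => hx (h2.1 h))]
        simp
    simp_rw [h1]
    rw [integral_const_mul, integral_integral_swap]
    · have h3 : ∀ ξ, ∫ x in (𝒪[K] : Set K), f x * (χ (ξ * (x - a)) : ℂ) ∂μ = 0 := by
        intro ξ
        have h4 : ∀ x, f x * (χ (ξ * (x - a)) : ℂ) =
            f x * (χ (ξ * x) : ℂ) * (χ (-(ξ * a)) : ℂ) := by
          intro x
          rw [mul_sub, sub_eq_add_neg, AddChar.map_add_eq_mul, Circle.coe_mul, mul_assoc]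
        simp_rw [h4]
        rw [integral_mul_const, hF, zero_mul]
      simp [h3]
    · have hfin : IsFiniteMeasure (μ.restrict (integerBall ϖ 0 (-(n : ℤ)))) :=
        ⟨by simpa using H.measure_integerBall_lt_top μ hμ 0 _⟩
      have h5 : Integrable (fun p : K × K => f p.1 * 1)
          ((μ.restrict (𝒪[K] : Set K)).prod (μ.restrict (integerBall ϖ 0 (-(n : ℤ))))) :=
        Integrable.mul_prod (f := f) (g := fun _ => (1 : ℂ)) hf (integrable_const _)
      simp only [mul_one] at h5
      refine h5.mul_bdd (c := 1) ?_ (ae_of_all _ fun p => ?_)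
      · have := H.continuous
        have hc : Continuous fun p : K × K => (χ (p.2 * (p.1 - a)) : ℂ) := by fun_prop
        exact hc.aestronglyMeasurable
      · exact (Circle.norm_coe _).le
  rw [EventuallyEq, ae_restrict_iff' measurableSet_integer]
  filter_upwards [hg] with x hx hxm
  rwa [Set.indicator_of_mem hxm] at hx

omit H hμ in
theorem _root_.memLp_latticeChar (hχ : Continuous χ) (k : ℕ) :
    MemLp (latticeChar χ u k) 2 (μ.restrict (𝒪[K] : Set K)) := by
  have : IsFiniteMeasure (μ.restrict (𝒪[K] : Set K)) :=
    ⟨by simpa using (isCompact_integer (K := K)).measure_lt_top⟩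
  refine MemLp.of_bound (C := 1) ?_ (ae_of_all _ fun x => (norm_latticeChar k x).le)
  have hc : Continuous (latticeChar χ u k) := by unfold latticeChar; fun_prop
  exact hc.measurable.aestronglyMeasurable

/-- The conjugate lattice characters, an orthonormal basis of `L²(𝒪[K])`. -/
noncomputable def charBasis : HilbertBasis ℕ ℂ (Lp ℂ 2 (μ.restrict (𝒪[K] : Set K))) :=
  HilbertBasis.mkOfOrthogonalEqBot
    (v := fun k => (memLp_latticeChar μ H.continuous k).toLp (latticeChar χ u k))
    (by
      rw [orthonormal_iff_ite]
      intro k l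
      rw [inner_toLp_toLp]
      have h1 : ∀ x, latticeChar χ u l x * conj (latticeChar χ u k x) =
          (χ ((u k - u l) * x) : ℂ) := by
        intro x
        rw [latticeChar, latticeChar, Complex.conj_conj, ← Circle.coe_inv_eq_conj,
          ← AddChar.map_neg_eq_inv, ← Circle.coe_mul, ← AddChar.map_add_eq_mul]
        congr 2
        ring
      simp_rw [h1]
      rw [H.setIntegral_char μ hμ]
      by_cases hkl : k = l
      · rw [if_pos hkl, hkl, sub_self, Set.indicator_of_mem (by exact zero_mem 𝒪[K])]; rfl
      · rw [if_neg hkl, Set.indicator_of_notMem (fun h => hkl (H.separated k l h))])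
    (by
      rw [Submodule.eq_bot_iff]
      intro f hf
      have hprob := H.isProbabilityMeasure μ hμ
      have h1 : f =ᵐ[μ.restrict (𝒪[K] : Set K)] 0 := by
        refine H.ae_eq_zero_of_coeff_eq_zero μ hμ ((Lp.memLp f).integrable one_le_two) fun k => ?_
        have h2 := (Submodule.mem_orthogonal _ _).1 hf _ (Submodule.subset_span ⟨k, rfl⟩)
        have h3 := inner_toLp_toLp (memLp_latticeChar (u := u) μ H.continuous k) (Lp.memLp f)
        rw [Lp.toLp_coeFn] at h3
        rw [h3] at h2
        simpa [latticeChar] using h2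
      exact Lp.ext (h1.trans (Lp.coeFn_zero _ _ _).symm))

theorem charBasis_apply (k : ℕ) : H.charBasis μ hμ k =
    (memLp_latticeChar μ H.continuous k).toLp (latticeChar χ u k) := by
  rw [charBasis, HilbertBasis.coe_mkOfOrthogonalEqBot]

theorem inner_charBasis {f : K → ℂ} (hf : MemLp f 2 (μ.restrict (𝒪[K] : Set K))) (k : ℕ) :
    ⟪H.charBasis μ hμ k, hf.toLp f⟫_ℂ = ∫ x in (𝒪[K] : Set K), f x * (χ (u k * x) : ℂ) ∂μ := by
  rw [charBasis_apply, inner_toLp_toLp]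
  simp [latticeChar]

/-- Parseval's identity for the lattice characters. -/
theorem tsum_enorm_setIntegral_char {f : K → ℂ} (hf : MemLp f 2 (μ.restrict (𝒪[K] : Set K))) :
    ∑' k, ‖∫ x in (𝒪[K] : Set K), f x * (χ (u k * x) : ℂ) ∂μ‖ₑ ^ 2 =
      ∫⁻ x in (𝒪[K] : Set K), ‖f x‖ₑ ^ 2 ∂μ := by
  rw [← enorm_toLp_sq hf, ← ((H.charBasis μ hμ).hasSum_norm_sq (hf.toLp f)).tsum_enorm_sq_eq]
  simp_rw [H.inner_charBasis μ hμ hf]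

end IsWaveletLattice

end Characters

/-! ### The Fourier transform on `L²(K)` -/

section Fourier

open scoped ENNReal InnerProductSpace

set_option linter.unusedSectionVars false

variable {K : Type*} [Field K] [ValuativeRel K] [TopologicalSpace K]
  [IsNonarchimedeanLocalField K] [MeasurableSpace K] [BorelSpace K]
  {ϖ : K} {χ : AddChar K Circle} {q : ℕ} {u : ℕ → K}

/-- `g` is the Fourier transform of `f` in `L²(K)`: the limit in `L²(K)` of the Fourier transforms
of the restrictions of `f` to the balls `ϖ⁻ⁿ 𝒪[K]`. -/
def IsFourierL2 (μ : Measure K) (ϖ : K) (χ : AddChar K Circle) (f g : K → ℂ) : Prop :=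
  MemLp g 2 μ ∧
    Tendsto (fun n : ℕ => eLpNorm (fun ξ => g ξ - truncatedFourier μ ϖ χ f n ξ) 2 μ) atTop (𝓝 0)

theorem setOf_pow_mul_mem (ϖ : K) (n : ℕ) :
    {x : K | ϖ ^ n * x ∈ 𝒪[K]} = integerBall ϖ 0 (-n) := by
  ext x; simp [integerBall]

theorem eLpNorm_two_lt_top_iff {μ : Measure K} {f : K → ℂ} :
    eLpNorm f 2 μ < ∞ ↔ ∫⁻ x, ‖f x‖ₑ ^ 2 ∂μ < ∞ := by
  rw [← eLpNorm_two_sq, ENNReal.pow_lt_top_iff, or_iff_left two_ne_zero]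

theorem tendsto_eLpNorm_zero_iff {μ : Measure K} {F : ℕ → K → ℂ} :
    Tendsto (fun n => eLpNorm (F n) 2 μ) atTop (𝓝 0) ↔
      Tendsto (fun n => ∫⁻ x, ‖F n x‖ₑ ^ 2 ∂μ) atTop (𝓝 0) := by
  simp_rw [← eLpNorm_two_sq]
  constructor
  · intro h
    simpa using ENNReal.Tendsto.pow (n := 2) h
  · intro h
    have h1 : ∀ a : ℝ≥0∞, (a ^ 2) ^ (1 / 2 : ℝ) = a := by
      intro a
      rw [← ENNReal.rpow_natCast, ← ENNReal.rpow_mul]; norm_num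
    have h2 := h.ennrpow_const (1 / 2)
    simp_rw [h1] at h2
    rwa [ENNReal.zero_rpow_of_pos (by norm_num)] at h2

namespace IsWaveletLattice

variable (H : IsWaveletLattice ϖ χ q u)
include H

theorem integerBall_exhaust (x : K) : ∃ N : ℕ, ∀ n ≥ N, x ∈ integerBall ϖ 0 (-(n : ℤ)) := by
  obtain ⟨N, hN⟩ := H.prime.exists_pow_mul_mem x
  refine ⟨N, fun n hn => H.integerBall_mono 0 (m := -(n : ℤ)) (n := -(N : ℤ)) (by omega) ?_⟩
  rwa [← setOf_pow_mul_mem]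

variable (μ : Measure K) [μ.IsAddHaarMeasure] (hμ : μ (𝒪[K] : Set K) = 1)
include hμ

theorem integrableOn_integerBall {f : K → ℂ} (hf : MemLp f 2 μ) (a : K) (n : ℤ) :
    IntegrableOn f (integerBall ϖ a n) μ := by
  have hfin : IsFiniteMeasure (μ.restrict (integerBall ϖ a n)) :=
    ⟨by simpa using H.measure_integerBall_lt_top μ hμ a n⟩
  exact (hf.restrict _).integrable one_le_two

theorem integrableOn_mul_char {f : K → ℂ} (hf : MemLp f 2 μ) (a ξ : K) (n : ℤ) :
    IntegrableOn (fun x => f x * conj (χ (ξ * x) : ℂ)) (integerBall ϖ a n) μ := by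
  refine (H.integrableOn_integerBall μ hμ hf a n).mul_bdd (c := 1) ?_ (ae_of_all _ fun p => ?_)
  · have := H.continuous
    have hc : Continuous fun x => conj (χ (ξ * x) : ℂ) := by fun_prop
    exact hc.measurable.aestronglyMeasurable
  · rw [RCLike.norm_conj]; exact (Circle.norm_coe _).le

/-- Plancherel's formula for functions on `𝒪[K]`: the Fourier transform is constant on the cosets
of `𝒪[K]`, and its values are the coefficients with respect to the lattice characters. -/
theorem lintegral_enorm_setIntegral_char {f : K → ℂ}
    (hf : MemLp f 2 (μ.restrict (𝒪[K] : Set K))) :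
    ∫⁻ ξ, ‖∫ x in (𝒪[K] : Set K), f x * conj (χ (ξ * x) : ℂ) ∂μ‖ₑ ^ 2 ∂μ =
      ∫⁻ x in (𝒪[K] : Set K), ‖f x‖ₑ ^ 2 ∂μ := by
  have hprob := H.isProbabilityMeasure μ hμ
  rw [H.lintegral_eq_tsum μ, ← H.tsum_enorm_setIntegral_char μ hμ hf]
  refine tsum_congr fun k => ?_
  have h1 : ∀ ξ ∈ (𝒪[K] : Set K), ∫ x in (𝒪[K] : Set K), f x * conj (χ ((ξ - u k) * x) : ℂ) ∂μ =
      ∫ x in (𝒪[K] : Set K), f x * (χ (u k * x) : ℂ) ∂μ := by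
    intro ξ hξ
    refine setIntegral_congr_fun measurableSet_integer fun x hx => ?_
    congr 1
    rw [← Circle.coe_inv_eq_conj, ← AddChar.map_neg_eq_inv,
      show -((ξ - u k) * x) = -(ξ * x) + u k * x by ring, AddChar.map_add_eq_mul,
      H.map_integer _ (neg_mem (mul_mem hξ hx)), one_mul]
  rw [setLIntegral_congr_fun (g := fun _ =>
    ‖∫ x in (𝒪[K] : Set K), f x * (χ (u k * x) : ℂ) ∂μ‖ₑ ^ 2) measurableSet_integer
    (fun ξ hξ => by simp only [h1 ξ hξ])]
  simp

/-- By rescaling, the Fourier transform on `ϖ⁻ⁿ 𝒪[K]` is one on `𝒪[K]`. -/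
theorem truncatedFourier_eq (f : K → ℂ) (n : ℕ) (ξ : K) :
    truncatedFourier μ ϖ χ f n ξ = (q : ℂ) ^ (n : ℤ) *
      ∫ x in (𝒪[K] : Set K), f (ϖ ^ (-(n : ℤ)) * x) *
        conj (χ ((ϖ ^ (-(n : ℤ)) * ξ) * x) : ℂ) ∂μ := by
  have h0 := H.ne_zero
  have h := H.integral_comp_affine μ hμ n 0 ((𝒪[K] : Set K).indicator fun x =>
    f (ϖ ^ (-(n : ℤ)) * x) * conj (χ ((ϖ ^ (-(n : ℤ)) * ξ) * x) : ℂ))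
  rw [integral_indicator measurableSet_integer] at h
  rw [← h, truncatedFourier, setOf_pow_mul_mem, ← integral_indicator
    (measurableSet_integerBall _ _ _)]
  congr 1
  ext x
  have h1 : x ∈ integerBall ϖ 0 (-(n : ℤ)) ↔ ϖ ^ (n : ℤ) * x - 0 ∈ (𝒪[K] : Set K) := by
    simp [mem_integerBall]
  have h3 : ϖ ^ (-(n : ℤ)) * ϖ ^ (n : ℤ) = 1 := by rw [← zpow_add₀ h0]; simp
  by_cases hx : x ∈ integerBall ϖ 0 (-(n : ℤ))
  · rw [Set.indicator_of_mem hx, Set.indicator_of_mem (h1.1 hx), sub_zero, ← mul_assoc, h3, one_mul]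
    congr 4
    linear_combination (-(ξ * x)) * h3
  · rw [Set.indicator_of_notMem hx, Set.indicator_of_notMem (fun h => hx (h1.2 h))]

/-- Plancherel's formula for the restriction of `f` to `ϖ⁻ⁿ 𝒪[K]`. -/
theorem lintegral_enorm_truncatedFourier {f : K → ℂ} (hf : MemLp f 2 μ) (n : ℕ) :
    ∫⁻ ξ, ‖truncatedFourier μ ϖ χ f n ξ‖ₑ ^ 2 ∂μ =
      ∫⁻ x in integerBall ϖ 0 (-(n : ℤ)), ‖f x‖ₑ ^ 2 ∂μ := by
  have hq0 := H.q_ne_zero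
  have hqt : (q : ℝ≥0∞) ≠ ∞ := ENNReal.natCast_ne_top q
  have h0 := H.ne_zero
  have hcomp : ∀ j : ℤ, MemLp (fun x => f (ϖ ^ j * x)) 2 μ := by
    intro j
    have h1 : MemLp f 2 (μ.map fun x => ϖ ^ j * x) := by
      rw [H.map_zpow_mul μ hμ]
      exact hf.smul_measure (ENNReal.zpow_ne_top hq0 hqt _)
    exact h1.comp_of_map (continuous_const_mul _).measurable.aemeasurable
  simp_rw [H.truncatedFourier_eq μ hμ f n, enorm_mul, mul_pow]
  rw [lintegral_const_mul' _ _ (by simp)]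
  have h1 := H.lintegral_comp_affine μ hμ (-n) 0 fun ξ =>
    ‖∫ x in (𝒪[K] : Set K), f (ϖ ^ (-(n : ℤ)) * x) * conj (χ (ξ * x) : ℂ) ∂μ‖ₑ ^ 2
  simp_rw [sub_zero] at h1
  rw [h1, H.lintegral_enorm_setIntegral_char μ hμ ((hcomp _).restrict _)]
  have h2 := H.lintegral_comp_affine μ hμ n 0
    ((𝒪[K] : Set K).indicator fun x => ‖f (ϖ ^ (-(n : ℤ)) * x)‖ₑ ^ 2)
  rw [lintegral_indicator measurableSet_integer] at h2
  have h3 : ‖(q : ℂ) ^ (n : ℤ)‖ₑ ^ 2 * (q : ℝ≥0∞) ^ (-(n : ℤ)) = (q : ℝ≥0∞) ^ (n : ℤ) := by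
    have : ‖(q : ℂ) ^ (n : ℤ)‖ₑ = (q : ℝ≥0∞) ^ (n : ℤ) := by
      rw [zpow_natCast, zpow_natCast, enorm_pow]
      congr 1
      simp [enorm_eq_nnnorm]
    rw [this, sq, mul_assoc, ← ENNReal.zpow_add hq0 hqt]
    simp
  rw [← mul_assoc, h3, ← h2, ← lintegral_indicator (measurableSet_integerBall _ _ _)]
  congr 1
  ext x
  have h1 : x ∈ integerBall ϖ 0 (-(n : ℤ)) ↔ ϖ ^ (n : ℤ) * x - 0 ∈ (𝒪[K] : Set K) := by
    simp [mem_integerBall]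
  have h3 : ϖ ^ (-(n : ℤ)) * ϖ ^ (n : ℤ) = 1 := by rw [← zpow_add₀ h0]; simp
  by_cases hx : x ∈ integerBall ϖ 0 (-(n : ℤ))
  · rw [Set.indicator_of_mem hx, Set.indicator_of_mem (h1.1 hx), sub_zero, ← mul_assoc, h3, one_mul]
  · rw [Set.indicator_of_notMem hx, Set.indicator_of_notMem (fun h => hx (h1.2 h))]

/-- The Fourier transform of the restriction to `ϖ⁻ⁿ 𝒪[K]` is constant on the cosets of
`ϖ ^ n 𝒪[K]`, hence measurable. -/
theorem memLp_truncatedFourier {f : K → ℂ} (hf : MemLp f 2 μ) (n : ℕ) :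
    MemLp (truncatedFourier μ ϖ χ f n) 2 μ := by
  have hloc : IsLocallyConstant (truncatedFourier μ ϖ χ f n) := by
    rw [IsLocallyConstant.iff_eventually_eq]
    intro ξ
    filter_upwards [(isOpen_integerBall ϖ ξ n).mem_nhds (H.mem_integerBall_self ξ n)] with ξ' hξ'
    rw [truncatedFourier, truncatedFourier, setOf_pow_mul_mem]
    refine setIntegral_congr_fun (measurableSet_integerBall _ _ _) fun x hx => ?_
    congr 3
    have h1 : (ξ' - ξ) * x ∈ 𝒪[K] := by
      have := mul_mem (show _ ∈ 𝒪[K] from hξ') (show _ ∈ 𝒪[K] from hx)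
      have h2 : ϖ ^ (-(n : ℤ)) * ϖ ^ (n : ℤ) = 1 := by rw [← zpow_add₀ H.ne_zero]; simp
      rw [neg_neg, sub_zero] at this
      rwa [show ϖ ^ (-(n : ℤ)) * (ξ' - ξ) * (ϖ ^ (n : ℤ) * x) =
        (ϖ ^ (-(n : ℤ)) * ϖ ^ (n : ℤ)) * ((ξ' - ξ) * x) by ring, h2, one_mul] at this
    rw [show ξ' * x = (ξ' - ξ) * x + ξ * x by ring, AddChar.map_add_eq_mul, H.map_integer _ h1,
      one_mul]
  refine ⟨hloc.continuous.measurable.aestronglyMeasurable, ?_⟩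
  rw [eLpNorm_two_lt_top_iff, H.lintegral_enorm_truncatedFourier μ hμ hf]
  exact (setLIntegral_le_lintegral _ _).trans_lt (eLpNorm_two_lt_top_iff.1 hf.2)

theorem truncatedFourier_add {f g : K → ℂ} (hf : MemLp f 2 μ) (hg : MemLp g 2 μ) (n : ℕ) (ξ : K) :
    truncatedFourier μ ϖ χ (fun x => f x + g x) n ξ =
      truncatedFourier μ ϖ χ f n ξ + truncatedFourier μ ϖ χ g n ξ := by
  simp only [truncatedFourier, setOf_pow_mul_mem, add_mul]
  exact integral_add (H.integrableOn_mul_char μ hμ hf 0 ξ _) (H.integrableOn_mul_char μ hμ hg 0 ξ _)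

omit H hμ in
theorem _root_.truncatedFourier_const_mul (c : ℂ) (f : K → ℂ) (n : ℕ) (ξ : K) :
    truncatedFourier μ ϖ χ (fun x => c * f x) n ξ = c * truncatedFourier μ ϖ χ f n ξ := by
  simp only [truncatedFourier, mul_assoc, integral_const_mul]

theorem truncatedFourier_sub_of_le (f : K → ℂ) (hf : MemLp f 2 μ) {m n : ℕ} (h : m ≤ n) (ξ : K) :
    truncatedFourier μ ϖ χ f n ξ - truncatedFourier μ ϖ χ f m ξ =
      truncatedFourier μ ϖ χ ((integerBall ϖ 0 (-(m : ℤ)))ᶜ.indicator f) n ξ := by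
  have hm := measurableSet_integerBall ϖ (0 : K) (-(m : ℤ))
  have hsub := H.integerBall_mono 0 (m := -(n : ℤ)) (n := -(m : ℤ)) (by omega)
  simp only [truncatedFourier, setOf_pow_mul_mem]
  have h1 : ∀ x, (integerBall ϖ 0 (-(m : ℤ)))ᶜ.indicator f x * conj (χ (ξ * x) : ℂ) =
      (integerBall ϖ 0 (-(m : ℤ)))ᶜ.indicator (fun x => f x * conj (χ (ξ * x) : ℂ)) x := by
    intro x
    simp only [Set.indicator]
    split_ifs <;> simp
  simp_rw [h1]
  rw [setIntegral_indicator hm.compl, ← Set.sdiff_eq, setIntegral_sdiff hm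
    (H.integrableOn_mul_char μ hμ hf 0 ξ _) hsub]

theorem tendsto_lintegral_compl_integerBall {f : K → ℂ} (hf : MemLp f 2 μ) :
    Tendsto (fun m : ℕ => ∫⁻ x, ‖(integerBall ϖ 0 (-(m : ℤ)))ᶜ.indicator f x‖ₑ ^ 2 ∂μ) atTop
      (𝓝 0) := by
  have hfin : ∫⁻ x, ‖f x‖ₑ ^ 2 ∂μ ≠ ∞ := (eLpNorm_two_lt_top_iff.1 hf.2).ne
  have h := tendsto_lintegral_of_dominated_convergence' (μ := μ)
    (F := fun (m : ℕ) x => ‖(integerBall ϖ 0 (-(m : ℤ)))ᶜ.indicator f x‖ₑ ^ 2)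
    (f := fun _ => 0) (fun x => ‖f x‖ₑ ^ 2) (fun m => ?_) (fun m => ae_of_all _ fun x => ?_) hfin
    (ae_of_all _ fun x => ?_)
  · simpa using h
  · exact ((hf.1.indicator (measurableSet_integerBall ϖ (0 : K) (-(m : ℤ))).compl).enorm).pow_const 2
  · exact pow_le_pow_left' (enorm_indicator_le_enorm_self _ _) 2
  · obtain ⟨N, hN⟩ := H.integerBall_exhaust x
    refine tendsto_const_nhds.congr' ?_
    filter_upwards [eventually_ge_atTop N] with m hm
    rw [Set.indicator_of_notMem (Set.notMem_compl_iff.2 (hN m hm))]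
    simp

/-- Every `f ∈ L²(K)` has a Fourier transform. -/
theorem exists_isFourierL2 {f : K → ℂ} (hf : MemLp f 2 μ) : ∃ g, IsFourierL2 μ ϖ χ f g := by
  let F : ℕ → Lp ℂ 2 μ := fun n => (H.memLp_truncatedFourier μ hμ hf n).toLp _
  let b : ℕ → ℝ≥0∞ := fun m => eLpNorm ((integerBall ϖ 0 (-(m : ℤ)))ᶜ.indicator f) 2 μ
  have hb : Tendsto b atTop (𝓝 0) :=
    tendsto_eLpNorm_zero_iff.2 (H.tendsto_lintegral_compl_integerBall μ hμ hf)
  have hind : ∀ m : ℕ, MemLp ((integerBall ϖ 0 (-(m : ℤ)))ᶜ.indicator f) 2 μ := fun m =>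
    hf.indicator (measurableSet_integerBall ϖ (0 : K) (-(m : ℤ))).compl
  have hbtop : ∀ m, b m ≠ ∞ := fun m => (hind m).2.ne
  have hdist : ∀ m n, m ≤ n → dist (F m) (F n) ≤ (b m).toReal := by
    intro m n hmn
    rw [dist_comm, dist_eq_norm, ← MemLp.toLp_sub, Lp.norm_toLp]
    refine ENNReal.toReal_mono (hbtop m) ?_
    have h1 : truncatedFourier μ ϖ χ f n - truncatedFourier μ ϖ χ f m =
        truncatedFourier μ ϖ χ ((integerBall ϖ 0 (-(m : ℤ)))ᶜ.indicator f) n := by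
      ext ξ
      exact H.truncatedFourier_sub_of_le μ hμ f hf hmn ξ
    rw [h1, ← ENNReal.pow_le_pow_left_iff (n := 2) two_ne_zero, eLpNorm_two_sq, eLpNorm_two_sq,
      H.lintegral_enorm_truncatedFourier μ hμ (hind m)]
    exact setLIntegral_le_lintegral _ _
  have hcau : CauchySeq F := cauchySeq_of_le_tendsto_0' (fun m => (b m).toReal) hdist
    ((ENNReal.tendsto_toReal ENNReal.zero_ne_top).comp hb)
  obtain ⟨g, hg⟩ := cauchySeq_tendsto_of_complete hcau
  refine ⟨g, Lp.memLp g, ?_⟩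
  have h2 := (Lp.tendsto_Lp_iff_tendsto_eLpNorm' _ _).1 hg
  refine h2.congr fun n => ?_
  rw [eLpNorm_sub_comm]
  refine eLpNorm_congr_ae ?_
  filter_upwards [(H.memLp_truncatedFourier μ hμ hf n).coeFn_toLp] with x hx
  simp only [F, Pi.sub_apply, hx]

theorem isFourierL2_fourierL2 {f : K → ℂ} (hf : MemLp f 2 μ) :
    IsFourierL2 μ ϖ χ f (fourierL2 μ ϖ χ f) :=
  Classical.epsilon_spec (H.exists_isFourierL2 μ hμ hf)

end IsWaveletLattice

namespace IsFourierL2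

variable {H : IsWaveletLattice ϖ χ q u} {μ : Measure K} [μ.IsAddHaarMeasure] {f g f' g' : K → ℂ}

theorem add_const_mul (H : IsWaveletLattice ϖ χ q u) (hμ : μ (𝒪[K] : Set K) = 1)
    (hf : MemLp f 2 μ) (hf' : MemLp f' 2 μ) (h : IsFourierL2 μ ϖ χ f g)
    (h' : IsFourierL2 μ ϖ χ f' g') (c : ℂ) :
    IsFourierL2 μ ϖ χ (fun x => f x + c * f' x) (fun x => g x + c * g' x) := by
  refine ⟨h.1.add (h'.1.const_mul c), ?_⟩
  have hlim : Tendsto (fun n => eLpNorm (fun ξ => g ξ - truncatedFourier μ ϖ χ f n ξ) 2 μ +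
      ‖c‖ₑ * eLpNorm (fun ξ => g' ξ - truncatedFourier μ ϖ χ f' n ξ) 2 μ) atTop (𝓝 0) := by
    have := h.2.add (ENNReal.Tendsto.const_mul h'.2 (Or.inr (enorm_ne_top (x := c))))
    simpa using this
  refine tendsto_of_tendsto_of_tendsto_of_le_of_le tendsto_const_nhds hlim (fun _ => zero_le)
    fun n => ?_
  have hT := H.memLp_truncatedFourier μ hμ hf n
  have hT' := H.memLp_truncatedFourier μ hμ hf' n
  have h1 : (fun ξ => g ξ + c * g' ξ - truncatedFourier μ ϖ χ (fun x => f x + c * f' x) n ξ) =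
      (fun ξ => g ξ - truncatedFourier μ ϖ χ f n ξ) +
        c • fun ξ => g' ξ - truncatedFourier μ ϖ χ f' n ξ := by
    ext ξ
    rw [H.truncatedFourier_add μ hμ hf (hf'.const_mul c), truncatedFourier_const_mul]
    simp only [Pi.add_apply, Pi.smul_apply, smul_eq_mul]
    ring
  simp only
  rw [h1, ← eLpNorm_const_smul]
  exact eLpNorm_add_le (h.1.sub hT).1 ((h'.1.sub hT').1.const_smul c) one_le_two

/-- Plancherel's theorem. -/
theorem eLpNorm_eq (H : IsWaveletLattice ϖ χ q u) (hμ : μ (𝒪[K] : Set K) = 1)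
    (hf : MemLp f 2 μ) (h : IsFourierL2 μ ϖ χ f g) : eLpNorm g 2 μ = eLpNorm f 2 μ := by
  have hT := H.memLp_truncatedFourier μ hμ hf
  have h1 : Tendsto (fun n => eLpNorm (truncatedFourier μ ϖ χ f n) 2 μ) atTop
      (𝓝 (eLpNorm g 2 μ)) := by
    have h2 : Tendsto (fun n => (hT n).toLp _) atTop (𝓝 (h.1.toLp g)) := by
      rw [Lp.tendsto_Lp_iff_tendsto_eLpNorm'']
      refine h.2.congr fun n => ?_
      rw [← eLpNorm_neg]
      congr 1
      ext ξ
      simp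
    have h3 := h2.enorm
    simpa only [Lp.enorm_toLp] using h3
  have h2 := (ENNReal.Tendsto.pow (n := 2) h1).add (H.tendsto_lintegral_compl_integerBall μ hμ hf)
  have h3 : ∀ n : ℕ, eLpNorm (truncatedFourier μ ϖ χ f n) 2 μ ^ 2 +
      ∫⁻ x, ‖(integerBall ϖ 0 (-(n : ℤ)))ᶜ.indicator f x‖ₑ ^ 2 ∂μ = eLpNorm f 2 μ ^ 2 := by
    intro n
    have hm := measurableSet_integerBall ϖ (0 : K) (-(n : ℤ))
    rw [eLpNorm_two_sq, eLpNorm_two_sq, H.lintegral_enorm_truncatedFourier μ hμ hf n,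
      ← lintegral_add_compl (μ := μ) (fun x => ‖f x‖ₑ ^ 2) hm]
    congr 1
    rw [← lintegral_indicator hm.compl]
    refine lintegral_congr fun x => ?_
    simp only [Set.indicator]
    split_ifs <;> simp
  simp_rw [h3, add_zero] at h2
  have h4 := tendsto_nhds_unique h2 tendsto_const_nhds
  exact le_antisymm ((ENNReal.pow_le_pow_left_iff two_ne_zero).1 h4.le)
    ((ENNReal.pow_le_pow_left_iff two_ne_zero).1 h4.ge)

/-- Plancherel's theorem for inner products, by polarization. -/
theorem integral_mul_conj (H : IsWaveletLattice ϖ χ q u) (hμ : μ (𝒪[K] : Set K) = 1)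
    (hf : MemLp f 2 μ) (hf' : MemLp f' 2 μ) (h : IsFourierL2 μ ϖ χ f g)
    (h' : IsFourierL2 μ ϖ χ f' g') :
    ∫ ξ, g ξ * conj (g' ξ) ∂μ = ∫ x, f x * conj (f' x) ∂μ := by
  have h1 : ∀ c : ℂ, ‖h'.1.toLp g' + c • h.1.toLp g‖ = ‖hf'.toLp f' + c • hf.toLp f‖ := by
    intro c
    rw [← MemLp.toLp_const_smul, ← MemLp.toLp_const_smul, ← MemLp.toLp_add, ← MemLp.toLp_add,
      Lp.norm_toLp, Lp.norm_toLp]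
    congr 1
    exact (h'.add_const_mul H hμ hf' hf h c).eLpNorm_eq H hμ (hf'.add (hf.const_mul c))
  rw [← inner_toLp_toLp h'.1 h.1, ← inner_toLp_toLp hf' hf,
    inner_eq_sum_norm_sq_div_four, inner_eq_sum_norm_sq_div_four]
  have h2 := h1 1
  have h3 := h1 (-1)
  have h4 := h1 Complex.I
  have h5 := h1 (-Complex.I)
  simp only [one_smul, neg_smul, ← sub_eq_add_neg] at h2 h3 h4 h5
  simp only [RCLike.I_to_complex, h2, h3, h4, h5]

theorem comp_sub (H : IsWaveletLattice ϖ χ q u) (h : IsFourierL2 μ ϖ χ f g) (a : K) :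
    IsFourierL2 μ ϖ χ (fun x => f (x - a)) (fun ξ => conj (χ (a * ξ) : ℂ) * g ξ) := by
  have hc : Continuous fun ξ => conj (χ (a * ξ) : ℂ) := by
    have := H.continuous
    fun_prop
  have hnorm : ∀ ξ, ‖conj (χ (a * ξ) : ℂ)‖ = 1 := fun ξ => by
    rw [RCLike.norm_conj]; exact Circle.norm_coe _
  refine ⟨?_, ?_⟩
  · refine h.1.of_le (hc.measurable.aestronglyMeasurable.mul h.1.1) (ae_of_all _ fun ξ => ?_)
    rw [norm_mul, hnorm, one_mul]
  · refine h.2.congr' ?_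
    obtain ⟨N, hN⟩ := H.integerBall_exhaust a
    filter_upwards [eventually_ge_atTop N] with n hn
    refine eLpNorm_congr_norm_ae (ae_of_all _ fun ξ => ?_)
    have h1 : truncatedFourier μ ϖ χ (fun x => f (x - a)) n ξ =
        conj (χ (a * ξ) : ℂ) * truncatedFourier μ ϖ χ f n ξ := by
      rw [truncatedFourier, truncatedFourier, setOf_pow_mul_mem, ← integral_const_mul]
      have h2 := (measurePreserving_sub_right μ a).setIntegral_preimage_emb
        (MeasurableEquiv.subRight a).measurableEmbedding
        (fun x => conj (χ (a * ξ) : ℂ) * (f x * conj (χ (ξ * x) : ℂ))) (integerBall ϖ 0 (-(n : ℤ)))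
      have h3 : (fun x => x - a) ⁻¹' integerBall ϖ 0 (-(n : ℤ)) = integerBall ϖ 0 (-(n : ℤ)) := by
        have ha := hN n hn
        rw [mem_integerBall, sub_zero] at ha
        ext x
        rw [Set.mem_preimage, mem_integerBall, mem_integerBall, sub_zero, sub_zero, mul_sub]
        exact ⟨fun h => by simpa using add_mem h ha, fun h => sub_mem h ha⟩
      rw [h3] at h2
      rw [← h2]
      refine integral_congr_ae (ae_of_all _ fun x => ?_)
      simp only
      rw [mul_left_comm, ← map_mul, ← Circle.coe_mul, ← AddChar.map_add_eq_mul]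
      congr 4
      ring
    rw [h1, ← mul_sub, norm_mul, hnorm, one_mul]

end IsFourierL2

namespace IsWaveletLattice

variable (H : IsWaveletLattice ϖ χ q u) (μ : Measure K) [μ.IsAddHaarMeasure]
  (hμ : μ (𝒪[K] : Set K) = 1)
include H hμ

theorem memLp_indicator_integerBall (a : K) (n : ℤ) :
    MemLp ((integerBall ϖ a n).indicator (1 : K → ℂ)) 2 μ :=
  memLp_indicator_const 2 (measurableSet_integerBall _ _ _) 1
    (Or.inr (H.measure_integerBall_lt_top μ hμ a n).ne)

/-- The Fourier transform of the indicator function of a ball. -/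
theorem isFourierL2_indicator (a : K) (n : ℤ) :
    IsFourierL2 μ ϖ χ ((integerBall ϖ a n).indicator 1)
      (fun ξ => conj (χ (a * ξ) : ℂ) *
        ((q : ℂ) ^ (-n) * (integerBall ϖ 0 (-n)).indicator 1 ξ)) := by
  have h0 : IsFourierL2 μ ϖ χ ((integerBall ϖ 0 n).indicator 1)
      (fun ξ => (q : ℂ) ^ (-n) * (integerBall ϖ 0 (-n)).indicator 1 ξ) := by
    refine ⟨(H.memLp_indicator_integerBall μ hμ 0 (-n)).const_mul _, ?_⟩
    refine tendsto_const_nhds.congr' ?_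
    filter_upwards [eventually_ge_atTop (-n).toNat] with m hm
    have hsub := H.integerBall_mono 0 (m := -(m : ℤ)) (n := n) (by omega)
    have h1 : ∀ ξ, truncatedFourier μ ϖ χ ((integerBall ϖ 0 n).indicator 1) m ξ =
        (q : ℂ) ^ (-n) * (integerBall ϖ 0 (-n)).indicator 1 ξ := by
      intro ξ
      have h2 := congrArg conj (H.setIntegral_integerBall_char μ hμ ξ (-n))
      rw [← integral_conj, neg_neg] at h2
      have h3 : conj ((q : ℂ) ^ (-n) * (integerBall ϖ 0 (-n)).indicator 1 ξ) =
          (q : ℂ) ^ (-n) * (integerBall ϖ 0 (-n)).indicator 1 ξ := by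
        rw [RingHom.map_mul, map_zpow₀, Complex.conj_natCast]
        congr 1
        simp only [Set.indicator]
        split_ifs <;> simp
      rw [h3] at h2
      rw [← h2, truncatedFourier, setOf_pow_mul_mem]
      have h4 : ∀ x, (integerBall ϖ 0 n).indicator (1 : K → ℂ) x * conj (χ (ξ * x) : ℂ) =
          (integerBall ϖ 0 n).indicator (fun x => conj (χ (x * ξ) : ℂ)) x := by
        intro x
        simp only [Set.indicator]
        split_ifs <;> simp [mul_comm]
      simp_rw [h4]
      rw [setIntegral_indicator (measurableSet_integerBall _ _ _), Set.inter_eq_right.2 hsub]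
    simp_rw [h1, sub_self]
    exact eLpNorm_zero.symm
  have h1 := h0.comp_sub H a
  convert! h1 using 1
  ext x
  have h2 : x ∈ integerBall ϖ a n ↔ x - a ∈ integerBall ϖ 0 n := by simp [mem_integerBall]
  by_cases hx : x ∈ integerBall ϖ a n
  · rw [Set.indicator_of_mem hx, Set.indicator_of_mem (h2.1 hx)]; rfl
  · rw [Set.indicator_of_notMem hx, Set.indicator_of_notMem (fun h => hx (h2.2 h))]

end IsWaveletLattice

end Fourier

/-! ### Series in `L²` -/

section Series

open scoped ENNReal InnerProductSpace

theorem Orthonormal.summable_smul {ι E : Type*} [NormedAddCommGroup E] [InnerProductSpace ℂ E]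
    [CompleteSpace E] {v : ι → E} (hv : Orthonormal ℂ v) {a : ι → ℂ}
    (ha : Summable fun i => ‖a i‖ ^ 2) : Summable fun i => a i • v i := by
  have h := (hv.orthogonalFamily.summable_iff_norm_sq_summable a).2 ha
  simpa using h

theorem Orthonormal.inner_of_hasSum {ι E : Type*} [NormedAddCommGroup E] [InnerProductSpace ℂ E]
    {v : ι → E} (hv : Orthonormal ℂ v) {a : ι → ℂ} {x : E} (h : HasSum (fun i => a i • v i) x)
    (i : ι) : ⟪v i, x⟫_ℂ = a i := by
  classical
  have h1 := h.mapL (innerSL ℂ (v i))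
  simp only [innerSL_apply_apply, inner_smul_right] at h1
  have h2 := hasSum_single (f := fun j => a j * ⟪v i, v j⟫_ℂ) i fun j hj => by
    rw [hv.2 hj.symm, mul_zero]
  rw [h1.unique h2, inner_self_eq_norm_sq_to_K, hv.1 i]
  simp

variable {X : Type*} [MeasurableSpace X] {ν : Measure X}

theorem MemLp.sum_toLp {e : ℕ → X → ℂ} (he : ∀ k, MemLp (e k) 2 ν) (N : ℕ) :
    ∑ k ∈ Finset.range N, (he k).toLp (e k) =
      (memLp_finsetSum (Finset.range N) fun k _ => he k).toLp
        (fun x => ∑ k ∈ Finset.range N, e k x) := by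
  induction N with
  | zero => simp; rfl
  | succ N ih =>
    rw [Finset.sum_range_succ, ih, ← MemLp.toLp_add]
    congr 1
    ext x
    simp [Finset.sum_range_succ]

theorem hasL2Sum_iff {e : ℕ → X → ℂ} (he : ∀ k, MemLp (e k) 2 ν) {g : X → ℂ} (hg : MemLp g 2 ν) :
    HasL2Sum ν e g ↔
      Tendsto (fun N => ∑ k ∈ Finset.range N, (he k).toLp (e k)) atTop (𝓝 (hg.toLp g)) := by
  simp_rw [MemLp.sum_toLp he]
  rw [Lp.tendsto_Lp_iff_tendsto_eLpNorm'', HasL2Sum, and_iff_right hg]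
  refine tendsto_congr fun N => ?_
  rw [← eLpNorm_neg]
  congr 1
  ext x
  simp

theorem exists_hasL2Sum {e : ℕ → X → ℂ} (he : ∀ k, MemLp (e k) 2 ν)
    (hs : Summable fun k => (he k).toLp (e k)) : ∃ g, HasL2Sum ν e g := by
  obtain ⟨x, hx⟩ := hs
  refine ⟨x, (hasL2Sum_iff he (Lp.memLp x)).2 ?_⟩
  rw [Lp.toLp_coeFn]
  exact hx.tendsto_sum_nat

/-- A sum over `ℕ` may be taken over each residue class modulo `q` first. -/
theorem hasSum_of_hasSum_residues {α : Type*} [AddCommMonoid α] [TopologicalSpace α]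
    [ContinuousAdd α] {q : ℕ} (hq : 0 < q) {f : ℕ → α} {g : Fin q → α}
    (h : ∀ r : Fin q, HasSum (fun s => f (r + q * s)) (g r)) : HasSum f (∑ r, g r) := by
  have h1 : f = fun k => ∑ r : Fin q, if k % q = r then f k else 0 := by
    ext k
    rw [Finset.sum_eq_single (⟨k % q, Nat.mod_lt _ hq⟩ : Fin q)]
    · simp
    · intro r _ hr
      rw [if_neg]
      intro h2
      exact hr (Fin.ext h2.symm)
    · simp
  rw [h1]
  refine hasSum_sum fun r _ => ?_
  have hinj : Function.Injective fun s : ℕ => (r : ℕ) + q * s := by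
    intro a b hab
    simp only at hab
    exact Nat.eq_of_mul_eq_mul_left hq (by omega)
  refine (hinj.hasSum_iff ?_).1 ?_
  · intro k hk
    rw [if_neg]
    intro h2
    exact hk ⟨k / q, by simp only; rw [← h2]; exact Nat.mod_add_div k q⟩
  · have h3 : ((fun k => if k % q = r then f k else 0) ∘ fun s : ℕ => (r : ℕ) + q * s) =
        fun s => f (r + q * s) := by
      ext s
      simp [Nat.mod_eq_of_lt r.2]
    rw [h3]
    exact h r

theorem star_dotProduct_self_eq {m : Type*} [Fintype m] (w : m → ℂ) :
    star w ⬝ᵥ w = ((∑ i, ‖w i‖ ^ 2 : ℝ) : ℂ) := by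
  rw [dotProduct, Complex.ofReal_sum]
  refine Finset.sum_congr rfl fun i _ => ?_
  rw [Pi.star_apply, mul_comm, ← starRingEnd_apply, Complex.mul_conj, Complex.normSq_eq_norm_sq]

/-- A matrix with `Γ Γᴴ = 1` has an isometric adjoint. -/
theorem Matrix.sum_norm_sq_conjTranspose_mulVec {m n : Type*} [Fintype m] [Fintype n]
    [DecidableEq m] {Γ : Matrix m n ℂ} (h : Γ * Γᴴ = 1) (v : m → ℂ) :
    ∑ ℓ, ‖∑ r, conj (Γ r ℓ) * v r‖ ^ 2 = ∑ r, ‖v r‖ ^ 2 := by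
  have h2 : star (Γᴴ *ᵥ v) ⬝ᵥ (Γᴴ *ᵥ v) = star v ⬝ᵥ v := by
    rw [star_mulVec, conjTranspose_conjTranspose, ← dotProduct_mulVec, mulVec_mulVec, h,
      one_mulVec]
  rw [star_dotProduct_self_eq, star_dotProduct_self_eq] at h2
  exact Complex.ofReal_injective h2

theorem Matrix.norm_apply_le_one {m n : Type*} [Fintype m] [Fintype n]
    [DecidableEq m] {Γ : Matrix m n ℂ} (h : Γ * Γᴴ = 1) (r : m) (ℓ : n) : ‖Γ r ℓ‖ ≤ 1 := by
  have h1 := Matrix.sum_norm_sq_conjTranspose_mulVec h (Pi.single r 1)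
  simp only [Pi.single_apply, mul_ite, mul_one, mul_zero, Finset.sum_ite_eq', Finset.mem_univ,
    if_true, RCLike.norm_conj, apply_ite norm, norm_one, norm_zero, ite_pow, one_pow,
    ne_eq, OfNat.ofNat_ne_zero, not_false_eq_true, zero_pow] at h1
  have h2 := Finset.single_le_sum (f := fun ℓ => ‖Γ r ℓ‖ ^ 2) (fun i _ => by positivity)
    (Finset.mem_univ ℓ)
  rw [h1] at h2
  exact (sq_le_one_iff₀ (norm_nonneg _)).1 h2

end Series

/-! ### Polyphase components -/

section Polyphase

open scoped ENNReal InnerProductSpace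

set_option linter.unusedSectionVars false

variable {K : Type*} [Field K] [ValuativeRel K] [TopologicalSpace K]
  [IsNonarchimedeanLocalField K] [MeasurableSpace K] [BorelSpace K]
  {ϖ : K} {χ : AddChar K Circle} {q : ℕ} {u : ℕ → K}

namespace IsWaveletLattice

variable (H : IsWaveletLattice ϖ χ q u)
include H

theorem exists_add (m n : ℕ) : ∃ k, u k = u m + u n := by
  obtain ⟨l, hl⟩ := H.exists_neg n
  obtain ⟨k, hk⟩ := H.exists_sub m l
  exact ⟨k, by rw [hk, hl, sub_neg_eq_add]⟩

/-- The index of the sum of two lattice elements. -/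
noncomputable def addIndex (m n : ℕ) : ℕ := (H.exists_add m n).choose

theorem map_addIndex (m n : ℕ) : u (H.addIndex m n) = u m + u n := (H.exists_add m n).choose_spec

theorem map_mul_index (m : ℕ) : u (q * m) = ϖ⁻¹ * u m := by
  have := H.map_digit 0 H.q_pos m
  rwa [zero_add, H.map_zero, zero_add] at this

theorem addIndex_digit (m s : ℕ) {r : ℕ} (hr : r < q) :
    H.addIndex (q * m) (r + q * s) = r + q * H.addIndex m s := by
  apply H.injective
  rw [H.map_addIndex, H.map_mul_index, H.map_digit r hr, H.map_digit r hr, H.map_addIndex]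
  ring

theorem injective_addIndex (m : ℕ) : Function.Injective (H.addIndex m) := by
  intro k l h
  have h1 := congrArg u h
  rw [H.map_addIndex, H.map_addIndex] at h1
  exact H.injective (add_left_cancel h1)

variable (μ : Measure K) [μ.IsAddHaarMeasure] (hμ : μ (𝒪[K] : Set K) = 1)
include hμ

theorem orthonormal_toLp_latticeChar : Orthonormal ℂ fun k =>
    (memLp_latticeChar (u := u) μ H.continuous k).toLp (latticeChar χ u k) := by
  have h := (H.charBasis μ hμ).orthonormal
  simpa only [funext (H.charBasis_apply μ hμ)] using h

/-- Dilation by `ϖ` maps `𝒪[K]` into itself and multiplies integrals by at most `q`. -/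
theorem map_prime_mul_restrict_le : (μ.restrict (𝒪[K] : Set K)).map (fun x => ϖ * x) ≤
    (q : ℝ≥0∞) • μ.restrict (𝒪[K] : Set K) := by
  have hm : Measurable fun x : K => ϖ * x := (continuous_const_mul ϖ).measurable
  rw [Measure.le_iff]
  intro s hs
  have h1 : μ.map (fun x => ϖ * x) (s ∩ 𝒪[K]) = ((q : ℝ≥0∞) • μ) (s ∩ 𝒪[K]) := by
    rw [H.map_prime_mul μ hμ]
  rw [Measure.map_apply hm (hs.inter measurableSet_integer)] at h1
  rw [Measure.map_apply hm hs, Measure.smul_apply, Measure.restrict_apply hs,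
    Measure.restrict_apply (hm hs)]
  rw [Measure.smul_apply] at h1
  rw [← h1]
  exact measure_mono fun x hx => ⟨hx.1, mul_mem H.prime_mem hx.2⟩

theorem quasiMeasurePreserving_prime_mul :
    Measure.QuasiMeasurePreserving (fun x => ϖ * x) (μ.restrict (𝒪[K] : Set K))
      (μ.restrict (𝒪[K] : Set K)) :=
  ⟨(continuous_const_mul ϖ).measurable,
    (Measure.absolutelyContinuous_of_le (H.map_prime_mul_restrict_le μ hμ)).trans
      Measure.smul_absolutelyContinuous⟩

theorem memLp_comp_prime_mul {f : K → ℂ} (hf : MemLp f 2 (μ.restrict (𝒪[K] : Set K))) :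
    MemLp (fun x => f (ϖ * x)) 2 (μ.restrict (𝒪[K] : Set K)) := by
  have h1 : MemLp f 2 ((μ.restrict (𝒪[K] : Set K)).map (fun x => ϖ * x)) :=
    (hf.smul_measure (ENNReal.natCast_ne_top q)).mono_measure (H.map_prime_mul_restrict_le μ hμ)
  exact h1.comp_of_map (continuous_const_mul _).measurable.aemeasurable

theorem lintegral_comp_prime_mul_le {f : K → ℂ}
    (hf : AEStronglyMeasurable f (μ.restrict (𝒪[K] : Set K))) :
    ∫⁻ x in (𝒪[K] : Set K), ‖f (ϖ * x)‖ₑ ^ 2 ∂μ ≤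
      q * ∫⁻ x in (𝒪[K] : Set K), ‖f x‖ₑ ^ 2 ∂μ := by
  have hle := H.map_prime_mul_restrict_le μ hμ
  have h2 : AEMeasurable (fun x => ‖f x‖ₑ ^ 2)
      ((μ.restrict (𝒪[K] : Set K)).map (fun x => ϖ * x)) :=
    (hf.enorm.pow_const 2).mono_ac
      ((Measure.absolutelyContinuous_of_le hle).trans Measure.smul_absolutelyContinuous)
  rw [← lintegral_map' h2 (continuous_const_mul _).measurable.aemeasurable]
  refine (lintegral_mono' hle le_rfl).trans ?_
  rw [lintegral_smul_measure, smul_eq_mul]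

theorem hasL2Sum_polyphaseComponent {a : ℕ → ℂ} (ha : Summable fun k => ‖a k‖ ^ 2) {r : ℕ} :
    HasL2Sum (μ.restrict (𝒪[K] : Set K)) (fun k => fun ξ => a (r + q * k) *
      conj (χ (u (q * k) * ξ) : ℂ)) (polyphaseComponent μ q χ u a r) := by
  have hinj : Function.Injective fun k : ℕ => q * k := fun k l h =>
    Nat.eq_of_mul_eq_mul_left H.q_pos h
  have hinj' : Function.Injective fun k : ℕ => r + q * k := fun k l h =>
    hinj (Nat.add_left_cancel h)
  refine Classical.epsilon_spec (exists_hasL2Sum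
    (fun k => (memLp_latticeChar μ H.continuous (q * k)).const_mul (a (r + q * k))) ?_)
  have h := ((H.orthonormal_toLp_latticeChar μ hμ).comp _ hinj).summable_smul
    (a := fun k => a (r + q * k)) (ha.comp_injective hinj')
  exact h

/-- The polyphase components depend on `ϖ⁻¹ ξ` only. As functions of this variable, they have the
coefficients `a (r + q s)` with respect to the lattice characters. -/
theorem setIntegral_polyphaseComponent {a : ℕ → ℂ} (ha : Summable fun k => ‖a k‖ ^ 2) {r : ℕ}
    (s : ℕ) :
    ∫ ξ in (𝒪[K] : Set K), polyphaseComponent μ q χ u a r (ϖ * ξ) * (χ (u s * ξ) : ℂ) ∂μ =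
      a (r + q * s) := by
  have hL2 := H.hasL2Sum_polyphaseComponent μ hμ ha (r := r)
  set P := polyphaseComponent μ q χ u a r with hP
  have he : ∀ k, MemLp (fun ξ => a (r + q * k) * latticeChar χ u k ξ) 2
      (μ.restrict (𝒪[K] : Set K)) := fun k =>
    (memLp_latticeChar μ H.continuous k).const_mul (a (r + q * k))
  have hPϖ := H.memLp_comp_prime_mul μ hμ hL2.1
  have hsum : HasL2Sum (μ.restrict (𝒪[K] : Set K))
      (fun k ξ => a (r + q * k) * latticeChar χ u k ξ) (fun ξ => P (ϖ * ξ)) := by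
    refine ⟨hPϖ, ?_⟩
    rw [tendsto_eLpNorm_zero_iff]
    have h1 := ENNReal.Tendsto.const_mul (tendsto_eLpNorm_zero_iff.1 hL2.2)
      (Or.inr (ENNReal.natCast_ne_top q))
    rw [mul_zero] at h1
    refine tendsto_of_tendsto_of_tendsto_of_le_of_le tendsto_const_nhds h1 (fun _ => zero_le)
      fun N => ?_
    have hmeas : AEStronglyMeasurable (fun ξ => P ξ - ∑ k ∈ Finset.range N, a (r + q * k) *
        conj (χ (u (q * k) * ξ) : ℂ)) (μ.restrict (𝒪[K] : Set K)) :=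
      (hL2.1.sub (memLp_finsetSum (Finset.range N) fun k _ =>
        (memLp_latticeChar μ H.continuous (q * k)).const_mul (a (r + q * k)))).1
    refine le_trans (le_of_eq ?_) (H.lintegral_comp_prime_mul_le μ hμ hmeas)
    refine lintegral_congr fun ξ => ?_
    congr 3
    refine Finset.sum_congr rfl fun k _ => ?_
    simp only [latticeChar, H.map_mul_index]
    congr 4
    have := H.ne_zero
    field_simp
  have h2 := (hasL2Sum_iff he hPϖ).1 hsum
  have h3 := ((innerSL ℂ (H.charBasis μ hμ s)).continuous.tendsto _).comp h2
  rw [innerSL_apply_apply, H.inner_charBasis μ hμ hPϖ s] at h3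
  refine tendsto_nhds_unique h3 (tendsto_const_nhds.congr' ?_)
  filter_upwards [eventually_gt_atTop s] with N hN
  have h4 : ∀ k, (he k).toLp _ = a (r + q * k) • H.charBasis μ hμ k := fun k => by
    rw [charBasis_apply]; rfl
  simp only [Function.comp, h4, innerSL_apply_apply, inner_sum, inner_smul_right,
    orthonormal_iff_ite.1 (H.charBasis μ hμ).orthonormal, mul_ite, mul_one, mul_zero,
    Finset.sum_ite_eq, Finset.mem_range, hN, if_true]

/-- If the polyphase matrix satisfies `Γ Γᴴ = 1`, then the operation that maps the sequence `c` to
the sequences `m ↦ ∑ k, conj (h ℓ k) c (k')`, where `u k' = u (q m) + u k`, is an isometry. In terms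
of the functions `C r = ∑ s, c (r + q s) conj χ (u s · )`, it is multiplication by `Γᴴ`. -/
theorem sum_tsum_enorm_sq_polyphase {L : ℕ} {h : Fin (L + 1) → ℕ → ℂ}
    (hh : ∀ ℓ, Summable fun k => ‖h ℓ k‖ ^ 2)
    (hΓ : ∀ᵐ ξ ∂(μ.restrict (𝒪[K] : Set K)),
      polyphaseMatrix μ q χ u h ξ * (polyphaseMatrix μ q χ u h ξ)ᴴ = 1)
    {c : ℕ → ℂ} (hc : Summable fun k => ‖c k‖ ^ 2) :
    ∑ ℓ, ∑' m, ‖∑' k, conj (h ℓ k) * c (H.addIndex (q * m) k)‖ₑ ^ 2 = ∑' k, ‖c k‖ₑ ^ 2 := by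
  set ν := μ.restrict (𝒪[K] : Set K) with hν
  set b := H.charBasis μ hμ with hb
  have hinj : ∀ r, Function.Injective fun k : ℕ => r + q * k := fun r k l h =>
    Nat.eq_of_mul_eq_mul_left H.q_pos (Nat.add_left_cancel h)
  -- the polyphase components and the functions `C r`
  let A : Fin (L + 1) → Fin q → K → ℂ := fun ℓ r ξ => polyphaseMatrix μ q χ u h (ϖ * ξ) r ℓ
  have hA : ∀ ℓ r, MemLp (A ℓ r) 2 ν := fun ℓ r =>
    H.memLp_comp_prime_mul μ hμ (H.hasL2Sum_polyphaseComponent μ hμ (hh ℓ)).1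
  have hAs : ∀ ℓ r s, ⟪b s, (hA ℓ r).toLp (A ℓ r)⟫_ℂ = h ℓ (r + q * s) := by
    intro ℓ r s
    rw [hb, H.inner_charBasis μ hμ]
    exact H.setIntegral_polyphaseComponent μ hμ (hh ℓ) s
  have hΓ' : ∀ᵐ ξ ∂ν, polyphaseMatrix μ q χ u h (ϖ * ξ) *
      (polyphaseMatrix μ q χ u h (ϖ * ξ))ᴴ = 1 :=
    (H.quasiMeasurePreserving_prime_mul μ hμ).ae hΓ
  have hC : ∀ r : Fin q, ∃ C : K → ℂ, MemLp C 2 ν ∧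
      ∀ s, ∫ ξ in (𝒪[K] : Set K), C ξ * (χ (u s * ξ) : ℂ) ∂μ = c (r + q * s) := by
    intro r
    obtain ⟨x, hx⟩ := b.orthonormal.summable_smul (a := fun s => c (r + q * s))
      (hc.comp_injective (hinj r))
    refine ⟨x, Lp.memLp x, fun s => ?_⟩
    rw [← H.inner_charBasis μ hμ (Lp.memLp x), Lp.toLp_coeFn]
    exact b.orthonormal.inner_of_hasSum hx s
  choose C hCmem hCs using hC
  have hCnorm : ∀ r, ∫⁻ ξ, ‖C r ξ‖ₑ ^ 2 ∂ν = ∑' s, ‖c (r + q * s)‖ₑ ^ 2 := by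
    intro r
    rw [← H.tsum_enorm_setIntegral_char μ hμ (hCmem r)]
    simp_rw [hCs]
  let G : Fin (L + 1) → K → ℂ := fun ℓ ξ => ∑ r, conj (A ℓ r ξ) * C r ξ
  have hAC : ∀ ℓ r, MemLp (fun ξ => conj (A ℓ r ξ) * C r ξ) 2 ν := by
    intro ℓ r
    refine (hCmem r).of_le ((hA ℓ r).1.star.mul (hCmem r).1) ?_
    filter_upwards [hΓ'] with ξ hξ
    rw [norm_mul, RCLike.norm_conj]
    exact mul_le_of_le_one_left (norm_nonneg _) (Matrix.norm_apply_le_one hξ r ℓ)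
  have hG : ∀ ℓ, MemLp (G ℓ) 2 ν := fun ℓ => memLp_finsetSum _ fun r _ => hAC ℓ r
  have hcoeff : ∀ ℓ m, ∑' k, conj (h ℓ k) * c (H.addIndex (q * m) k) =
      ∫ ξ in (𝒪[K] : Set K), G ℓ ξ * (χ (u m * ξ) : ℂ) ∂μ := by
    intro ℓ m
    have hCχ : ∀ r, MemLp (fun ξ => C r ξ * (χ (u m * ξ) : ℂ)) 2 ν := by
      intro r
      refine (hCmem r).of_le ((hCmem r).1.mul
        (H.continuous_char (u m)).measurable.aestronglyMeasurable) (ae_of_all _ fun ξ => ?_)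
      rw [norm_mul, Circle.norm_coe, mul_one]
    have h1 : ∫ ξ in (𝒪[K] : Set K), G ℓ ξ * (χ (u m * ξ) : ℂ) ∂μ =
        ∑ r, ⟪(hA ℓ r).toLp _, (hCχ r).toLp _⟫_ℂ := by
      simp only [G, Finset.sum_mul]
      rw [integral_finsetSum]
      · refine Finset.sum_congr rfl fun r _ => ?_
        rw [inner_toLp_toLp]
        refine integral_congr_ae (ae_of_all _ fun ξ => ?_)
        simp only
        ring
      · intro r _
        have h2 := (hA ℓ r).star.integrable_mul (hCχ r)
        refine h2.congr (ae_of_all _ fun ξ => ?_)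
        simp only [Pi.mul_apply, Pi.star_apply, starRingEnd_apply]
        ring
    rw [h1]
    refine (hasSum_of_hasSum_residues H.q_pos fun r => ?_).tsum_eq
    have h2 := b.hasSum_inner_mul_inner ((hA ℓ r).toLp _) ((hCχ r).toLp _)
    convert! h2 using 2 with s
    rw [← inner_conj_symm, hAs, H.addIndex_digit m s r.2, ← hCs r, hb, H.inner_charBasis μ hμ]
    congr 1
    refine integral_congr_ae (ae_of_all _ fun ξ => ?_)
    simp only
    rw [H.map_addIndex, add_mul, AddChar.map_add_eq_mul, Circle.coe_mul, mul_assoc]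
  calc _ = ∑ ℓ, ∫⁻ ξ, ‖G ℓ ξ‖ₑ ^ 2 ∂ν := by
        refine Finset.sum_congr rfl fun ℓ _ => ?_
        rw [← H.tsum_enorm_setIntegral_char μ hμ (hG ℓ)]
        simp_rw [hcoeff]
    _ = ∫⁻ ξ, ∑ ℓ, ‖G ℓ ξ‖ₑ ^ 2 ∂ν :=
        (lintegral_finsetSum' _ fun ℓ _ => (hG ℓ).1.enorm.pow_const 2).symm
    _ = ∫⁻ ξ, ∑ r, ‖C r ξ‖ₑ ^ 2 ∂ν := by
        refine lintegral_congr_ae ?_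
        filter_upwards [hΓ'] with ξ hξ
        have h1 := Matrix.sum_norm_sq_conjTranspose_mulVec hξ (fun r => C r ξ)
        simp_rw [enorm_sq_eq_ofReal]
        rw [← ENNReal.ofReal_sum_of_nonneg (fun _ _ => by positivity),
          ← ENNReal.ofReal_sum_of_nonneg (fun _ _ => by positivity), ← h1]
    _ = ∑ r : Fin q, ∑' s, ‖c (r + q * s)‖ₑ ^ 2 := by
        rw [lintegral_finsetSum' _ fun r _ => (hCmem r).1.enorm.pow_const 2]
        exact Finset.sum_congr rfl fun r _ => hCnorm r
    _ = _ := (hasSum_of_hasSum_residues (f := fun k => ‖c k‖ₑ ^ 2) H.q_pos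
        fun r => ENNReal.summable.hasSum).tsum_eq.symm

end IsWaveletLattice

end Polyphase

/-! ### Projections onto orthonormal systems -/

section Projections

open scoped ENNReal InnerProductSpace

variable {E : Type*} [NormedAddCommGroup E] [InnerProductSpace ℂ E] [CompleteSpace E]

/-- The orthogonal projection onto the closed span of an orthonormal system, with Bessel's sum as
the square of its norm. -/
theorem Orthonormal.exists_projection {ι : Type*} {v : ι → E} (hv : Orthonormal ℂ v) :
    ∃ P : E →L[ℂ] E, (∀ f, HasSum (fun k => ‖⟪v k, f⟫_ℂ‖ ^ 2) (‖P f‖ ^ 2)) ∧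
      ∀ f, ‖f - P f‖ ^ 2 + ‖P f‖ ^ 2 = ‖f‖ ^ 2 := by
  classical
  let W := hv.orthogonalFamily.linearIsometry
  let T := W.toContinuousLinearMap.adjoint
  have hT : ∀ f k, T f k = ⟪v k, f⟫_ℂ := by
    intro f k
    have h1 := lp.inner_single_left (𝕜 := ℂ) k (1 : ℂ) (T f)
    rw [ContinuousLinearMap.adjoint_inner_right, LinearIsometry.coe_toContinuousLinearMap,
      hv.orthogonalFamily.linearIsometry_apply_single] at h1
    simpa using h1.symm
  refine ⟨W.toContinuousLinearMap.comp T, fun f => ?_, fun f => ?_⟩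
  · have h1 := lp.hasSum_inner (𝕜 := ℂ) (T f) (T f)
    rw [inner_self_eq_norm_sq_to_K] at h1
    have h2 : ∀ k, ⟪T f k, T f k⟫_ℂ = ((‖⟪v k, f⟫_ℂ‖ ^ 2 : ℝ) : ℂ) := by
      intro k
      rw [hT, inner_self_eq_norm_sq_to_K, Complex.ofReal_pow]
      rfl
    simp_rw [h2] at h1
    have h3 : ‖W.toContinuousLinearMap.comp T f‖ = ‖T f‖ := W.norm_map (T f)
    rw [h3]
    exact Complex.hasSum_ofReal.1 (by rw [Complex.ofReal_pow]; exact h1)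
  · have h1 : ⟪f - W (T f), W (T f)⟫_ℂ = 0 := by
      rw [inner_sub_left, W.inner_map_map]
      have h2 := ContinuousLinearMap.adjoint_inner_left W.toContinuousLinearMap (T f) f
      rw [LinearIsometry.coe_toContinuousLinearMap] at h2
      rw [← h2, sub_self]
    have h3 := norm_add_sq_eq_norm_sq_add_norm_sq_of_inner_eq_zero _ _ h1
    rw [sub_add_cancel] at h3
    simp only [sq]
    exact h3.symm

omit [CompleteSpace E] in
/-- A family of contractions that converges to zero on a total set converges to zero. -/
theorem tendsto_zero_of_total {ι : Type*} {l : Filter ι} {B : ι → E →L[ℂ] E}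
    (hB : ∀ i f, ‖B i f‖ ≤ ‖f‖) {s : Set E} (hs : (Submodule.span ℂ s).topologicalClosure = ⊤)
    (h : ∀ f ∈ s, Tendsto (fun i => B i f) l (𝓝 0)) (f : E) :
    Tendsto (fun i => B i f) l (𝓝 0) := by
  have hspan : ∀ g ∈ Submodule.span ℂ s, Tendsto (fun i => B i g) l (𝓝 0) := by
    intro g hg
    induction hg using Submodule.span_induction with
    | mem x hx => exact h x hx
    | zero => simpa using tendsto_const_nhds
    | add x y _ _ hx hy => simpa using hx.add hy
    | smul c x _ hx => simpa using hx.const_smul c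
  rw [Metric.tendsto_nhds]
  intro ε hε
  have hf : f ∈ closure (Submodule.span ℂ s : Set E) := by
    rw [← Submodule.topologicalClosure_coe, hs]; trivial
  obtain ⟨g, hg, hfg⟩ := Metric.mem_closure_iff.1 hf (ε / 2) (by positivity)
  filter_upwards [(Metric.tendsto_nhds.1 (hspan g hg)) (ε / 2) (by positivity)] with i hi
  rw [dist_zero_right] at hi ⊢
  have h1 : B i f = B i (f - g) + B i g := by rw [map_sub, sub_add_cancel]
  rw [dist_eq_norm] at hfg
  calc ‖B i f‖ ≤ ‖B i (f - g)‖ + ‖B i g‖ := by rw [h1]; exact norm_add_le _ _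
    _ < ε / 2 + ε / 2 := add_lt_add ((hB i _).trans_lt hfg) hi
    _ = ε := add_halves ε

omit [CompleteSpace E] [InnerProductSpace ℂ E] in
theorem tendsto_enorm_sq_iff {κ : Type*} {l : Filter κ} {x : κ → E} {y : E} :
    Tendsto (fun j => ‖x j‖ₑ ^ 2) l (𝓝 (‖y‖ₑ ^ 2)) ↔
      Tendsto (fun j => ‖x j‖ ^ 2) l (𝓝 (‖y‖ ^ 2)) := by
  simp_rw [enorm_sq_eq_ofReal]
  refine ⟨fun h => ?_, fun h => ENNReal.tendsto_ofReal h⟩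
  have h1 := (ENNReal.tendsto_toReal ENNReal.ofReal_ne_top).comp h
  simpa only [Function.comp_def, ENNReal.toReal_ofReal (sq_nonneg _)] using h1

omit [CompleteSpace E] [InnerProductSpace ℂ E] in
theorem tendsto_zero_iff_norm_sq {κ : Type*} {l : Filter κ} {x : κ → E} :
    Tendsto x l (𝓝 0) ↔ Tendsto (fun j => ‖x j‖ ^ 2) l (𝓝 0) := by
  rw [tendsto_zero_iff_norm_tendsto_zero]
  refine ⟨fun h => by simpa using h.pow 2, fun h => ?_⟩
  have h1 := (Real.continuous_sqrt.tendsto 0).comp h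
  simpa only [Function.comp_def, Real.sqrt_sq (norm_nonneg _), Real.sqrt_zero] using h1

/-- If the Bessel sums of orthonormal systems tend to zero on a total set, then they do so
everywhere. -/
theorem tendsto_tsum_inner_zero {κ ι : Type*} {l : Filter κ} {v : κ → ι → E}
    (hv : ∀ j, Orthonormal ℂ (v j)) {s : Set E}
    (hs : (Submodule.span ℂ s).topologicalClosure = ⊤)
    (h : ∀ f ∈ s, Tendsto (fun j => ∑' k, ‖⟪v j k, f⟫_ℂ‖ₑ ^ 2) l (𝓝 0)) (f : E) :
    Tendsto (fun j => ∑' k, ‖⟪v j k, f⟫_ℂ‖ₑ ^ 2) l (𝓝 0) := by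
  choose P hP hP' using fun j => (hv j).exists_projection
  have hiff : ∀ f, Tendsto (fun j => ∑' k, ‖⟪v j k, f⟫_ℂ‖ₑ ^ 2) l (𝓝 0) ↔
      Tendsto (fun j => P j f) l (𝓝 0) := by
    intro f
    simp_rw [fun j => (hP j f).tsum_enorm_sq_eq]
    have h1 := tendsto_enorm_sq_iff (x := fun j => P j f) (y := 0) (l := l)
    simp only [enorm_zero, norm_zero, ne_eq, OfNat.ofNat_ne_zero, not_false_eq_true, zero_pow] at h1
    exact h1.trans tendsto_zero_iff_norm_sq.symm
  simp_rw [hiff] at h ⊢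
  refine tendsto_zero_of_total (fun j f => ?_) hs h f
  refine (sq_le_sq₀ (norm_nonneg _) (norm_nonneg _)).1 ?_
  rw [← hP' j f]
  exact le_add_of_nonneg_left (sq_nonneg _)

/-- If the Bessel sums of orthonormal systems tend to the square of the norm on a total set, then
they do so everywhere. -/
theorem tendsto_tsum_inner_norm {κ ι : Type*} {l : Filter κ} {v : κ → ι → E}
    (hv : ∀ j, Orthonormal ℂ (v j)) {s : Set E}
    (hs : (Submodule.span ℂ s).topologicalClosure = ⊤)
    (h : ∀ f ∈ s, Tendsto (fun j => ∑' k, ‖⟪v j k, f⟫_ℂ‖ₑ ^ 2) l (𝓝 (‖f‖ₑ ^ 2))) (f : E) :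
    Tendsto (fun j => ∑' k, ‖⟪v j k, f⟫_ℂ‖ₑ ^ 2) l (𝓝 (‖f‖ₑ ^ 2)) := by
  choose P hP hP' using fun j => (hv j).exists_projection
  have hiff : ∀ f, Tendsto (fun j => ∑' k, ‖⟪v j k, f⟫_ℂ‖ₑ ^ 2) l (𝓝 (‖f‖ₑ ^ 2)) ↔
      Tendsto (fun j => (ContinuousLinearMap.id ℂ E - P j) f) l (𝓝 0) := by
    intro f
    simp_rw [fun j => (hP j f).tsum_enorm_sq_eq]
    rw [tendsto_enorm_sq_iff, tendsto_zero_iff_norm_sq]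
    have h1 : ∀ j, ‖(ContinuousLinearMap.id ℂ E - P j) f‖ ^ 2 = ‖f‖ ^ 2 - ‖P j f‖ ^ 2 := fun j =>
      eq_sub_of_add_eq (hP' j f)
    simp_rw [h1]
    constructor
    · intro h
      have h2 := h.const_sub (‖f‖ ^ 2)
      rwa [sub_self] at h2
    · intro h
      have h2 := h.const_sub (‖f‖ ^ 2)
      simp_rw [sub_sub_cancel, sub_zero] at h2
      exact h2
  simp_rw [hiff] at h ⊢
  refine tendsto_zero_of_total (fun j f => ?_) hs h f
  refine (sq_le_sq₀ (norm_nonneg _) (norm_nonneg _)).1 ?_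
  rw [← hP' j f]
  exact le_add_of_nonneg_right (sq_nonneg _)

end Projections

/-! ### Dilations and translations of a function -/

section Dilation

open scoped ENNReal InnerProductSpace

set_option linter.unusedSectionVars false

variable {K : Type*} [Field K] [ValuativeRel K] [TopologicalSpace K]
  [IsNonarchimedeanLocalField K] [MeasurableSpace K] [BorelSpace K]
  {ϖ : K} {χ : AddChar K Circle} {q : ℕ} {u : ℕ → K}

/-- The function `x ↦ q ^ (j/2) f(ϖ ^ (-j) x - u(k))`. -/
noncomputable def dilate {K : Type*} [Field K] (q : ℕ) (ϖ : K) (u : ℕ → K) (j : ℤ) (k : ℕ)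
    (f : K → ℂ) : K → ℂ :=
  fun x => (((q : ℝ) ^ ((j : ℝ) / 2) : ℝ) : ℂ) * f (ϖ ^ (-j) * x - u k)

namespace IsWaveletLattice

variable (H : IsWaveletLattice ϖ χ q u)
include H

theorem dilate_factor_mul (j : ℤ) :
    (((q : ℝ) ^ ((j : ℝ) / 2) : ℝ) : ℂ) * (((q : ℝ) ^ ((j : ℝ) / 2) : ℝ) : ℂ) = (q : ℂ) ^ j := by
  have hq : (0 : ℝ) < q := by exact_mod_cast H.q_pos
  rw [← Complex.ofReal_mul, ← Real.rpow_add hq, add_halves, Real.rpow_intCast]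
  push_cast
  rfl

theorem enorm_dilate_factor_sq (j : ℤ) :
    ‖(((q : ℝ) ^ ((j : ℝ) / 2) : ℝ) : ℂ)‖ₑ ^ 2 = (q : ℝ≥0∞) ^ j := by
  rw [sq, ← enorm_mul, H.dilate_factor_mul]
  have h1 : (q : NNReal) ≠ 0 := by exact_mod_cast H.q_pos.ne'
  rw [enorm_eq_nnnorm, nnnorm_zpow, ← ENNReal.coe_natCast, ← ENNReal.coe_zpow h1]
  congr 2
  simp

theorem dilate_factor_add_one (j : ℤ) :
    (((q : ℝ) ^ ((j : ℝ) / 2) : ℝ) : ℂ) * (Real.sqrt q : ℂ) =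
      (((q : ℝ) ^ (((j + 1 : ℤ) : ℝ) / 2) : ℝ) : ℂ) := by
  have hq : (0 : ℝ) < q := by exact_mod_cast H.q_pos
  rw [← Complex.ofReal_mul, Real.sqrt_eq_rpow, ← Real.rpow_add hq]
  congr 2
  push_cast
  ring

variable (μ : Measure K) [μ.IsAddHaarMeasure] (hμ : μ (𝒪[K] : Set K) = 1)
include hμ

theorem lintegral_enorm_dilate (j : ℤ) (k : ℕ) (f : K → ℂ) :
    ∫⁻ x, ‖dilate q ϖ u j k f x‖ₑ ^ 2 ∂μ = ∫⁻ x, ‖f x‖ₑ ^ 2 ∂μ := by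
  have hq : (q : ℝ≥0∞) ^ j ≠ ∞ :=
    ENNReal.zpow_ne_top H.q_ne_zero (ENNReal.natCast_ne_top q) _
  simp_rw [dilate, enorm_mul, mul_pow, H.enorm_dilate_factor_sq]
  rw [lintegral_const_mul' _ _ hq, H.lintegral_comp_affine μ hμ (-j) (u k) fun x => ‖f x‖ₑ ^ 2,
    ← mul_assoc, ← ENNReal.zpow_add H.q_ne_zero (ENNReal.natCast_ne_top q), add_neg_cancel,
    zpow_zero, one_mul]

theorem memLp_dilate (j : ℤ) (k : ℕ) {f : K → ℂ} (hf : MemLp f 2 μ) :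
    MemLp (dilate q ϖ u j k f) 2 μ := by
  have h1 : AEStronglyMeasurable f (μ.map fun x => ϖ ^ (-j) * x - u k) := by
    rw [H.map_affine μ hμ]
    exact hf.1.mono_ac Measure.smul_absolutelyContinuous
  refine ⟨(h1.comp_measurable (H.measurableEmbedding_affine (-j) (u k)).measurable).const_mul _, ?_⟩
  rw [eLpNorm_two_lt_top_iff, H.lintegral_enorm_dilate μ hμ]
  exact eLpNorm_two_lt_top_iff.1 hf.2

theorem integral_dilate_mul_conj (j : ℤ) (k l : ℕ) (f : K → ℂ) :
    ∫ x, dilate q ϖ u j k f x * conj (dilate q ϖ u j l f x) ∂μ =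
      ∫ x, f (x - u k) * conj (f (x - u l)) ∂μ := by
  have h1 : ∀ x, dilate q ϖ u j k f x * conj (dilate q ϖ u j l f x) =
      (q : ℂ) ^ j * (f (ϖ ^ (-j) * x - 0 - u k) * conj (f (ϖ ^ (-j) * x - 0 - u l))) := by
    intro x
    rw [← H.dilate_factor_mul, dilate, dilate, RingHom.map_mul, Complex.conj_ofReal, sub_zero]
    ring
  simp_rw [h1]
  rw [integral_const_mul, H.integral_comp_affine μ hμ (-j) 0
    fun x => f (x - u k) * conj (f (x - u l)), ← mul_assoc, ← zpow_add₀, add_neg_cancel, zpow_zero,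
    one_mul]
  exact_mod_cast H.q_pos.ne'

theorem hasL2Sum_dilate (j : ℤ) (m : ℕ) {e : ℕ → K → ℂ} {g : K → ℂ} (h : HasL2Sum μ e g) :
    HasL2Sum μ (fun k => dilate q ϖ u j m (e k)) (dilate q ϖ u j m g) := by
  refine ⟨H.memLp_dilate μ hμ j m h.1, ?_⟩
  rw [tendsto_eLpNorm_zero_iff]
  refine (tendsto_eLpNorm_zero_iff.1 h.2).congr fun N => ?_
  rw [← H.lintegral_enorm_dilate μ hμ j m]
  refine lintegral_congr fun x => ?_
  simp only [dilate, mul_sub, Finset.mul_sum]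

omit hμ in
theorem dilate_twoScale_term (j : ℤ) (m k : ℕ) (a : ℂ) (φ : K → ℂ) :
    dilate q ϖ u j m (fun x => (Real.sqrt q : ℂ) * (a * φ (ϖ⁻¹ * x - u k))) =
      fun x => a * dilate q ϖ u (j + 1) (H.addIndex (q * m) k) φ x := by
  ext x
  rw [dilate, dilate, ← H.dilate_factor_add_one, H.map_addIndex, H.map_mul_index]
  have h1 : ϖ⁻¹ * (ϖ ^ (-j) * x - u m) - u k = ϖ ^ (-(j + 1)) * x - (ϖ⁻¹ * u m + u k) := by
    rw [neg_add, zpow_add₀ H.ne_zero, zpow_neg_one]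
    ring
  rw [h1]
  ring

/-- The two-scale equation for the dilates: if the dilates of `φ` are orthonormal, then the
coefficients are square-summable and the series of dilates converges unconditionally. -/
theorem twoScale_dilate {φ g : K → ℂ} {a : ℕ → ℂ} (hφ : MemLp φ 2 μ)
    (horth : ∀ j, Orthonormal ℂ fun k => (H.memLp_dilate μ hμ j k hφ).toLp (dilate q ϖ u j k φ))
    (h : SatisfiesTwoScale μ q ϖ u φ a g) :
    (Summable fun k => ‖a k‖ ^ 2) ∧ ∀ j m,
      HasSum (fun k => a k • (H.memLp_dilate μ hμ (j + 1) (H.addIndex (q * m) k) hφ).toLp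
        (dilate q ϖ u (j + 1) (H.addIndex (q * m) k) φ))
        ((H.memLp_dilate μ hμ j m h.1).toLp (dilate q ϖ u j m g)) := by
  have hmem : ∀ j m k, MemLp (fun x => a k * dilate q ϖ u (j + 1) (H.addIndex (q * m) k) φ x) 2 μ :=
    fun j m k => (H.memLp_dilate μ hμ (j + 1) _ hφ).const_mul (a k)
  have hlim : ∀ j m, Tendsto (fun N => ∑ k ∈ Finset.range N,
      a k • (H.memLp_dilate μ hμ (j + 1) (H.addIndex (q * m) k) hφ).toLp
        (dilate q ϖ u (j + 1) (H.addIndex (q * m) k) φ)) atTop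
      (𝓝 ((H.memLp_dilate μ hμ j m h.1).toLp (dilate q ϖ u j m g))) := by
    intro j m
    have h1 := H.hasL2Sum_dilate μ hμ j m h
    simp_rw [H.dilate_twoScale_term] at h1
    exact (hasL2Sum_iff (hmem j m) _).1 h1
  have horth' : ∀ j m, Orthonormal ℂ fun k =>
      (H.memLp_dilate μ hμ (j + 1) (H.addIndex (q * m) k) hφ).toLp
        (dilate q ϖ u (j + 1) (H.addIndex (q * m) k) φ) := fun j m =>
    (horth (j + 1)).comp _ (H.injective_addIndex (q * m))
  have hsum : Summable fun k => ‖a k‖ ^ 2 := by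
    have h1 := (horth' 0 0).inner_products_summable ((H.memLp_dilate μ hμ 0 0 h.1).toLp _)
    refine h1.congr fun s => ?_
    congr 2
    have h3 := ((innerSL ℂ ((H.memLp_dilate μ hμ (0 + 1) (H.addIndex (q * 0) s) hφ).toLp _)
      ).continuous.tendsto _).comp (hlim 0 0)
    rw [innerSL_apply_apply] at h3
    refine tendsto_nhds_unique h3 (tendsto_const_nhds.congr' ?_)
    filter_upwards [eventually_gt_atTop s] with N hN
    simp only [Function.comp, innerSL_apply_apply, inner_sum, inner_smul_right]
    rw [Finset.sum_eq_single s]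
    · rw [inner_self_eq_norm_sq_to_K, (horth' 0 0).1 s]
      simp
    · intro k _ hks
      rw [(horth' 0 0).2 hks.symm, mul_zero]
    · intro hs
      exact absurd (Finset.mem_range.2 hN) hs
  refine ⟨hsum, fun j m => ?_⟩
  have h1 := ((horth' j m).summable_smul hsum).hasSum
  rwa [tendsto_nhds_unique h1.tendsto_sum_nat (hlim j m)] at h1

end IsWaveletLattice

end Dilation

/-! ### The scaling function -/

section Scaling

open scoped ENNReal InnerProductSpace

set_option linter.unusedSectionVars false

variable {K : Type*} [Field K] [ValuativeRel K] [TopologicalSpace K]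
  [IsNonarchimedeanLocalField K] [MeasurableSpace K] [BorelSpace K]
  {ϖ : K} {χ : AddChar K Circle} {q : ℕ} {u : ℕ → K}

namespace IsWaveletLattice

variable (H : IsWaveletLattice ϖ χ q u)
include H

variable (μ : Measure K) [μ.IsAddHaarMeasure]

/-- Periodization for the integral of a function with values in `ℂ`. -/
theorem hasSum_setIntegral_sub {F : K → ℂ} (hF : Integrable F μ) :
    HasSum (fun k => ∫ x in (𝒪[K] : Set K), F (x - u k) ∂μ) (∫ x, F x ∂μ) := by
  have h := hasSum_integral_iUnion (μ := μ) (f := F)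
    (fun k => measurableSet_integer.preimage (measurable_add_const (u k)))
    H.pairwise_disjoint_preimage_add hF.integrableOn
  rw [H.iUnion_preimage_add, setIntegral_univ] at h
  convert! h using 2 with k
  have h1 := (measurePreserving_add_right μ (u k)).setIntegral_preimage_emb
    (MeasurableEquiv.addRight (u k)).measurableEmbedding (fun x => F (x - u k)) (𝒪[K] : Set K)
  simpa using h1.symm

variable (hμ : μ (𝒪[K] : Set K) = 1)
include hμ

/-- If the periodization of `|g|²` is `1`, then the integral of `χ (u n · ) |g|²` over `K` is the
integral of the character `χ (u n · )` over `𝒪[K]`. -/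
theorem integral_char_mul_norm_sq {g : K → ℂ} (hg : MemLp g 2 μ)
    (h1 : ∀ᵐ ξ ∂(μ.restrict (𝒪[K] : Set K)), HasSum (fun k : ℕ => ‖g (ξ - u k)‖ ^ 2) 1) (n : ℕ) :
    ∫ ξ, (χ (u n * ξ) : ℂ) * ((‖g ξ‖ ^ 2 : ℝ) : ℂ) ∂μ = if n = 0 then 1 else 0 := by
  have hsq : Integrable (fun ξ => ((‖g ξ‖ ^ 2 : ℝ) : ℂ)) μ := hg.norm.integrable_sq.ofReal
  have hFint : Integrable (fun ξ => (χ (u n * ξ) : ℂ) * ((‖g ξ‖ ^ 2 : ℝ) : ℂ)) μ :=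
    hsq.bdd_mul (c := 1) (H.continuous_char (u n)).measurable.aestronglyMeasurable
      (ae_of_all _ fun x => (Circle.norm_coe _).le)
  have hper := H.hasSum_setIntegral_sub μ hFint
  have hχ : ∀ k ξ, χ (u n * (ξ - u k)) = χ (u n * ξ) := by
    intro k ξ
    rw [mul_sub, sub_eq_add_neg, AddChar.map_add_eq_mul, AddChar.map_neg_eq_inv, H.map_mul, inv_one,
      mul_one]
  simp_rw [hχ] at hper
  have hint : ∀ k, Integrable (fun ξ => (χ (u n * ξ) : ℂ) * ((‖g (ξ - u k)‖ ^ 2 : ℝ) : ℂ))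
      (μ.restrict (𝒪[K] : Set K)) := by
    intro k
    have h2 := (hFint.comp_sub_right (u k)).integrableOn (s := (𝒪[K] : Set K))
    simp_rw [hχ] at h2
    exact h2
  have hsum : Summable fun k => ∫ ξ in (𝒪[K] : Set K),
      ‖(χ (u n * ξ) : ℂ) * ((‖g (ξ - u k)‖ ^ 2 : ℝ) : ℂ)‖ ∂μ := by
    have h2 := (H.hasSum_setIntegral_sub μ hsq).summable
    rw [← Complex.summable_ofReal]
    refine h2.congr fun k => ?_
    rw [← integral_complex_ofReal]
    refine integral_congr_ae (ae_of_all _ fun ξ => ?_)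
    simp only
    rw [norm_mul, Circle.norm_coe, one_mul, Complex.norm_real, Real.norm_of_nonneg (sq_nonneg _)]
  have h3 := hasSum_integral_of_summable_integral_norm hint hsum
  rw [hper.unique h3]
  have h4 : ∫ ξ in (𝒪[K] : Set K), ∑' k, (χ (u n * ξ) : ℂ) * ((‖g (ξ - u k)‖ ^ 2 : ℝ) : ℂ) ∂μ =
      ∫ ξ in (𝒪[K] : Set K), (χ (u n * ξ) : ℂ) ∂μ := by
    refine integral_congr_ae ?_
    filter_upwards [h1] with ξ hξ
    have h5 := (Complex.hasSum_ofReal.2 hξ).mul_left (χ (u n * ξ) : ℂ)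
    rw [h5.tsum_eq, Complex.ofReal_one, mul_one]
  rw [h4, H.setIntegral_char μ hμ]
  by_cases hn : n = 0
  · rw [if_pos hn, hn, H.map_zero, Set.indicator_of_mem (by exact zero_mem 𝒪[K])]; rfl
  · rw [if_neg hn, Set.indicator_of_notMem (fun h => hn (H.eq_zero_of_mem h))]

/-- The dilates and translates of `φ` on one scale are orthonormal: by Plancherel's theorem their
inner products are integrals of characters against `|φ̂|²`, whose periodization is `1`. -/
theorem orthonormal_dilate {φ : K → ℂ} (hφ : MemLp φ 2 μ) (hMRA : GeneratesMRA μ ϖ χ u φ) (j : ℤ) :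
    Orthonormal ℂ fun k => (H.memLp_dilate μ hμ j k hφ).toLp (dilate q ϖ u j k φ) := by
  have hF := H.isFourierL2_fourierL2 μ hμ hφ
  rw [orthonormal_iff_ite]
  intro k l
  have htr : ∀ a, MemLp (fun x => φ (x - a)) 2 μ := fun a =>
    hφ.comp_measurePreserving (measurePreserving_sub_right μ a)
  rw [inner_toLp_toLp, H.integral_dilate_mul_conj μ hμ,
    ← (hF.comp_sub H (u l)).integral_mul_conj H hμ (htr _) (htr _) (hF.comp_sub H (u k))]
  obtain ⟨n, hn⟩ := H.exists_sub k l
  have h1 : ∀ ξ, conj (χ (u l * ξ) : ℂ) * fourierL2 μ ϖ χ φ ξ *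
      conj (conj (χ (u k * ξ) : ℂ) * fourierL2 μ ϖ χ φ ξ) =
        (χ (u n * ξ) : ℂ) * ((‖fourierL2 μ ϖ χ φ ξ‖ ^ 2 : ℝ) : ℂ) := by
    intro ξ
    rw [hn, sub_mul, sub_eq_add_neg, AddChar.map_add_eq_mul, AddChar.map_neg_eq_inv,
      Circle.coe_mul, Circle.coe_inv_eq_conj, RingHom.map_mul, Complex.conj_conj,
      ← Complex.normSq_eq_norm_sq, ← Complex.mul_conj]
    ring
  simp_rw [h1]
  rw [H.integral_char_mul_norm_sq μ hμ hF.1 hMRA.1]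
  have h2 : n = 0 ↔ k = l := by
    constructor
    · rintro rfl
      exact H.separated k l (by rw [← hn, H.map_zero]; exact zero_mem _)
    · rintro rfl
      exact H.eq_zero_of_mem (by rw [hn, sub_self]; exact zero_mem _)
  simp only [h2]

/-- The indicator functions of small balls, as elements of `L²(K)`. -/
noncomputable def ballIndicator (p : K × ℕ) : Lp ℂ 2 μ :=
  (H.memLp_indicator_integerBall μ hμ p.1 (p.2 : ℤ)).toLp _

theorem span_ballIndicator :
    (Submodule.span ℂ (Set.range (H.ballIndicator μ hμ))).topologicalClosure = ⊤ := by
  rw [Submodule.topologicalClosure_eq_top_iff, Submodule.eq_bot_iff]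
  intro f hf
  have h1 : f =ᵐ[μ] 0 := by
    refine H.ae_eq_zero_of_setIntegral_integerBall μ
      (fun a => H.integrableOn_integerBall μ hμ (Lp.memLp f) a 0) fun a n => ?_
    have h2 := (Submodule.mem_orthogonal _ _).1 hf _ (Submodule.subset_span ⟨(a, n), rfl⟩)
    have h3 := inner_toLp_toLp (H.memLp_indicator_integerBall μ hμ a (n : ℤ)) (Lp.memLp f)
    rw [Lp.toLp_coeFn] at h3
    rw [ballIndicator, h3] at h2
    rw [← h2, ← integral_indicator (measurableSet_integerBall _ _ _)]
    refine integral_congr_ae (ae_of_all _ fun x => ?_)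
    simp only [Set.indicator]
    split_ifs <;> simp
  exact Lp.ext (h1.trans (Lp.coeFn_zero _ _ _).symm)

theorem enorm_ballIndicator_sq (p : K × ℕ) :
    ‖H.ballIndicator μ hμ p‖ₑ ^ 2 = (q : ℝ≥0∞) ^ (-(p.2 : ℤ)) := by
  rw [ballIndicator, enorm_toLp_sq, ← H.measure_integerBall μ hμ p.1,
    ← lintegral_indicator_one (measurableSet_integerBall _ _ _)]
  refine lintegral_congr fun x => ?_
  simp only [Set.indicator]
  split_ifs <;> simp

theorem lintegral_integerBall_dilate (i : ℕ) (k : ℕ) (N : ℤ) (f : K → ℂ) :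
    ∫⁻ x in integerBall ϖ 0 N, ‖dilate q ϖ u (-(i : ℤ)) k f x‖ₑ ^ 2 ∂μ =
      ∫⁻ y in integerBall ϖ 0 (i + N), ‖f (y - u k)‖ₑ ^ 2 ∂μ := by
  have hq : (q : ℝ≥0∞) ^ (-(i : ℤ)) ≠ ∞ :=
    ENNReal.zpow_ne_top H.q_ne_zero (ENNReal.natCast_ne_top q) _
  have h := H.lintegral_comp_affine μ hμ i 0
    ((integerBall ϖ 0 (i + N)).indicator fun y => ‖f (y - u k)‖ₑ ^ 2)
  rw [lintegral_indicator (measurableSet_integerBall _ _ _)] at h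
  have h2 : ∀ x, (integerBall ϖ 0 N).indicator
      (fun x => ‖dilate q ϖ u (-(i : ℤ)) k f x‖ₑ ^ 2) x = (q : ℝ≥0∞) ^ (-(i : ℤ)) *
        (integerBall ϖ 0 (i + N)).indicator (fun y => ‖f (y - u k)‖ₑ ^ 2) (ϖ ^ (i : ℤ) * x - 0) := by
    intro x
    have h3 : ϖ ^ (i : ℤ) * x - 0 ∈ integerBall ϖ 0 (i + N) ↔ x ∈ integerBall ϖ 0 N := by
      rw [mem_integerBall, mem_integerBall, sub_zero, sub_zero, sub_zero, ← mul_assoc,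
        ← zpow_add₀ H.ne_zero]
      ring_nf
    by_cases hx : x ∈ integerBall ϖ 0 N
    · rw [Set.indicator_of_mem hx, Set.indicator_of_mem (h3.2 hx), dilate, enorm_mul, mul_pow,
        H.enorm_dilate_factor_sq, neg_neg, sub_zero]
    · rw [Set.indicator_of_notMem hx, Set.indicator_of_notMem (fun h => hx (h3.1 h)), mul_zero]
  rw [← lintegral_indicator (measurableSet_integerBall _ _ _)]
  simp_rw [h2]
  rw [lintegral_const_mul' _ _ hq, h, ← mul_assoc, ← ENNReal.zpow_add H.q_ne_zero
    (ENNReal.natCast_ne_top q), neg_add_cancel, zpow_zero, one_mul]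

/-- On large scales the dilates of an `L²` function do not see functions of bounded support: the
mass of the dilates on a fixed ball is the mass of the periodization of `|φ|²` on a ball that
shrinks to a point. -/
theorem tendsto_tsum_dilate_zero {φ : K → ℂ} (hφ : MemLp φ 2 μ) (p : K × ℕ) :
    Tendsto (fun i : ℕ => ∑' k,
      ‖⟪(H.memLp_dilate μ hμ (-(i : ℤ)) k hφ).toLp (dilate q ϖ u (-(i : ℤ)) k φ),
        H.ballIndicator μ hμ p⟫_ℂ‖ₑ ^ 2) atTop (𝓝 0) := by
  obtain ⟨a, n⟩ := p
  set B := integerBall ϖ a (n : ℤ) with hB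
  obtain ⟨N, hN⟩ := H.integerBall_exhaust a
  have hsub : B ⊆ integerBall ϖ 0 (-(N : ℤ)) := by
    rw [H.integerBall_eq_of_mem (hN N le_rfl)]
    exact H.integerBall_mono a (by omega)
  set Φ : K → ℝ≥0∞ := fun y => ∑' k, ‖φ (y - u k)‖ₑ ^ 2 with hΦ
  have hmeas : ∀ k, AEMeasurable (fun y => ‖φ (y - u k)‖ₑ ^ 2) μ := fun k =>
    ((hφ.comp_measurePreserving (measurePreserving_sub_right μ (u k))).1.enorm).pow_const 2
  have hΦint : ∫⁻ y in (𝒪[K] : Set K), Φ y ∂μ ≠ ∞ := by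
    rw [hΦ, lintegral_tsum fun k => (hmeas k).restrict,
      ← H.lintegral_eq_tsum μ fun x => ‖φ x‖ₑ ^ 2]
    exact (eLpNorm_two_lt_top_iff.1 hφ.2).ne
  -- the Cauchy–Schwarz inequality on the ball
  have hCS : ∀ i k : ℕ, ‖⟪(H.memLp_dilate μ hμ (-(i : ℤ)) k hφ).toLp
      (dilate q ϖ u (-(i : ℤ)) k φ), H.ballIndicator μ hμ (a, n)⟫_ℂ‖ₑ ^ 2 ≤
        ‖H.ballIndicator μ hμ (a, n)‖ₑ ^ 2 *
          ∫⁻ y in integerBall ϖ 0 ((i : ℤ) + -(N : ℤ)), ‖φ (y - u k)‖ₑ ^ 2 ∂μ := by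
    intro i k
    have hD := H.memLp_dilate μ hμ (-(i : ℤ)) k hφ
    have hI := hD.indicator (measurableSet_integerBall ϖ (0 : K) (-(N : ℤ)))
    have h1 : ⟪hD.toLp _, H.ballIndicator μ hμ (a, n)⟫_ℂ =
        ⟪hI.toLp _, H.ballIndicator μ hμ (a, n)⟫_ℂ := by
      rw [ballIndicator, inner_toLp_toLp, inner_toLp_toLp]
      refine integral_congr_ae (ae_of_all _ fun x => ?_)
      simp only
      by_cases hx : x ∈ B
      · rw [Set.indicator_of_mem (hsub hx)]
      · rw [Set.indicator_of_notMem hx, zero_mul, zero_mul]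
    rw [h1, ← H.lintegral_integerBall_dilate μ hμ, mul_comm]
    have h2 : ∫⁻ x in integerBall ϖ 0 (-(N : ℤ)), ‖dilate q ϖ u (-(i : ℤ)) k φ x‖ₑ ^ 2 ∂μ =
        ‖hI.toLp _‖ₑ ^ 2 := by
      rw [enorm_toLp_sq, ← lintegral_indicator (measurableSet_integerBall _ _ _)]
      refine lintegral_congr fun x => ?_
      simp only [Set.indicator]
      split_ifs <;> simp
    rw [h2, ← mul_pow]
    refine pow_le_pow_left' ?_ 2
    rw [← ofReal_norm, ← ofReal_norm, ← ofReal_norm, ← ENNReal.ofReal_mul (norm_nonneg _)]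
    exact ENNReal.ofReal_le_ofReal (norm_inner_le_norm _ _)
  have hbound : ∀ i : ℕ, N ≤ i → ∑' k, ‖⟪(H.memLp_dilate μ hμ (-(i : ℤ)) k hφ).toLp
      (dilate q ϖ u (-(i : ℤ)) k φ), H.ballIndicator μ hμ (a, n)⟫_ℂ‖ₑ ^ 2 ≤
        ‖H.ballIndicator μ hμ (a, n)‖ₑ ^ 2 *
          ∫⁻ y in integerBall ϖ 0 ((i : ℤ) + -(N : ℤ)), Φ y ∂(μ.restrict (𝒪[K] : Set K)) := by
    intro i hi
    have h1 : integerBall ϖ 0 ((i : ℤ) + -(N : ℤ)) ⊆ (𝒪[K] : Set K) := by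
      rw [← integerBall_zero_zero ϖ]
      exact H.integerBall_mono 0 (by omega)
    rw [Measure.restrict_restrict (measurableSet_integerBall _ _ _), Set.inter_eq_left.2 h1, hΦ,
      lintegral_tsum fun k => (hmeas k).restrict, ← ENNReal.tsum_mul_left]
    exact ENNReal.tsum_le_tsum fun k => hCS i k
  have hmeas0 : Tendsto (fun i : ℕ => (μ.restrict (𝒪[K] : Set K))
      (integerBall ϖ 0 ((i : ℤ) + -(N : ℤ)))) atTop (𝓝 0) := by
    have h1 : Tendsto (fun i : ℕ => (q : ℝ≥0∞) ^ (N : ℤ) * ((q : ℝ≥0∞)⁻¹) ^ i) atTop (𝓝 0) := by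
      have h2 : (q : ℝ≥0∞)⁻¹ < 1 := by
        rw [ENNReal.inv_lt_one]
        exact_mod_cast lt_of_lt_of_le one_lt_two H.two_le
      have h3 := ENNReal.Tendsto.const_mul (a := (q : ℝ≥0∞) ^ (N : ℤ))
        (ENNReal.tendsto_pow_atTop_nhds_zero_of_lt_one h2)
        (Or.inr (ENNReal.zpow_ne_top H.q_ne_zero (ENNReal.natCast_ne_top q) _))
      rwa [mul_zero] at h3
    refine tendsto_of_tendsto_of_tendsto_of_le_of_le tendsto_const_nhds h1 (fun _ => zero_le)
      fun i => (Measure.restrict_apply_le _ _).trans ?_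
    rw [H.measure_integerBall μ hμ, neg_add, neg_neg, add_comm,
      ENNReal.zpow_add H.q_ne_zero (ENNReal.natCast_ne_top q), ENNReal.zpow_neg, zpow_natCast,
      zpow_natCast, ENNReal.inv_pow]
  have hlim := ENNReal.Tendsto.const_mul (a := ‖H.ballIndicator μ hμ (a, n)‖ₑ ^ 2)
    (tendsto_setLIntegral_zero hΦint hmeas0) (Or.inr (ENNReal.pow_ne_top enorm_ne_top))
  rw [mul_zero] at hlim
  refine tendsto_of_tendsto_of_tendsto_of_le_of_le' tendsto_const_nhds hlim
    (Eventually.of_forall fun _ => zero_le) ?_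
  filter_upwards [eventually_ge_atTop N] with i hi
  exact hbound i hi

end IsWaveletLattice

end Scaling

/-! ### The scaling function on small scales -/

section SmallScales

open scoped ENNReal InnerProductSpace

set_option linter.unusedSectionVars false

variable {K : Type*} [Field K] [ValuativeRel K] [TopologicalSpace K]
  [IsNonarchimedeanLocalField K] [MeasurableSpace K] [BorelSpace K]
  {ϖ : K} {χ : AddChar K Circle} {q : ℕ} {u : ℕ → K}

namespace IsWaveletLattice

variable (H : IsWaveletLattice ϖ χ q u)
include H

variable (μ : Measure K) [μ.IsAddHaarMeasure] (hμ : μ (𝒪[K] : Set K) = 1)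
include hμ

/-- By Plancherel's theorem, the coefficients of the indicator function of a ball with respect to
the dilates of `φ` on a smaller scale are the coefficients on `𝒪[K]` of a multiple of the
restriction of `conj φ̂` to a ball. -/
theorem inner_dilate_ballIndicator {φ : K → ℂ} (hφ : MemLp φ 2 μ) (a : K) (n m k : ℕ) :
    ⟪(H.memLp_dilate μ hμ ((n : ℤ) + m) k hφ).toLp (dilate q ϖ u ((n : ℤ) + m) k φ),
        H.ballIndicator μ hμ (a, n)⟫_ℂ =
      (((q : ℝ) ^ ((((n : ℤ) + m : ℤ) : ℝ) / 2) : ℝ) : ℂ) * (q : ℂ) ^ (-((n : ℤ) + m)) *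
        ∫ ξ in (𝒪[K] : Set K), (conj (χ (ϖ ^ (-((n : ℤ) + m)) * a * ξ) : ℂ) *
          ((q : ℂ) ^ (m : ℤ) * (integerBall ϖ 0 (m : ℤ)).indicator 1 ξ) *
            conj (fourierL2 μ ϖ χ φ ξ)) * (χ (u k * ξ) : ℂ) ∂μ := by
  set j : ℤ := (n : ℤ) + m with hj
  set b : K := ϖ ^ (-j) * a with hb
  set s : ℂ := (((q : ℝ) ^ ((j : ℝ) / 2) : ℝ) : ℂ) with hs
  have hF := H.isFourierL2_fourierL2 μ hμ hφ
  have htr : MemLp (fun x => φ (x - u k)) 2 μ :=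
    hφ.comp_measurePreserving (measurePreserving_sub_right μ (u k))
  have hball := H.isFourierL2_indicator μ hμ b (-(m : ℤ))
  rw [neg_neg] at hball
  have hpl := hball.integral_mul_conj H hμ (H.memLp_indicator_integerBall μ hμ b (-(m : ℤ))) htr
    (hF.comp_sub H (u k))
  rw [ballIndicator, inner_toLp_toLp]
  have h1 : ∀ x, (integerBall ϖ a (n : ℤ)).indicator (1 : K → ℂ) x *
      conj (dilate q ϖ u j k φ x) = s * ((integerBall ϖ b (-(m : ℤ))).indicator (1 : K → ℂ)
        (ϖ ^ (-j) * x - 0) * conj (φ (ϖ ^ (-j) * x - 0 - u k))) := by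
    intro x
    have h2 : ϖ ^ (-j) * x - 0 ∈ integerBall ϖ b (-(m : ℤ)) ↔ x ∈ integerBall ϖ a (n : ℤ) := by
      rw [mem_integerBall, mem_integerBall, sub_zero, hb, ← mul_sub, ← mul_assoc,
        ← zpow_add₀ H.ne_zero, hj]
      ring_nf
    rw [dilate, RingHom.map_mul, Complex.conj_ofReal]
    by_cases hx : x ∈ integerBall ϖ a (n : ℤ)
    · rw [Set.indicator_of_mem hx, Set.indicator_of_mem (h2.2 hx), sub_zero]
      simp only [Pi.one_apply, one_mul, hs]
    · rw [Set.indicator_of_notMem hx, Set.indicator_of_notMem fun h => hx (h2.1 h)]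
      ring
  simp_rw [h1]
  rw [integral_const_mul, H.integral_comp_affine μ hμ (-j) 0
    fun y => (integerBall ϖ b (-(m : ℤ))).indicator (1 : K → ℂ) y * conj (φ (y - u k)),
    ← hpl, ← mul_assoc]
  congr 1
  rw [setIntegral_eq_integral_of_forall_compl_eq_zero]
  · refine integral_congr_ae (ae_of_all _ fun ξ => ?_)
    simp only
    rw [RingHom.map_mul, Complex.conj_conj]
    ring
  · intro ξ hξ
    have h2 : ξ ∉ integerBall ϖ 0 (m : ℤ) := fun h => hξ (by
      rw [← integerBall_zero_zero ϖ]
      exact H.integerBall_mono 0 (by omega) h)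
    rw [Set.indicator_of_notMem h2]
    ring

theorem tsum_inner_dilate_ballIndicator {φ : K → ℂ} (hφ : MemLp φ 2 μ) (a : K) (n m : ℕ) :
    ∑' k, ‖⟪(H.memLp_dilate μ hμ ((n : ℤ) + m) k hφ).toLp (dilate q ϖ u ((n : ℤ) + m) k φ),
        H.ballIndicator μ hμ (a, n)⟫_ℂ‖ₑ ^ 2 =
      (q : ℝ≥0∞) ^ (-(n : ℤ)) *
        ∫⁻ ξ in (𝒪[K] : Set K), ‖fourierL2 μ ϖ χ φ (ϖ ^ m * ξ)‖ₑ ^ 2 ∂μ := by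
  have hF := (H.isFourierL2_fourierL2 μ hμ hφ).1
  set g := fourierL2 μ ϖ χ φ with hg
  have hq0 := H.q_ne_zero
  have hqt := ENNReal.natCast_ne_top q
  have henorm : ∀ j : ℤ, ‖(q : ℂ) ^ j‖ₑ = (q : ℝ≥0∞) ^ j := by
    intro j
    have h1 : (q : NNReal) ≠ 0 := by exact_mod_cast H.q_pos.ne'
    rw [enorm_eq_nnnorm, nnnorm_zpow, ← ENNReal.coe_natCast, ← ENNReal.coe_zpow h1]
    congr 2
    simp
  simp_rw [H.inner_dilate_ballIndicator μ hμ hφ, enorm_mul, mul_pow, H.enorm_dilate_factor_sq]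
  rw [ENNReal.tsum_mul_left, H.tsum_enorm_setIntegral_char μ hμ]
  · have h1 : ∀ ξ, ‖conj (χ (ϖ ^ (-((n : ℤ) + m)) * a * ξ) : ℂ) *
        ((q : ℂ) ^ (m : ℤ) * (integerBall ϖ 0 (m : ℤ)).indicator 1 ξ) * conj (g ξ)‖ₑ ^ 2 =
          ((q : ℝ≥0∞) ^ (m : ℤ)) ^ 2 *
            (integerBall ϖ 0 (m : ℤ)).indicator (fun ξ => ‖g ξ‖ₑ ^ 2) ξ := by
      intro ξ
      have h2 : ‖conj (χ (ϖ ^ (-((n : ℤ) + m)) * a * ξ) : ℂ)‖ₑ = 1 := by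
        rw [← ofReal_norm, RCLike.norm_conj, Circle.norm_coe, ENNReal.ofReal_one]
      have h3 : ‖conj (g ξ)‖ₑ = ‖g ξ‖ₑ := by
        rw [← ofReal_norm, RCLike.norm_conj, ofReal_norm]
      rw [enorm_mul, enorm_mul, enorm_mul, h2, h3, henorm, one_mul, mul_pow, mul_pow]
      by_cases hξ : ξ ∈ integerBall ϖ 0 (m : ℤ)
      · rw [Set.indicator_of_mem hξ, Set.indicator_of_mem hξ]
        simp
      · rw [Set.indicator_of_notMem hξ, Set.indicator_of_notMem hξ]
        simp
    simp_rw [← hg, h1]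
    rw [lintegral_const_mul' _ _ (ENNReal.pow_ne_top (ENNReal.zpow_ne_top hq0 hqt _)),
      henorm]
    have h4 : ∫⁻ ξ in (𝒪[K] : Set K),
        (integerBall ϖ 0 (m : ℤ)).indicator (fun ξ => ‖g ξ‖ₑ ^ 2) ξ ∂μ =
          ∫⁻ ξ, (integerBall ϖ 0 (m : ℤ)).indicator (fun ξ => ‖g ξ‖ₑ ^ 2) ξ ∂μ := by
      rw [← lintegral_indicator measurableSet_integer]
      refine lintegral_congr fun ξ => ?_
      rw [Set.indicator_indicator, Set.inter_eq_right.2]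
      rw [← integerBall_zero_zero ϖ]
      exact H.integerBall_mono 0 (by omega)
    have h5 := H.lintegral_comp_affine μ hμ (m : ℤ) 0
      ((integerBall ϖ 0 (m : ℤ)).indicator fun ξ => ‖g ξ‖ₑ ^ 2)
    have h6 : ∫⁻ x, (integerBall ϖ 0 (m : ℤ)).indicator (fun ξ => ‖g ξ‖ₑ ^ 2)
        (ϖ ^ (m : ℤ) * x - 0) ∂μ = ∫⁻ ξ in (𝒪[K] : Set K), ‖g (ϖ ^ m * ξ)‖ₑ ^ 2 ∂μ := by
      rw [← lintegral_indicator measurableSet_integer]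
      refine lintegral_congr fun ξ => ?_
      have h7 : ϖ ^ (m : ℤ) * ξ - 0 ∈ integerBall ϖ 0 (m : ℤ) ↔ ξ ∈ (𝒪[K] : Set K) := by
        rw [mem_integerBall, sub_zero, sub_zero, ← mul_assoc, ← zpow_add₀ H.ne_zero,
          neg_add_cancel, zpow_zero, one_mul]
        rfl
      by_cases hξ : ξ ∈ (𝒪[K] : Set K)
      · rw [Set.indicator_of_mem hξ, Set.indicator_of_mem (h7.2 hξ), sub_zero, zpow_natCast]
      · rw [Set.indicator_of_notMem hξ, Set.indicator_of_notMem fun h => hξ (h7.1 h)]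
    rw [h4, ← h6, h5]
    simp only [← mul_assoc]
    congr 1
    simp only [sq, ← ENNReal.zpow_add hq0 hqt]
    congr 1
    ring
  · refine ((hF.restrict (𝒪[K] : Set K)).const_mul ((q : ℂ) ^ (m : ℤ))).of_le
      ?_ (ae_of_all _ fun ξ => ?_)
    · have hc : Continuous fun ξ => conj (χ (ϖ ^ (-((n : ℤ) + m)) * a * ξ) : ℂ) := by
        have := H.continuous
        fun_prop
      exact (hc.measurable.aestronglyMeasurable.mul (((measurable_const.indicator
        (measurableSet_integerBall _ _ _)).const_mul _).aestronglyMeasurable)).mul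
          (Complex.continuous_conj.comp_aestronglyMeasurable hF.1.restrict)
    · rw [norm_mul, norm_mul, norm_mul, norm_mul, RCLike.norm_conj, RCLike.norm_conj,
        Circle.norm_coe, one_mul]
      refine mul_le_mul_of_nonneg_right (mul_le_of_le_one_right (norm_nonneg _) ?_) (norm_nonneg _)
      simp only [Set.indicator]
      split_ifs <;> simp

/-- On small scales the dilates of `φ` capture the indicator function of a ball: this is
the condition `|φ̂(ϖ ^ j ξ)| → 1`, integrated over `𝒪[K]`, where `|φ̂| ≤ 1` by the first condition
on `φ`. -/
theorem tendsto_tsum_dilate_norm {φ : K → ℂ} (hφ : MemLp φ 2 μ) (hMRA : GeneratesMRA μ ϖ χ u φ)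
    (p : K × ℕ) :
    Tendsto (fun i : ℕ => ∑' k,
      ‖⟪(H.memLp_dilate μ hμ (i : ℤ) k hφ).toLp (dilate q ϖ u (i : ℤ) k φ),
        H.ballIndicator μ hμ p⟫_ℂ‖ₑ ^ 2) atTop (𝓝 (‖H.ballIndicator μ hμ p‖ₑ ^ 2)) := by
  obtain ⟨a, n⟩ := p
  have := H.isProbabilityMeasure μ hμ
  have hF := (H.isFourierL2_fourierL2 μ hμ hφ).1
  set g := fourierL2 μ ϖ χ φ with hg
  have hqmp : ∀ m : ℕ, Measure.QuasiMeasurePreserving (fun x => ϖ ^ m * x)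
      (μ.restrict (𝒪[K] : Set K)) (μ.restrict (𝒪[K] : Set K)) := by
    intro m
    have h1 := (H.quasiMeasurePreserving_prime_mul μ hμ).iterate m
    rwa [mul_left_iterate] at h1
  have hle : ∀ᵐ ξ ∂(μ.restrict (𝒪[K] : Set K)), ‖g ξ‖ₑ ^ 2 ≤ 1 := by
    filter_upwards [hMRA.1] with ξ hξ
    have h1 := hξ.summable.le_tsum 0 fun k _ => sq_nonneg _
    rw [hξ.tsum_eq, H.map_zero, sub_zero] at h1
    rw [enorm_sq_eq_ofReal]
    exact ENNReal.ofReal_le_one.2 h1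
  have hlim : Tendsto (fun m : ℕ => ∫⁻ ξ in (𝒪[K] : Set K), ‖g (ϖ ^ m * ξ)‖ₑ ^ 2 ∂μ) atTop
      (𝓝 (∫⁻ _ in (𝒪[K] : Set K), 1 ∂μ)) := by
    refine tendsto_lintegral_of_dominated_convergence' (fun _ => 1) (fun m => ?_)
      (fun m => (hqmp m).ae hle) ?_ ?_
    · exact (hF.1.restrict.comp_quasiMeasurePreserving (hqmp m)).enorm.pow_const 2
    · rw [lintegral_one, measure_univ]
      exact ENNReal.one_ne_top
    · filter_upwards [ae_restrict_of_ae hMRA.2] with ξ hξ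
      have h1 := ENNReal.tendsto_ofReal (hξ.pow 2)
      rw [one_pow, ENNReal.ofReal_one] at h1
      exact h1.congr fun m => (enorm_sq_eq_ofReal _).symm
  rw [lintegral_one, measure_univ] at hlim
  have h1 := ENNReal.Tendsto.const_mul (a := (q : ℝ≥0∞) ^ (-(n : ℤ))) hlim
    (Or.inr (ENNReal.zpow_ne_top H.q_ne_zero (ENNReal.natCast_ne_top q) _))
  rw [mul_one] at h1
  rw [H.enorm_ballIndicator_sq μ hμ, ← tendsto_add_atTop_iff_nat n]
  refine h1.congr fun m => ?_
  rw [← H.tsum_inner_dilate_ballIndicator μ hμ hφ a n m]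
  have h2 : ((m + n : ℕ) : ℤ) = (n : ℤ) + m := by push_cast; ring
  rw [h2]

end IsWaveletLattice

end SmallScales

/-! ### The wavelet system -/

section Wavelets

open scoped ENNReal InnerProductSpace

set_option linter.unusedSectionVars false

/-- Telescoping over `ℤ` for functions with values in `ℝ≥0∞`. -/
theorem ENNReal.tsum_int_of_add_eq {S W : ℤ → ℝ≥0∞} {y : ℝ≥0∞} (h : ∀ j, S j + W j = S (j + 1))
    (h0 : Tendsto (fun i : ℕ => S (-(i : ℤ))) atTop (𝓝 0))
    (h1 : Tendsto (fun i : ℕ => S i) atTop (𝓝 y)) : ∑' j, W j = y := by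
  have htel : ∀ N : ℕ, S (-(N : ℤ)) + ∑ j ∈ Finset.Ico (-(N : ℤ)) N, W j = S N := by
    have haux : ∀ (a : ℤ) (M : ℕ), S a + ∑ j ∈ Finset.Ico a (a + M), W j = S (a + M) := by
      intro a M
      induction M with
      | zero => simp
      | succ M ih =>
        have h2 : a + ((M + 1 : ℕ) : ℤ) = a + M + 1 := by push_cast; ring
        rw [h2, ← Finset.sum_Ico_add_eq_sum_Ico_add_one (by omega), ← h, ← ih]
        ring
    intro N
    have h2 := haux (-(N : ℤ)) (2 * N)
    have h3 : -(N : ℤ) + ((2 * N : ℕ) : ℤ) = N := by push_cast; ring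
    rwa [h3] at h2
  have h2 : Tendsto (fun N : ℕ => ∑ j ∈ Finset.Ico (-(N : ℤ)) N, W j) atTop (𝓝 (∑' j, W j)) :=
    (ENNReal.summable (f := W)).hasSum.comp (Finset.tendsto_Ico_neg (R := ℤ))
  have h3 := h0.add h2
  simp_rw [htel] at h3
  rw [zero_add] at h3
  exact tendsto_nhds_unique h3 h1

variable {K : Type*} [Field K] [ValuativeRel K] [TopologicalSpace K]
  [IsNonarchimedeanLocalField K] [MeasurableSpace K] [BorelSpace K]
  {ϖ : K} {χ : AddChar K Circle} {q : ℕ} {u : ℕ → K}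

namespace IsWaveletLattice

variable (H : IsWaveletLattice ϖ χ q u)
include H

variable (μ : Measure K) [μ.IsAddHaarMeasure] (hμ : μ (𝒪[K] : Set K) = 1)
include hμ

variable {L : ℕ} {φ : K → ℂ} {ψ : Fin L → K → ℂ} {h : Fin (L + 1) → ℕ → ℂ}

/-- One step of the decomposition: the Bessel sum of the dilates of `φ` on one scale splits into
the sum of the dilates of `φ` and the sum of the wavelets on the next coarser scale. -/
theorem tsum_inner_dilate_add (hφ : SatisfiesTwoScale μ q ϖ u φ (h 0) φ)
    (hMRA : GeneratesMRA μ ϖ χ u φ)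
    (hψ : ∀ ℓ : Fin L, SatisfiesTwoScale μ q ϖ u φ (h ℓ.succ) (ψ ℓ))
    (hΓ : ∀ᵐ ξ ∂(μ.restrict (𝒪[K] : Set K)),
      polyphaseMatrix μ q χ u h ξ * (polyphaseMatrix μ q χ u h ξ)ᴴ = 1) (f : Lp ℂ 2 μ) (j : ℤ) :
    ∑' m, ‖⟪(H.memLp_dilate μ hμ j m hφ.1).toLp (dilate q ϖ u j m φ), f⟫_ℂ‖ₑ ^ 2 +
      ∑ ℓ, ∑' m, ‖⟪(H.memLp_dilate μ hμ j m (hψ ℓ).1).toLp (dilate q ϖ u j m (ψ ℓ)), f⟫_ℂ‖ₑ ^ 2 =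
    ∑' k, ‖⟪(H.memLp_dilate μ hμ (j + 1) k hφ.1).toLp (dilate q ϖ u (j + 1) k φ), f⟫_ℂ‖ₑ ^ 2 := by
  have horth := H.orthonormal_dilate μ hμ hφ.1 hMRA
  have h0 := H.twoScale_dilate μ hμ hφ.1 horth hφ
  have hs := fun ℓ => H.twoScale_dilate μ hμ hφ.1 horth (hψ ℓ)
  have hcoef : ∀ {g : K → ℂ} (hg : MemLp g 2 μ) {a : ℕ → ℂ} {m : ℕ},
      HasSum (fun k => a k • (H.memLp_dilate μ hμ (j + 1) (H.addIndex (q * m) k) hφ.1).toLp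
        (dilate q ϖ u (j + 1) (H.addIndex (q * m) k) φ))
        ((H.memLp_dilate μ hμ j m hg).toLp (dilate q ϖ u j m g)) →
      ⟪(H.memLp_dilate μ hμ j m hg).toLp (dilate q ϖ u j m g), f⟫_ℂ =
        ∑' k, conj (a k) * ⟪(H.memLp_dilate μ hμ (j + 1) (H.addIndex (q * m) k) hφ.1).toLp
          (dilate q ϖ u (j + 1) (H.addIndex (q * m) k) φ), f⟫_ℂ := by
    intro g hg a m hsum
    have h1 := (hsum.mapL (innerSL ℂ f)).map (starRingEnd ℂ) Complex.continuous_conj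
    simp only [Function.comp_def, innerSL_apply_apply, inner_smul_right, RingHom.map_mul,
      inner_conj_symm] at h1
    exact h1.tsum_eq.symm
  have hpoly := H.sum_tsum_enorm_sq_polyphase μ hμ (h := h)
    (Fin.cases h0.1 fun ℓ => (hs ℓ).1) hΓ ((horth (j + 1)).inner_products_summable f)
  rw [Fin.sum_univ_succ] at hpoly
  rw [← hpoly]
  congr 1
  · exact tsum_congr fun m => by rw [hcoef hφ.1 (h0.2 j m)]
  · exact Finset.sum_congr rfl fun ℓ _ => tsum_congr fun m => by
      rw [hcoef (hψ ℓ).1 ((hs ℓ).2 j m)]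

/-- The unitary extension principle: the wavelets satisfy Parseval's identity. -/
theorem tsum_enorm_inner_wavelet (hφ : SatisfiesTwoScale μ q ϖ u φ (h 0) φ)
    (hMRA : GeneratesMRA μ ϖ χ u φ)
    (hψ : ∀ ℓ : Fin L, SatisfiesTwoScale μ q ϖ u φ (h ℓ.succ) (ψ ℓ))
    (hΓ : ∀ᵐ ξ ∂(μ.restrict (𝒪[K] : Set K)),
      polyphaseMatrix μ q χ u h ξ * (polyphaseMatrix μ q χ u h ξ)ᴴ = 1) (f : Lp ℂ 2 μ) :
    ∑' j, ∑ ℓ, ∑' m,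
      ‖⟪(H.memLp_dilate μ hμ j m (hψ ℓ).1).toLp (dilate q ϖ u j m (ψ ℓ)), f⟫_ℂ‖ₑ ^ 2 =
        ‖f‖ₑ ^ 2 := by
  have horth := H.orthonormal_dilate μ hμ hφ.1 hMRA
  refine ENNReal.tsum_int_of_add_eq
    (fun j => H.tsum_inner_dilate_add μ hμ hφ hMRA hψ hΓ f j) ?_ ?_
  · refine tendsto_tsum_inner_zero (fun i : ℕ => horth (-(i : ℤ))) (H.span_ballIndicator μ hμ) ?_ f
    rintro _ ⟨p, rfl⟩
    exact H.tendsto_tsum_dilate_zero μ hμ hφ.1 p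
  · refine tendsto_tsum_inner_norm (fun i : ℕ => horth (i : ℤ)) (H.span_ballIndicator μ hμ) ?_ f
    rintro _ ⟨p, rfl⟩
    exact H.tendsto_tsum_dilate_norm μ hμ hφ.1 hMRA p

theorem isParsevalFrame_waveletSystem (hφ : SatisfiesTwoScale μ q ϖ u φ (h 0) φ)
    (hMRA : GeneratesMRA μ ϖ χ u φ)
    (hψ : ∀ ℓ : Fin L, SatisfiesTwoScale μ q ϖ u φ (h ℓ.succ) (ψ ℓ))
    (hΓ : ∀ᵐ ξ ∂(μ.restrict (𝒪[K] : Set K)),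
      polyphaseMatrix μ q χ u h ξ * (polyphaseMatrix μ q χ u h ξ)ᴴ = 1) :
    IsParsevalFrame μ (waveletSystem q ϖ u ψ) := by
  have hmem : ∀ i, MemLp (waveletSystem q ϖ u ψ i) 2 μ := fun i =>
    H.memLp_dilate μ hμ i.2.1 i.2.2 (hψ i.1).1
  refine ⟨one_pos, one_pos, hmem, fun f hf => ?_⟩
  have hsum : ∑' i, ‖⟪(hmem i).toLp (waveletSystem q ϖ u ψ i), hf.toLp f⟫_ℂ‖ₑ ^ 2 =
      ‖hf.toLp f‖ₑ ^ 2 := by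
    rw [← H.tsum_enorm_inner_wavelet μ hμ hφ hMRA hψ hΓ, ENNReal.tsum_prod', tsum_fintype]
    simp_rw [ENNReal.tsum_prod']
    rw [← Summable.tsum_finsetSum fun _ _ => ENNReal.summable]
    rfl
  have hHas : HasSum (fun i => ‖∫ x, f x * conj (waveletSystem q ϖ u ψ i x) ∂μ‖ ^ 2)
      (∫ x, ‖f x‖ ^ 2 ∂μ) := by
    simp_rw [← norm_toLp_sq hf, ← inner_toLp_toLp (hmem _) hf]
    simp_rw [enorm_sq_eq_ofReal] at hsum
    have h1 : Summable fun i =>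
        ‖⟪(hmem i).toLp (waveletSystem q ϖ u ψ i), hf.toLp f⟫_ℂ‖ ^ 2 := by
      refine (ENNReal.summable_toReal (f := fun i => ENNReal.ofReal
        (‖⟪(hmem i).toLp (waveletSystem q ϖ u ψ i), hf.toLp f⟫_ℂ‖ ^ 2)) ?_).congr fun i =>
          ENNReal.toReal_ofReal (sq_nonneg _)
      rw [hsum]
      exact ENNReal.ofReal_ne_top
    rw [← ENNReal.ofReal_tsum_of_nonneg (fun i => sq_nonneg _) h1] at hsum
    rw [← (ENNReal.ofReal_eq_ofReal_iff (tsum_nonneg fun i => sq_nonneg _) (sq_nonneg _)).1 hsum]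
    exact h1.hasSum
  rw [one_mul, hHas.tsum_eq]
  exact ⟨hHas.summable, le_rfl, le_rfl⟩

end IsWaveletLattice

end Wavelets

theorem theorem3p1 {K : Type*} [Field K] [ValuativeRel K] [TopologicalSpace K]
    [IsNonarchimedeanLocalField K] [MeasurableSpace K] [BorelSpace K]
    -- `K` has positive characteristic `t` and residue field with `q` elements
    (t : ℕ) [Fact t.Prime] [CharP K t] (q : ℕ) (hq : Nat.card 𝓀[K] = q)
    -- the Haar measure on `K`, normalized on the ring of integers
    (μ : Measure K) [μ.IsAddHaarMeasure] (hμ : μ (𝒪[K] : Set K) = 1)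
    (ϖ : K) (hϖ : IsPrimeElement ϖ)
    (c : ℕ) [NeZero c] (ζ : Fin c → K) (hζ : IsResidueBasis t q ζ)
    (χ : AddChar K Circle) (hχ : IsBasicCharacter t ζ ϖ χ)
    (L : ℕ) (φ : K → ℂ) (ψ : Fin L → K → ℂ) (h : Fin (L + 1) → ℕ → ℂ)
    (hφ : SatisfiesTwoScale μ q ϖ (translation t q ζ ϖ) φ (h 0) φ)
    (hMRA : GeneratesMRA μ ϖ χ (translation t q ζ ϖ) φ)
    (hψ : ∀ ℓ : Fin L, SatisfiesTwoScale μ q ϖ (translation t q ζ ϖ) φ (h ℓ.succ) (ψ ℓ))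
    (hΓ : ∀ᵐ ξ ∂(μ.restrict (𝒪[K] : Set K)),
      polyphaseMatrix μ q χ (translation t q ζ ϖ) h ξ *
        (polyphaseMatrix μ q χ (translation t q ζ ϖ) h ξ)ᴴ = 1) :
    IsTightFrame μ (waveletSystem q ϖ (translation t q ζ ϖ) ψ) ∧
      IsParsevalFrame μ (waveletSystem q ϖ (translation t q ζ ϖ) ψ) := by
  have H := hζ.isWaveletLattice hq hϖ hχ
  have hP := H.isParsevalFrame_waveletSystem μ hμ hφ hMRA hψ hΓ
  exact ⟨⟨1, hP⟩, hP⟩
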